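/- Let $d\ge 1$ and let $\mathcal H=[-\tfrac12,\tfrac12)^d$. For a probability density $f$ on $\mathcal H$ let $x_1,\dots,x_m$ be i.i.d. points of $\mathcal H$ with density $f$, and let $V$ be the $n^d\times m$ matrix, with rows labelled by $\ell\in\{0,\dots,n-1\}^d$, with entries $$V_{\ell,q}=m^{-1/2}\exp(-2\pi i\,\ell^{T}x_q).$$ Let $F^{(n,m)}_f(z)=n^{-d}\sum_{i}\mathbb E\big[1\{\lambda_i\le z\}\big]$ be the average empirical cumulative distribution of the $n^d$ eigenvalues $\lambda_i$ of $VV^{\mathsf H}$. For $\beta>0$, a probability measure $f_{\lambda}(d,\beta,\cdot)$ on $\mathbb R$ is called the limiting spectral distribution (LSD) for $f$ at ratio $\beta$ if, as $n,m\to\infty$ with $n^d/m\to\beta$, $F^{(n,m)}_f$ converges to its cumulative distribution function at every continuity point of the latter. It is written as a generalized density. Let $f_x$ be a probability density on $\mathcal H$ with $f_x(z)>0$ for all $z\in\mathcal H$. Let $C\subseteq\mathcal H$ be measurable with $c=|C|>0$, and let $f_{x'}$ be a scaled version of $f_x$ supported on $C$: $$f_{x'}(z)=\begin{cases}\frac1c\,f_x(S(z)),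 & z\in C,\\ 0,& z\in\mathcal H\setminus C,\end{cases}$$ where $S:C\to\mathcal H$ is a measurable rescaling of $C$ onto $\mathcal H$ that multiplies volumes by $1/c$, in the sense that $|\{z\in C: S(z)\in B\}|=c\,|B|$ for every measurable $B\subseteq\mathcal H$. (For example, $C=c^{1/d}\mathcal H$ and $S(z)=z/c^{1/d}$, which is $S(z)=z/c$ when $d=1$.) Then $f_{x'}$ is a probability density on $\mathcal H$, and for every $\beta>0$ the LSD $f_{\lambda,x}(d,c\beta,\cdot)$ for $f_x$ at ratio $c\beta$ exists, the LSD $f_{\lambda,x'}(d,\beta,\cdot)$ for $f_{x'}$ at ratio $\beta$ exists, and $$f_{\lambda,x'}(d,\beta,z)=(1-c)\,\delta(z)+c^2 f_{\lambda,x}(d,c\beta,cz)$$ as an identity of generalized densities. Equivalently, the LSD for $f_{x'}$ at ratio $\beta$ is $(1-c)\delta_0+c\,\mathrm{Law}(\lambda/c)$, where $\lambda$ is distributed according to the LSD for $f_x$ at ratio $c\beta$. -/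

import Mathlib

open MeasureTheory Filter Topology

/-- The sampling region `𝓗 = [-1/2, 1/2)^d`. -/
def cube (d : ℕ) : Set (Fin d → ℝ) :=
  Set.univ.pi fun _ => Set.Ico (-(1 / 2 : ℝ)) (1 / 2)

/-- `f` is a probability density with respect to Lebesgue measure on `𝓗`
(its values outside `𝓗` play no role). -/
structure IsDensityOnCube {d : ℕ} (f : (Fin d → ℝ) → ℝ) : Prop where
  aemeasurable : AEMeasurable f (volume.restrict (cube d))
  nonneg : ∀ z ∈ cube d, 0 ≤ f z
  lintegral_eq_one : ∫⁻ z in cube d, ENNReal.ofReal (f z) = 1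

/-- The law on `𝓗` with density `f`. -/
noncomputable def pointLaw {d : ℕ} (f : (Fin d → ℝ) → ℝ) : Measure (Fin d → ℝ) :=
  (volume.restrict (cube d)).withDensity fun z => ENNReal.ofReal (f z)

/-- The `d`-fold `n^d × m` Vandermonde matrix of the sampling points `x_1, …, x_m`, with entries
`m^{-1/2} exp(-2πi ℓᵀ x_q)`. The rows are labelled directly by `ℓ ∈ {0, …, n-1}^d`. -/
noncomputable def vandermondeFold (d n m : ℕ) (x : Fin m → Fin d → ℝ) :
    Matrix (Fin d → Fin n) (Fin m) ℂ :=
  Matrix.of fun l q =>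
    ((Real.sqrt m : ℝ) : ℂ)⁻¹ *
      Complex.exp (-2 * Real.pi * Complex.I * ((∑ j, ((l j : ℕ) : ℝ) * x q j : ℝ) : ℂ))

/-- The eigenvalues (with multiplicity) of the Hermitian matrix `V Vᴴ`. -/
noncomputable def gramEigenvalue (d n m : ℕ) (x : Fin m → Fin d → ℝ) (i : Fin d → Fin n) : ℝ :=
  (Matrix.isHermitian_mul_conjTranspose_self (vandermondeFold d n m x)).eigenvalues i

/-- The average empirical cumulative distribution of the eigenvalues of `V Vᴴ`,
`F(z) = n^{-d} ∑_i 𝔼[1{λ_i ≤ z}]`, when the points `x_1, …, x_m` are i.i.d. with density `f`. -/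
noncomputable def meanSpectralCDF {d : ℕ} (f : (Fin d → ℝ) → ℝ) (n m : ℕ) (z : ℝ) : ℝ :=
  ((n : ℝ) ^ d)⁻¹ * ∑ i : Fin d → Fin n,
    (Measure.pi fun _ : Fin m => pointLaw f).real {x | gramEigenvalue d n m x i ≤ z}

/-- The regime `n, m → ∞` with `β_{n,m} = n^d / m → β`, for the pair `(n, m)`. -/
noncomputable def aspectFilter (d : ℕ) (β : ℝ) : Filter (ℕ × ℕ) :=
  (atTop ×ˢ atTop) ⊓ comap (fun p : ℕ × ℕ => (p.1 : ℝ) ^ d / (p.2 : ℝ)) (𝓝 β)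

/-- `μ` is the limiting spectral distribution of `V Vᴴ` for points with density `f` and aspect
ratio `β`: the average empirical cumulative distributions converge, at every continuity point of
the limit, to the cumulative distribution function of the probability measure `μ`. -/
structure IsLSD {d : ℕ} (f : (Fin d → ℝ) → ℝ) (β : ℝ) (μ : Measure ℝ) : Prop where
  isProbabilityMeasure : IsProbabilityMeasure μ
  tendsto_cdf : ∀ z : ℝ, μ {z} = 0 →
    Tendsto (fun p : ℕ × ℕ => meanSpectralCDF f p.1 p.2 z) (aspectFilter d β)
      (𝓝 (μ.real (Set.Iic z)))

/-- If `μ` has the (generalized) density `g`, this is the measure with the (generalized) density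
`z ↦ g (c z)`, for `c > 0`; in particular `δ(c z) = c⁻¹ δ(z)`. -/
noncomputable def dilatedDensity (c : ℝ) (μ : Measure ℝ) : Measure ℝ :=
  ENNReal.ofReal c⁻¹ • μ.map fun t => t / c

/-- `f'` is the scaled version of `f` on `C`: it vanishes on `𝓗 \ C`, and on `C` it is
`|C|⁻¹ f (S z)`, where `S : C → 𝓗` rescales `C` onto `𝓗`, i.e. `S` multiplies volumes by
`|C|⁻¹`. -/
def IsScaledVersion {d : ℕ} (f f' : (Fin d → ℝ) → ℝ) (C : Set (Fin d → ℝ)) : Prop :=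
  ∃ S : (Fin d → ℝ) → (Fin d → ℝ),
    Set.MapsTo S C (cube d) ∧
    MeasurePreserving S (volume.restrict C) (volume C • volume.restrict (cube d)) ∧
    (∀ z ∈ C, f' z = (volume.real C)⁻¹ * f (S z)) ∧
    ∀ z ∈ cube d \ C, f' z = 0

/-- The basic case: `C = r 𝓗` with `0 < r ≤ 1`, so that `|C| = r^d`, and
`f' z = |C|⁻¹ f (z / r) = |C|⁻¹ f (z / |C|^{1/d})` on `C`. -/
theorem isScaledVersion_dilate {d : ℕ} (f : (Fin d → ℝ) → ℝ) {r : ℝ} (hr : 0 < r) :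
    IsScaledVersion f
      (((fun z => r⁻¹ • z) ⁻¹' cube d).indicator fun z => (r ^ d)⁻¹ * f (r⁻¹ • z))
      ((fun z => r⁻¹ • z) ⁻¹' cube d) := by
  have hcube : volume (cube d) = 1 := by
    rw [cube, Real.volume_pi_Ico]
    norm_num
  have hmeas : MeasurableSet (cube d) := by
    unfold cube
    exact MeasurableSet.univ_pi fun _ => measurableSet_Ico
  have hS : Measurable fun z : Fin d → ℝ => r⁻¹ • z := measurable_const_smul _
  have hri : r⁻¹ ≠ 0 := inv_ne_zero hr.ne'
  have hvol : volume ((fun z : Fin d → ℝ => r⁻¹ • z) ⁻¹' cube d) = ENNReal.ofReal (r ^ d) := by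
    rw [Measure.addHaar_preimage_smul volume hri, hcube]
    simp [abs_of_pos hr]
  have hmap : Measure.map (fun z : Fin d → ℝ => r⁻¹ • z) volume
      = ENNReal.ofReal (r ^ d) • volume := by
    rw [Measure.map_addHaar_smul volume hri]
    simp [abs_of_pos hr]
  refine ⟨fun z => r⁻¹ • z, fun z hz => hz, ⟨hS, ?_⟩, ?_, ?_⟩
  · rw [← Measure.restrict_map hS hmeas, hmap, hvol, Measure.restrict_smul]
  · intro z hz
    rw [Set.indicator_of_mem hz, measureReal_def, hvol, ENNReal.toReal_ofReal (by positivity)]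
  · intro z hz
    exact Set.indicator_of_notMem hz.2 _

/-! For s > 0 let T_s be the normalised expectation of tr(sVVᴴ(1 + sVVᴴ)⁻¹), that is, the integral
of the test function `ridge s` against the mean eigenvalue law. The theorem follows from a formula
for its limit: for every density f at ratio β, T_s tends to the integral over the cube of `limDof d
(s * β) (f z / β)`, where limDof(t, ρ) is the limit for ρ n^d uniform points of weight t / n^d
(`IsDensityOnCube.exists_isLSD`). So the limit sees only the distribution of the values of f. For f'
the integrand vanishes off C because limDof(t, 0) = 0. On C the change of variables S yields c times
the integral of limDof(sβ, f / (cβ)), which is c times the limit for f at ratio cβ with parameter s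
/ c, since (s / c)(cβ) = sβ. This is also the ridge integral of (1 - c)δ₀ + c Law(λ / c), and ridge
integrals determine a law on the half line (`ext_of_integral_ridge`).

The formula holds because the Gram kernel of the phases, a product of Dirichlet kernels, is
concentrated near the diagonal. Cut the cube into k^d cells. In mean square, and uniformly in k, the
kernel of (kn)^d frequencies is close to one that couples only points of the same cell, where it is
k^d times the kernel of n^d frequencies in the relative positions
(`sum_integral_norm_sq_boxKernel_sub_le`). The degrees of freedom tr(A(1 + A)⁻¹) are stable in
Hilbert–Schmidt distance (`abs_dof_sub_dof_le`), additive over blocks (`dof_sum_of_mul_eq_zero`),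
and move by at most one per point (`dof_add_vecMulVec`), so the random cell counts may be replaced
by their means. For the uniform law this self-similarity makes the normalised values a Cauchy
sequence (`cauchySeq_normDof`) and so defines limDof; for piecewise constant densities it gives the
formula (`tendsto_phaseDof_stepLaw`). A general density is replaced by its cell averages, close in
L¹, at a cost of the L¹ error per point (`abs_integral_pi_sub_le`).

No moments of VVᴴ beyond the first are computed. The trace of VVᴴ is deterministic, so the mean laws
are tight, and convergence of all ridge integrals forces weak convergence
(`exists_tendsto_of_tendsto_integral_ridge`). -/

/-- The effective number of degrees of freedom `tr (A (1 + A)⁻¹)` of a positive semidefinite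
matrix `A`. -/
noncomputable def dof {a : Type*} [Fintype a] [DecidableEq a] (A : Matrix a a ℂ) : ℝ :=
  (Matrix.trace (1 - (1 + A)⁻¹)).re

/-! ### Degrees of freedom: duality, rank-one updates, stability and additivity. -/

section dof

open Matrix ComplexOrder

variable {a b : Type*} [Fintype a] [DecidableEq a] [Fintype b] [DecidableEq b]

omit [Fintype a] in
theorem posDef_one_add {A : Matrix a a ℂ} (hA : A.PosSemidef) : (1 + A).PosDef :=
  Matrix.PosDef.one.add_posSemidef hA

theorem one_add_mul_inv {A : Matrix a a ℂ} (hA : A.PosSemidef) : (1 + A) * (1 + A)⁻¹ = 1 :=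
  Matrix.mul_nonsing_inv _ ((Matrix.isUnit_iff_isUnit_det _).1 (posDef_one_add hA).isUnit)

theorem inv_mul_one_add {A : Matrix a a ℂ} (hA : A.PosSemidef) : (1 + A)⁻¹ * (1 + A) = 1 :=
  Matrix.nonsing_inv_mul _ ((Matrix.isUnit_iff_isUnit_det _).1 (posDef_one_add hA).isUnit)

theorem inv_one_add_posSemidef {A : Matrix a a ℂ} (hA : A.PosSemidef) :
    ((1 + A)⁻¹).PosSemidef := (posDef_one_add hA).inv.posSemidef

theorem mul_inv_one_add {A : Matrix a a ℂ} (hA : A.PosSemidef) :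
    A * (1 + A)⁻¹ = 1 - (1 + A)⁻¹ := by
  have h := one_add_mul_inv hA
  rw [add_mul, one_mul] at h
  exact eq_sub_of_add_eq' h

theorem inv_one_add_mul {A : Matrix a a ℂ} (hA : A.PosSemidef) :
    (1 + A)⁻¹ * A = 1 - (1 + A)⁻¹ := by
  have h := inv_mul_one_add hA
  rw [mul_add, mul_one] at h
  exact eq_sub_of_add_eq' h

/-- Push-through identity (1 + MMᴴ)⁻¹M = M(1 + MᴴM)⁻¹ and cyclicity of the trace. It exchanges the
frequency side of the problem for the point side, where the matrix is a kernel evaluated at pairs of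
points. -/
theorem dof_mul_conjTranspose_comm (M : Matrix a b ℂ) : dof (M * Mᴴ) = dof (Mᴴ * M) := by
  have h1 := posSemidef_self_mul_conjTranspose M
  have h2 := posSemidef_conjTranspose_mul_self M
  have hpush : (1 + M * Mᴴ)⁻¹ * M = M * (1 + Mᴴ * M)⁻¹ := by
    calc (1 + M * Mᴴ)⁻¹ * M
        = (1 + M * Mᴴ)⁻¹ * M * ((1 + Mᴴ * M) * (1 + Mᴴ * M)⁻¹) := by
          rw [one_add_mul_inv h2, Matrix.mul_one]
      _ = (1 + M * Mᴴ)⁻¹ * ((1 + M * Mᴴ) * M) * (1 + Mᴴ * M)⁻¹ := by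
          simp only [Matrix.mul_assoc, Matrix.add_mul, Matrix.mul_add, Matrix.one_mul]
      _ = M * (1 + Mᴴ * M)⁻¹ := by
          rw [← Matrix.mul_assoc (1 + M * Mᴴ)⁻¹, inv_mul_one_add h1, Matrix.one_mul]
  unfold dof
  rw [← inv_one_add_mul h1, ← mul_inv_one_add h2, ← Matrix.mul_assoc, hpush, Matrix.mul_assoc,
    Matrix.trace_mul_comm M, Matrix.trace_mul_comm (Mᴴ * M), ← Matrix.mul_assoc]

/-- With R = (1 + A)⁻¹ the difference is R A R. -/
theorem sub_sq_posSemidef {A : Matrix a a ℂ} (hA : A.PosSemidef) :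
    ((1 + A)⁻¹ - (1 + A)⁻¹ * (1 + A)⁻¹).PosSemidef := by
  have h : (1 + A)⁻¹ - (1 + A)⁻¹ * (1 + A)⁻¹ = (1 + A)⁻¹ * A * ((1 + A)⁻¹)ᴴ := by
    rw [(inv_one_add_posSemidef hA).isHermitian.eq, inv_one_add_mul hA, sub_mul, one_mul]
  rw [h]
  exact hA.mul_mul_conjTranspose_same _

/-- With R = (1 + A)⁻¹, write 1 - R = (R - R²) + (1 - R)². -/
theorem one_sub_inv_posSemidef {A : Matrix a a ℂ} (hA : A.PosSemidef) :
    (1 - (1 + A)⁻¹).PosSemidef := by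
  have h : 1 - (1 + A)⁻¹ = ((1 + A)⁻¹ - (1 + A)⁻¹ * (1 + A)⁻¹)
      + (1 - (1 + A)⁻¹) * (1 - (1 + A)⁻¹)ᴴ := by
    rw [conjTranspose_sub, conjTranspose_one, (inv_one_add_posSemidef hA).isHermitian.eq]
    noncomm_ring
  rw [h]
  exact (sub_sq_posSemidef hA).add (posSemidef_self_mul_conjTranspose _)

theorem dof_nonneg {A : Matrix a a ℂ} (hA : A.PosSemidef) : 0 ≤ dof A :=
  (Complex.le_def.1 (one_sub_inv_posSemidef hA).trace_nonneg).1

theorem dof_le_card {A : Matrix a a ℂ} (hA : A.PosSemidef) : dof A ≤ Fintype.card a := by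
  have h := (Complex.le_def.1 (inv_one_add_posSemidef hA).trace_nonneg).1
  simp only [dof, trace_sub, trace_one, Complex.sub_re, Complex.natCast_re]
  simpa using h

theorem dof_zero : dof (0 : Matrix a a ℂ) = 0 := by simp [dof]

/-- A rank-one update increases the degrees of freedom by at most one. -/
theorem dof_add_vecMulVec {A : Matrix a a ℂ} (hA : A.PosSemidef) (v : a → ℂ) :
    dof A ≤ dof (A + vecMulVec v (star v)) ∧ dof (A + vecMulVec v (star v)) ≤ dof A + 1 := by
  set R := (1 + A)⁻¹ with hR
  have hB : (A + vecMulVec v (star v)).PosSemidef := hA.add (posSemidef_vecMulVec_self_star v)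
  set R' := (1 + (A + vecMulVec v (star v)))⁻¹ with hR'
  have hRp := inv_one_add_posSemidef hA
  have hRp' := inv_one_add_posSemidef hB
  set α : ℂ := star v ⬝ᵥ (R *ᵥ v) with hα
  set γ : ℂ := star v ⬝ᵥ ((R * R) *ᵥ v) with hγ
  have hα0 : 0 ≤ α := hRp.dotProduct_mulVec_nonneg v
  have hγ0 : 0 ≤ γ := by
    have h : (R * Rᴴ).PosSemidef := posSemidef_self_mul_conjTranspose R
    rw [hRp.isHermitian.eq] at h
    exact h.dotProduct_mulVec_nonneg v
  have hγα : γ ≤ α := by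
    have h := (sub_sq_posSemidef hA).dotProduct_mulVec_nonneg v
    rw [sub_mulVec, dotProduct_sub] at h
    exact sub_nonneg.1 h
  -- Sherman–Morrison: the increment of the degrees of freedom is γ / (1 + α), and γ ≤ α, that is R²
  -- ≤ R, keeps it between 0 and 1.
  have hdiff : R - R' = R' * vecMulVec v (star v) * R := by
    have h1 : R' * (1 + (A + vecMulVec v (star v))) * R = R := by
      rw [inv_mul_one_add hB, one_mul]
    have h2 : R' * (1 + A) * R = R' := by rw [Matrix.mul_assoc, one_add_mul_inv hA, mul_one]
    calc R - R' = R' * (1 + (A + vecMulVec v (star v))) * R - R' * (1 + A) * R := by rw [h1, h2]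
      _ = R' * vecMulVec v (star v) * R := by noncomm_ring
  have hR'v : R *ᵥ v = (1 + α) • (R' *ᵥ v) := by
    calc R *ᵥ v = (R' * (1 + (A + vecMulVec v (star v)))) *ᵥ (R *ᵥ v) := by
          rw [inv_mul_one_add hB, one_mulVec]
      _ = R' *ᵥ (((1 + A) * R) *ᵥ v + vecMulVec v (star v) *ᵥ (R *ᵥ v)) := by
          rw [← add_assoc, ← mulVec_mulVec, add_mulVec, ← mulVec_mulVec]
      _ = (1 + α) • (R' *ᵥ v) := by
          rw [one_add_mul_inv hA, one_mulVec, vecMulVec_mulVec]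
          simp only [mulVec_add, op_smul_eq_smul, mulVec_smul, add_smul, one_smul, hα]
  have hα1 : (1 + α) ≠ 0 := by
    intro h
    have := (Complex.le_def.1 hα0).1
    have h2 := congrArg Complex.re h
    simp at h2 this
    linarith
  have htr : trace (R - R') * (1 + α) = γ := by
    rw [hdiff, trace_mul_comm, ← Matrix.mul_assoc, mul_vecMulVec, trace_vecMulVec, hγ,
      ← mulVec_mulVec v R R, hR'v, mulVec_smul, dotProduct_smul, smul_eq_mul, mulVec_mulVec,
      dotProduct_comm, mul_comm]
  have hre : dof (A + vecMulVec v (star v)) - dof A = γ.re / (1 + α.re) := by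
    have hαi : α.im = 0 := (Complex.le_def.1 hα0).2.symm
    have hα0' : 0 ≤ α.re := (Complex.le_def.1 hα0).1
    have h := congrArg Complex.re htr
    simp only [Complex.mul_re, Complex.add_re, Complex.one_re, Complex.add_im, Complex.one_im, hαi,
      add_zero, mul_zero, sub_zero, trace_sub, Complex.sub_re] at h
    rw [eq_div_iff (by linarith), ← h]
    simp only [dof, trace_sub, Complex.sub_re, ← hR, ← hR']
    ring
  have h1 : 0 ≤ γ.re := (Complex.le_def.1 hγ0).1
  have h2 : γ.re ≤ α.re := (Complex.le_def.1 hγα).1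
  have h3 : 0 ≤ γ.re / (1 + α.re) := div_nonneg h1 (by linarith)
  have h4 : γ.re / (1 + α.re) ≤ 1 := by
    rw [div_le_one (by linarith)]
    linarith
  constructor <;> linarith

/-- Deleting some of the rank-one terms of a Gram sum changes the degrees of freedom by at most
the number of deleted terms. -/
theorem dof_sum_vecMulVec_mono {ι : Type*} [DecidableEq ι] (v : ι → a → ℂ) {s t : Finset ι}
    (hst : s ⊆ t) :
    dof (∑ i ∈ s, vecMulVec (v i) (star (v i))) ≤ dof (∑ i ∈ t, vecMulVec (v i) (star (v i))) ∧
      dof (∑ i ∈ t, vecMulVec (v i) (star (v i))) ≤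
        dof (∑ i ∈ s, vecMulVec (v i) (star (v i))) + ((t.card : ℝ) - s.card) := by
  have key : ∀ u : Finset ι, Disjoint s u →
      dof (∑ i ∈ s, vecMulVec (v i) (star (v i))) ≤
        dof (∑ i ∈ s ∪ u, vecMulVec (v i) (star (v i))) ∧
      dof (∑ i ∈ s ∪ u, vecMulVec (v i) (star (v i))) ≤
        dof (∑ i ∈ s, vecMulVec (v i) (star (v i))) + u.card := by
    intro u
    induction u using Finset.induction_on with
    | empty => simp
    | insert i u hi ih =>
      intro hd
      rw [Finset.disjoint_insert_right] at hd
      obtain ⟨h1, h2⟩ := ih hd.2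
      have hi' : i ∉ s ∪ u := by simp [hd.1, hi]
      have hp : (∑ i ∈ s ∪ u, vecMulVec (v i) (star (v i))).PosSemidef :=
        posSemidef_sum _ fun i _ => posSemidef_vecMulVec_self_star _
      obtain ⟨h3, h4⟩ := dof_add_vecMulVec hp (v i)
      rw [Finset.union_insert, Finset.sum_insert hi', add_comm (vecMulVec _ _),
        Finset.card_insert_of_notMem hi]
      push_cast
      constructor <;> linarith
  obtain ⟨h1, h2⟩ := key (t \ s) Finset.disjoint_sdiff
  rw [Finset.union_sdiff_of_subset hst] at h1 h2
  rw [Finset.cast_card_sdiff hst] at h2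
  exact ⟨h1, h2⟩

omit [DecidableEq a] [DecidableEq b] in
theorem trace_mul_conjTranspose_self (X : Matrix a b ℂ) :
    (trace (X * Xᴴ)).re = ∑ i, ∑ j, ‖X i j‖ ^ 2 := by
  simp only [trace, diag_apply, mul_apply, conjTranspose_apply, Complex.re_sum]
  refine Finset.sum_congr rfl fun i _ => Finset.sum_congr rfl fun j _ => ?_
  rw [Complex.star_def, Complex.mul_conj, Complex.normSq_eq_norm_sq, Complex.ofReal_re]

/-- The degrees of freedom are controlled by the Hilbert–Schmidt distance. -/
theorem abs_dof_sub_dof_le {A B : Matrix a a ℂ} (hA : A.PosSemidef) (hB : B.PosSemidef)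
    {η : ℝ} (hη : 0 < η) :
    |dof A - dof B| ≤ η * Fintype.card a + η⁻¹ * ∑ i, ∑ j, ‖A i j - B i j‖ ^ 2 := by
  set R := (1 + A)⁻¹ with hR
  set S := (1 + B)⁻¹ with hS
  have hRh : Rᴴ = R := (inv_one_add_posSemidef hA).isHermitian.eq
  have hSh : Sᴴ = S := (inv_one_add_posSemidef hB).isHermitian.eq
  have hdiff : S - R = S * (A - B) * R := by
    have h1 : S * (1 + A) * R = S := by rw [Matrix.mul_assoc, one_add_mul_inv hA, mul_one]
    have h2 : S * (1 + B) * R = R := by rw [inv_mul_one_add hB, one_mul]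
    calc S - R = S * (1 + A) * R - S * (1 + B) * R := by rw [h1, h2]
      _ = S * (A - B) * R := by noncomm_ring
  -- The difference is tr(RS(A - B)). Both resolvents are contractions, so RS has squared
  -- Hilbert–Schmidt norm at most the size of the matrix.
  set X := R * S with hX
  have hle : (trace (X * Xᴴ)).re ≤ Fintype.card a := by
    have e1 : (1 - S * S).PosSemidef := by
      have : 1 - S * S = (1 - S) + (S - S * S) := by abel
      rw [this]
      exact (one_sub_inv_posSemidef hB).add (sub_sq_posSemidef hB)
    have e2 : (1 - R * R).PosSemidef := by
      have : 1 - R * R = (1 - R) + (R - R * R) := by abel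
      rw [this]
      exact (one_sub_inv_posSemidef hA).add (sub_sq_posSemidef hA)
    have e3 : (1 - X * Xᴴ).PosSemidef := by
      have : 1 - X * Xᴴ = (1 - R * R) + R * (1 - S * S) * Rᴴ := by
        rw [hX, conjTranspose_mul, hRh, hSh]
        noncomm_ring
      rw [this]
      exact e2.add (e1.mul_mul_conjTranspose_same _)
    have := (Complex.le_def.1 e3.trace_nonneg).1
    rw [trace_sub, trace_one] at this
    simpa using this
  rw [trace_mul_conjTranspose_self] at hle
  have htr : dof A - dof B = (trace (X * (A - B))).re := by
    rw [hX, Matrix.mul_assoc, trace_mul_comm, ← hdiff]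
    simp only [dof, trace_sub, Complex.sub_re, ← hR, ← hS]
    ring
  -- Young's inequality. The weight η stays free and is later balanced against the mean square error
  -- of the kernels.
  have hterm : ∀ i j, ‖X i j * (A - B) j i‖ ≤ η * ‖X i j‖ ^ 2 + η⁻¹ * ‖A j i - B j i‖ ^ 2 := by
    intro i j
    rw [norm_mul, Matrix.sub_apply]
    set p := ‖X i j‖
    set q := ‖A j i - B j i‖
    have h : 0 ≤ η * (p - η⁻¹ * q / 2) ^ 2 := by positivity
    have h2 : 0 ≤ η⁻¹ * q ^ 2 := by positivity
    have h3 : η * (p - η⁻¹ * q / 2) ^ 2 = η * p ^ 2 - p * q + η⁻¹ * q ^ 2 / 4 := by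
      field_simp
      ring
    linarith
  calc |dof A - dof B| ≤ ‖trace (X * (A - B))‖ := by rw [htr]; exact Complex.abs_re_le_norm _
    _ ≤ ∑ i, ∑ j, ‖X i j * (A - B) j i‖ := by
        simp only [trace, diag_apply, mul_apply]
        exact (norm_sum_le _ _).trans (Finset.sum_le_sum fun i _ => norm_sum_le _ _)
    _ ≤ ∑ i, ∑ j, (η * ‖X i j‖ ^ 2 + η⁻¹ * ‖A j i - B j i‖ ^ 2) :=
        Finset.sum_le_sum fun i _ => Finset.sum_le_sum fun j _ => hterm i j
    _ = η * (∑ i, ∑ j, ‖X i j‖ ^ 2) + η⁻¹ * ∑ i, ∑ j, ‖A i j - B i j‖ ^ 2 := by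
        simp only [Finset.sum_add_distrib, ← Finset.mul_sum]
        congr 2
        exact Finset.sum_comm
    _ ≤ _ := by gcongr

/-- The degrees of freedom are additive over mutually annihilating summands. -/
theorem dof_sum_of_mul_eq_zero {ι : Type*} [Fintype ι] (A : ι → Matrix a a ℂ)
    (hA : ∀ i, (A i).PosSemidef) (h0 : ∀ i j, i ≠ j → A i * A j = 0) :
    dof (∑ i, A i) = ∑ i, dof (A i) := by
  classical
  have hS : (∑ i, A i).PosSemidef := posSemidef_sum _ fun i _ => hA i
  -- Since 1 - (1 + A i)⁻¹ = (1 + A i)⁻¹ A i annihilates every other summand, the i-th term only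
  -- sees 1 + A i.
  have h1 : (∑ i, (1 - (1 + A i)⁻¹)) * (1 + ∑ i, A i) = ∑ i, A i := by
    rw [Finset.sum_mul]
    refine Finset.sum_congr rfl fun i _ => ?_
    have hsplit : (1 : Matrix a a ℂ) + ∑ j, A j = (1 + A i) + ∑ j ∈ Finset.univ.erase i, A j := by
      rw [← Finset.add_sum_erase _ _ (Finset.mem_univ i), add_assoc]
    have h2 : (1 - (1 + A i)⁻¹) * ∑ j ∈ Finset.univ.erase i, A j = 0 := by
      rw [← inv_one_add_mul (hA i), Matrix.mul_assoc, Finset.mul_sum,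
        Finset.sum_eq_zero, mul_zero]
      intro j hj
      exact h0 i j (Finset.ne_of_mem_erase hj).symm
    rw [hsplit, mul_add, h2, add_zero, ← mul_inv_one_add (hA i), Matrix.mul_assoc,
      inv_mul_one_add (hA i), mul_one]
  have h3 : 1 - (1 + ∑ i, A i)⁻¹ = ∑ i, (1 - (1 + A i)⁻¹) := by
    rw [← mul_inv_one_add hS]
    nth_rw 1 [← h1]
    rw [Matrix.mul_assoc, one_add_mul_inv hS, mul_one]
  unfold dof
  rw [h3, trace_sum, Complex.re_sum]

/-- Spectral formula for the degrees of freedom of a multiple of a power. -/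
theorem dof_smul_pow {A : Matrix a a ℂ} (hA : A.PosSemidef) {s : ℝ} (hs : 0 ≤ s) (r : ℕ) :
    dof ((s : ℂ) • A ^ r) =
      ∑ i, s * hA.isHermitian.eigenvalues i ^ r / (1 + s * hA.isHermitian.eigenvalues i ^ r) := by
  set hH := hA.isHermitian
  set U : Matrix a a ℂ := (hH.eigenvectorUnitary : Matrix a a ℂ) with hU
  set D : Matrix a a ℂ := diagonal fun i => (hH.eigenvalues i : ℂ) with hD
  have hUU : star U * U = 1 := Unitary.coe_star_mul_self hH.eigenvectorUnitary
  have hUU' : U * star U = 1 := Unitary.coe_mul_star_self hH.eigenvectorUnitary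
  have hspec : A = U * D * star U := by
    have := hH.spectral_theorem
    rw [Unitary.conjStarAlgAut_apply] at this
    exact this
  have hpow : A ^ r = U * D ^ r * star U := by
    induction r with
    | zero => simp [hUU']
    | succ r ih =>
      rw [pow_succ, ih, pow_succ]
      nth_rw 1 [hspec]
      calc U * D ^ r * star U * (U * D * star U) = U * D ^ r * (star U * U) * D * star U := by
            noncomm_ring
        _ = U * (D ^ r * D) * star U := by rw [hUU]; noncomm_ring
  have hlam : ∀ i, 0 ≤ s * hH.eigenvalues i ^ r := fun i =>
    mul_nonneg hs (pow_nonneg (hA.eigenvalues_nonneg i) _)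
  set E : Matrix a a ℂ := diagonal fun i => (1 + (s : ℂ) * (hH.eigenvalues i : ℂ) ^ r)⁻¹ with hE
  have hinv : (1 + (s : ℂ) • A ^ r)⁻¹ = U * E * star U := by
    refine Matrix.inv_eq_right_inv ?_
    have h1 : 1 + (s : ℂ) • A ^ r = U * (1 + (s : ℂ) • D ^ r) * star U := by
      rw [hpow, mul_add, add_mul, mul_one, hUU', Matrix.mul_smul, Matrix.smul_mul]
    have h2 : (1 + (s : ℂ) • D ^ r) * E = 1 := by
      rw [hD, hE, diagonal_pow, ← diagonal_smul, ← diagonal_one, diagonal_add, diagonal_mul_diagonal]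
      congr 1
      ext i
      simp only [Pi.pow_apply, Pi.smul_apply, smul_eq_mul]
      refine mul_inv_cancel₀ ?_
      have := hlam i
      intro h
      have h' := congrArg Complex.re h
      rw [← Complex.ofReal_pow, ← Complex.ofReal_mul] at h'
      simp only [Complex.add_re, Complex.one_re, Complex.ofReal_re, Complex.zero_re] at h'
      linarith
    rw [h1]
    calc U * (1 + (s : ℂ) • D ^ r) * star U * (U * E * star U)
        = U * (1 + (s : ℂ) • D ^ r) * (star U * U) * E * star U := by noncomm_ring
      _ = U * ((1 + (s : ℂ) • D ^ r) * E) * star U := by rw [hUU]; noncomm_ring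
      _ = 1 := by rw [h2, mul_one, hUU']
  have htr : trace (U * E * star U) = trace E := by
    rw [trace_mul_cycle, hUU, one_mul]
  unfold dof
  rw [hinv, trace_sub, htr, trace_one, hE, trace_diagonal, Fintype.card_eq_sum_ones, Nat.cast_sum,
    ← Finset.sum_sub_distrib, Complex.re_sum]
  refine Finset.sum_congr rfl fun i _ => ?_
  have h := hlam i
  rw [← Complex.ofReal_pow, ← Complex.ofReal_mul, ← Complex.ofReal_one, ← Complex.ofReal_add,
    ← Complex.ofReal_inv, Complex.sub_re, Complex.ofReal_re]
  simp only [Nat.cast_one, Complex.one_re]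
  field_simp
  ring

theorem dof_smul {A : Matrix a a ℂ} (hA : A.PosSemidef) {s : ℝ} (hs : 0 ≤ s) :
    dof ((s : ℂ) • A) =
      ∑ i, s * hA.isHermitian.eigenvalues i / (1 + s * hA.isHermitian.eigenvalues i) := by
  simpa using dof_smul_pow hA hs 1

/-- Each eigenvalue contributes (s / t - 1) times a factor in [0, 1], so only the relative change of
the scale matters, however large the eigenvalues are. This permits replacing the weight s / m by its
asymptotic value. -/
theorem abs_dof_smul_sub_le {A : Matrix a a ℂ} (hA : A.PosSemidef) {s t : ℝ} (hs : 0 ≤ s)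
    (ht : 0 < t) :
    |dof ((s : ℂ) • A) - dof ((t : ℂ) • A)| ≤ Fintype.card a * |s / t - 1| := by
  rw [dof_smul hA hs, dof_smul hA ht.le, ← Finset.sum_sub_distrib]
  refine (Finset.abs_sum_le_sum_abs _ _).trans ?_
  rw [← nsmul_eq_mul, ← Finset.card_univ]
  refine Finset.sum_le_card_nsmul _ _ _ fun i _ => ?_
  set l := hA.isHermitian.eigenvalues i
  have hl : 0 ≤ l := hA.eigenvalues_nonneg i
  have h1 : 0 ≤ s * l := by positivity
  have h2 : 0 ≤ t * l := by positivity
  have : s * l / (1 + s * l) - t * l / (1 + t * l) =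
      (s / t - 1) * ((t * l) / ((1 + s * l) * (1 + t * l))) := by
    field_simp
    ring
  rw [this, abs_mul]
  refine mul_le_of_le_one_right (abs_nonneg _) ?_
  rw [abs_of_nonneg (by positivity), div_le_one (by positivity)]
  nlinarith

/-- By Cramer's rule the entries of the resolvent are quotients of polynomials in the entries of the
matrix; no spectral information is needed. -/
theorem measurable_dof {Ω : Type*} [MeasurableSpace Ω] {A : Ω → Matrix a a ℂ}
    (hA : ∀ i j, Measurable fun ω => A ω i j) : Measurable fun ω => dof (A ω) := by
  have hdet : ∀ B : Ω → Matrix a a ℂ, (∀ i j, Measurable fun ω => B ω i j) →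
      Measurable fun ω => (B ω).det := by
    intro B hB
    simp only [det_apply]
    refine Finset.measurable_sum _ fun σ _ => ?_
    exact (Finset.measurable_prod _ fun i _ => hB _ _).const_smul _
  have h1 : ∀ i j, Measurable fun ω => (1 + A ω) i j := fun i j => by
    simp only [Matrix.add_apply]
    exact measurable_const.add (hA i j)
  have hinv : ∀ i, Measurable fun ω => (1 + A ω)⁻¹ i i := by
    intro i
    simp only [Matrix.inv_def, Matrix.smul_apply, smul_eq_mul, Ring.inverse_eq_inv', adjugate_apply]
    refine (hdet _ h1).inv.mul (hdet _ fun p q => ?_)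
    by_cases hp : p = i
    · subst hp
      simp only [updateRow_self]
      exact measurable_const
    · simp only [updateRow_ne hp]
      exact h1 p q
  simp only [dof, trace, diag_apply, Matrix.sub_apply]
  exact Complex.measurable_re.comp
    (Finset.measurable_sum _ fun i _ => measurable_const.sub (hinv i))

end dof

/-! ### Measurability of ordered eigenvalues. -/

section eigenvalueMeasurability

open Matrix ComplexOrder

/-- Turns an event about one ordered eigenvalue into an event about a symmetric count. Positions
start at 0, so exactly i entries precede position i. -/
theorem Antitone.le_iff_card_le {N : ℕ} {l : Fin N → ℝ} (hl : Antitone l) (i : Fin N) (z : ℝ) :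
    l i ≤ z ↔ (Finset.univ.filter fun j => z < l j).card ≤ (i : ℕ) := by
  constructor
  · intro h
    have hsub : (Finset.univ.filter fun j => z < l j) ⊆ Finset.Iio i := by
      intro j hj
      rw [Finset.mem_filter] at hj
      rw [Finset.mem_Iio]
      by_contra hij
      exact absurd (hl (not_lt.1 hij)) (not_le.2 (lt_of_le_of_lt h hj.2))
    simpa using Finset.card_le_card hsub
  · intro h
    by_contra hz
    have hsub : Finset.Iic i ⊆ (Finset.univ.filter fun j => z < l j) := by
      intro j hj
      rw [Finset.mem_filter]
      exact ⟨Finset.mem_univ _, lt_of_lt_of_le (not_le.1 hz) (hl (Finset.mem_Iic.1 hj))⟩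
    have := Finset.card_le_card hsub
    simp at this
    omega

/-- The limit of `t ^ r / (1 + t ^ r)`. -/
noncomputable def stepLimit (t : ℝ) : ℝ := if 1 < t then 1 else if t = 1 then 1 / 2 else 0

theorem tendsto_pow_div_one_add {t : ℝ} (ht : 0 ≤ t) :
    Tendsto (fun r : ℕ => t ^ r / (1 + t ^ r)) atTop (𝓝 (stepLimit t)) := by
  unfold stepLimit
  split_ifs with h1 h2
  · have h : ∀ r : ℕ, t ^ r / (1 + t ^ r) = 1 - (1 + t ^ r)⁻¹ := by
      intro r
      have : 1 + t ^ r ≠ 0 := by positivity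
      field_simp
      ring
    simp only [h]
    have h3 : Tendsto (fun r : ℕ => 1 + t ^ r) atTop atTop :=
      tendsto_atTop_add_const_left _ _ (tendsto_pow_atTop_atTop_of_one_lt h1)
    simpa using (tendsto_const_nhds (x := (1 : ℝ))).sub h3.inv_tendsto_atTop
  · subst h2
    norm_num
  · have h3 := tendsto_pow_atTop_nhds_zero_of_lt_one ht (lt_of_le_of_ne (not_lt.1 h1) h2)
    have h4 := h3.div (h3.const_add 1) (by norm_num)
    simp only [add_zero, zero_div] at h4
    exact h4

/-- The thresholds approach z strictly from above, so an eigenvalue equal to z is never counted and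
the value 1 / 2 of `stepLimit` at 1 disappears in the limit. -/
theorem tendsto_stepLimit_div {l z : ℝ} (hz : 0 ≤ z) :
    Tendsto (fun j : ℕ => stepLimit (l / (z + 1 / ((j : ℝ) + 1)))) atTop
      (𝓝 (if z < l then 1 else 0)) := by
  have hpos : ∀ j : ℕ, 0 < z + 1 / ((j : ℝ) + 1) := fun j => by positivity
  have hlim : Tendsto (fun j : ℕ => z + 1 / ((j : ℝ) + 1)) atTop (𝓝 z) := by
    simpa using tendsto_one_div_add_atTop_nhds_zero_nat.const_add z
  split_ifs with h
  · refine tendsto_const_nhds.congr' ?_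
    filter_upwards [hlim.eventually_lt_const h] with j hj
    rw [stepLimit, if_pos ((one_lt_div (hpos j)).2 hj)]
  · refine tendsto_const_nhds.congr fun j => ?_
    have h1 : l / (z + 1 / ((j : ℝ) + 1)) < 1 := by
      rw [div_lt_one (hpos j)]
      have : (0 : ℝ) < 1 / ((j : ℝ) + 1) := by positivity
      linarith [not_lt.1 h]
    rw [stepLimit, if_neg h1.le.not_gt, if_neg h1.ne]

variable {a Ω : Type*} [Fintype a] [DecidableEq a] [MeasurableSpace Ω]

/-- The ordered eigenvalues of a measurable family of positive semidefinite matrices are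
measurable. -/
theorem measurable_eigenvalues {A : Ω → Matrix a a ℂ} (hA : ∀ i j, Measurable fun ω => A ω i j)
    (hp : ∀ ω, (A ω).PosSemidef) (i : a) :
    Measurable fun ω => (hp ω).isHermitian.eigenvalues i := by
  have hpow : ∀ (r : ℕ) (i j : a), Measurable fun ω => (A ω ^ r) i j := by
    intro r
    induction r with
    | zero => intro i j; simp only [pow_zero]; exact measurable_const
    | succ r ih =>
      intro i j
      simp only [pow_succ, mul_apply]
      exact Finset.measurable_sum _ fun k _ => (ih i k).mul (hA k j)
  -- The degrees of freedom of (A / z)^r are measurable, and for r → ∞ they count the eigenvalues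
  -- above z, those equal to z with weight one half.
  have hF : ∀ z : ℝ, 0 < z →
      Measurable fun ω => ∑ j, stepLimit ((hp ω).isHermitian.eigenvalues j / z) := by
    intro z hz
    refine measurable_of_tendsto_metrizable (f := fun (r : ℕ) ω =>
      dof ((((z ^ r)⁻¹ : ℝ) : ℂ) • A ω ^ r)) (fun r => measurable_dof fun p q => ?_) ?_
    · simp only [Matrix.smul_apply]
      exact (hpow r p q).const_mul _
    · rw [tendsto_pi_nhds]
      intro ω
      simp only [dof_smul_pow (hp ω) (inv_nonneg.2 (pow_nonneg hz.le _))]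
      refine tendsto_finsetSum _ fun j _ => ?_
      have h := tendsto_pow_div_one_add
        (div_nonneg ((hp ω).eigenvalues_nonneg j) hz.le)
      simpa only [div_pow, div_eq_inv_mul (_ ^ _) (z ^ _)] using h
  have hcount : ∀ z : ℝ, 0 ≤ z → Measurable fun ω =>
      ∑ j, if z < (hp ω).isHermitian.eigenvalues j then (1 : ℝ) else 0 := by
    intro z hz
    refine measurable_of_tendsto_metrizable
      (fun k : ℕ => hF (z + 1 / ((k : ℝ) + 1)) (by positivity)) ?_
    rw [tendsto_pi_nhds]
    intro ω
    exact tendsto_finsetSum _ fun j _ => tendsto_stepLimit_div hz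
  -- The equivalence used in the definition of `eigenvalues`, so that `e.symm i` is the rank of the
  -- eigenvalue labelled i.
  set e : Fin (Fintype.card a) ≃ a := Fintype.equivOfCardEq (Fintype.card_fin _)
  refine measurable_of_Iic fun z => ?_
  rcases lt_or_ge z 0 with hz | hz
  · convert MeasurableSet.empty
    ext ω
    simp only [Set.mem_preimage, Set.mem_Iic, Set.mem_empty_iff_false, iff_false, not_le]
    exact hz.trans_le ((hp ω).eigenvalues_nonneg i)
  · have hset : (fun ω => (hp ω).isHermitian.eigenvalues i) ⁻¹' Set.Iic z =
        (fun ω => ∑ j, if z < (hp ω).isHermitian.eigenvalues j then (1 : ℝ) else 0) ⁻¹'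
          Set.Iic ((e.symm i : ℕ) : ℝ) := by
      ext ω
      simp only [Set.mem_preimage, Set.mem_Iic]
      have h1 : ∑ j, (if z < (hp ω).isHermitian.eigenvalues j then (1 : ℝ) else 0) =
          ((Finset.univ.filter fun j => z < (hp ω).isHermitian.eigenvalues₀ j).card : ℝ) := by
        rw [← Equiv.sum_comp e]
        simp only [IsHermitian.eigenvalues, e, Equiv.symm_apply_apply]
        simp
      rw [h1, Nat.cast_le]
      exact (hp ω).isHermitian.eigenvalues₀_antitone.le_iff_card_le (e.symm i) z
    rw [hset]
    exact hcount z hz measurableSet_Iic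

end eigenvalueMeasurability

/-! ### Laws on the half line are determined by their ridge integrals. -/

section resolventDeterminacy

open scoped NNReal

/-- The test function `s x / (1 + s x)`, extended by `0` to negative `x`. -/
noncomputable def ridge (s x : ℝ) : ℝ := s * max x 0 / (1 + s * max x 0)

theorem ridge_of_nonneg (s : ℝ) {x : ℝ} (hx : 0 ≤ x) : ridge s x = s * x / (1 + s * x) := by
  rw [ridge, max_eq_left hx]

theorem ridge_nonneg {s : ℝ} (hs : 0 ≤ s) (x : ℝ) : 0 ≤ ridge s x := by
  unfold ridge
  positivity

theorem ridge_le_one {s : ℝ} (hs : 0 ≤ s) (x : ℝ) : ridge s x ≤ 1 := by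
  unfold ridge
  rw [div_le_one (by positivity)]
  linarith

theorem continuous_ridge {s : ℝ} (hs : 0 ≤ s) : Continuous (ridge s) := by
  unfold ridge
  refine Continuous.div (by fun_prop) (by fun_prop) fun x => ?_
  positivity

theorem integrable_ridge {s : ℝ} (hs : 0 ≤ s) (μ : Measure ℝ) [IsFiniteMeasure μ] :
    Integrable (ridge s) μ := by
  refine Integrable.of_bound (continuous_ridge hs).aestronglyMeasurable 1 (ae_of_all _ fun x => ?_)
  rw [Real.norm_eq_abs, abs_of_nonneg (ridge_nonneg hs x)]
  exact ridge_le_one hs x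

theorem one_add_mul_pow_inv_le_one {s : ℝ} (hs : 0 ≤ s) (x : ℝ≥0) (k : ℕ) :
    ((1 + s * x) ^ k)⁻¹ ≤ 1 := by
  have h1 : (1 : ℝ) ≤ 1 + s * x := by
    have : 0 ≤ s * (x : ℝ) := by positivity
    linarith
  exact inv_le_one_of_one_le₀ (one_le_pow₀ h1)

theorem integrable_resolvent_pow {s : ℝ} (hs : 0 ≤ s) (k : ℕ) (Q : Measure ℝ≥0)
    [IsFiniteMeasure Q] : Integrable (fun x : ℝ≥0 => ((1 + s * (x : ℝ)) ^ k)⁻¹) Q := by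
  refine Integrable.of_bound (Measurable.aestronglyMeasurable (by fun_prop)) 1
    (ae_of_all _ fun x => ?_)
  rw [Real.norm_eq_abs, abs_of_nonneg (by positivity)]
  exact one_add_mul_pow_inv_le_one hs x k

/-- The derivative -k x (1 + s x)^(-k-1) is rewritten with s x = (1 + s x) - 1, so that it contains
only the powers k and k + 1. This is what gives a recursion in k. -/
theorem hasDerivAt_integral_resolvent_pow {s : ℝ} (hs : 0 < s) (k : ℕ) (Q : Measure ℝ≥0)
    [IsFiniteMeasure Q] :
    HasDerivAt (fun s => ∫ x : ℝ≥0, ((1 + s * (x : ℝ)) ^ k)⁻¹ ∂Q)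
      (∫ x : ℝ≥0, -(k / s) * (((1 + s * (x : ℝ)) ^ k)⁻¹ - ((1 + s * (x : ℝ)) ^ (k + 1))⁻¹) ∂Q)
      s := by
  refine (hasDerivAt_integral_of_dominated_loc_of_deriv_le
    (F' := fun s (x : ℝ≥0) =>
      -(k / s) * (((1 + s * (x : ℝ)) ^ k)⁻¹ - ((1 + s * (x : ℝ)) ^ (k + 1))⁻¹))
    -- On the neighbourhood t > s / 2 the prefactor k / t is at most k / (s / 2), and the difference
    -- of the two powers lies in [0, 1].
    (bound := fun _ => k / (s / 2) * 1)
    (Ioi_mem_nhds (half_lt_self hs)) ?_ (integrable_resolvent_pow hs.le k Q)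
    (Measurable.aestronglyMeasurable (by fun_prop)) ?_ (integrable_const _) ?_).2
  · exact Eventually.of_forall fun s => Measurable.aestronglyMeasurable (by fun_prop)
  · refine ae_of_all _ fun x t ht => ?_
    have ht0 : 0 < t := (half_pos hs).trans ht
    have h1 := one_add_mul_pow_inv_le_one ht0.le x k
    have h2 : 0 ≤ ((1 + t * (x : ℝ)) ^ (k + 1))⁻¹ := by positivity
    have h3 : ((1 + t * (x : ℝ)) ^ (k + 1))⁻¹ ≤ ((1 + t * (x : ℝ)) ^ k)⁻¹ := by
      have h1 : (1 : ℝ) ≤ 1 + t * x := by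
        have : 0 ≤ t * (x : ℝ) := by positivity
        linarith
      exact inv_anti₀ (by positivity) (pow_le_pow_right₀ h1 (Nat.le_succ k))
    rw [norm_mul, norm_neg, Real.norm_eq_abs, Real.norm_eq_abs, abs_of_nonneg (by positivity),
      abs_of_nonneg (by linarith)]
    have h4 : s / 2 ≤ t := le_of_lt ht
    gcongr
    linarith
  · refine ae_of_all _ fun x t ht => ?_
    have ht0 : 0 < t := (half_pos hs).trans ht
    have hne : 1 + t * (x : ℝ) ≠ 0 := by positivity
    have h1 : HasDerivAt (fun t : ℝ => 1 + t * (x : ℝ)) (x : ℝ) t := by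
      simpa using ((hasDerivAt_id t).mul_const (x : ℝ)).const_add 1
    have h2 := (h1.pow k).inv (pow_ne_zero k hne)
    refine h2.congr_deriv ?_
    rcases k with _ | k
    · simp
    · simp only [Nat.add_sub_cancel, Pi.pow_apply]
      field_simp
      ring

/-- Differentiating the identity for the power k in s and solving for the new term gives the power k
+ 1. -/
theorem integral_resolvent_pow_eq {Q Q' : Measure ℝ≥0} [IsProbabilityMeasure Q]
    [IsProbabilityMeasure Q']
    (h : ∀ s : ℝ, 0 < s → ∫ x : ℝ≥0, (1 + s * (x : ℝ))⁻¹ ∂Q = ∫ x : ℝ≥0, (1 + s * (x : ℝ))⁻¹ ∂Q')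
    (k : ℕ) : ∀ s : ℝ, 0 < s → ∫ x : ℝ≥0, ((1 + s * (x : ℝ)) ^ k)⁻¹ ∂Q =
      ∫ x : ℝ≥0, ((1 + s * (x : ℝ)) ^ k)⁻¹ ∂Q' := by
  induction k with
  | zero => intro s _; simp
  | succ k ih =>
    -- The prefactor k / s vanishes for k = 0, so the first power has to come from the hypothesis.
    rcases Nat.eq_zero_or_pos k with rfl | hk
    · simpa using h
    intro s hs
    have hd := hasDerivAt_integral_resolvent_pow hs k Q
    have hd' := hasDerivAt_integral_resolvent_pow hs k Q'
    have heq : (fun s => ∫ x : ℝ≥0, ((1 + s * (x : ℝ)) ^ k)⁻¹ ∂Q) =ᶠ[𝓝 s]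
        fun s => ∫ x : ℝ≥0, ((1 + s * (x : ℝ)) ^ k)⁻¹ ∂Q' := by
      filter_upwards [Ioi_mem_nhds hs] with t ht using ih t ht
    have := (hd'.congr_of_eventuallyEq heq).unique hd
    simp only [integral_const_mul] at this
    rw [integral_sub (integrable_resolvent_pow hs.le _ _) (integrable_resolvent_pow hs.le _ _),
      integral_sub (integrable_resolvent_pow hs.le _ _) (integrable_resolvent_pow hs.le _ _),
      ih s hs] at this
    have hne : -((k : ℝ) / s) ≠ 0 := by
      have : (0 : ℝ) < k := by exact_mod_cast hk
      have : 0 < (k : ℝ) / s := by positivity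
      linarith
    have := mul_left_cancel₀ hne this
    linarith

/-- The function `1 / (1 + x)` on the nonnegative reals. -/
noncomputable def resolventFunction : BoundedContinuousFunction ℝ≥0 ℝ :=
  BoundedContinuousFunction.ofNormedAddCommGroup (fun x : ℝ≥0 => (1 + (x : ℝ))⁻¹)
    (Continuous.inv₀ (by fun_prop) fun x => by positivity) 1 fun x => by
      rw [Real.norm_eq_abs, abs_of_nonneg (by positivity)]
      simpa using one_add_mul_pow_inv_le_one zero_le_one x 1

theorem resolventFunction_apply (x : ℝ≥0) : resolventFunction x = (1 + (x : ℝ))⁻¹ := rfl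

/-- At s = 1 all powers of x ↦ 1 / (1 + x) have the same integrals, hence so do all elements of the
algebra it generates. This function is injective, so the algebra separates points and determines the
law. -/
theorem ext_of_integral_resolvent {Q Q' : Measure ℝ≥0} [IsProbabilityMeasure Q]
    [IsProbabilityMeasure Q']
    (h : ∀ s : ℝ, 0 < s →
      ∫ x : ℝ≥0, (1 + s * (x : ℝ))⁻¹ ∂Q = ∫ x : ℝ≥0, (1 + s * (x : ℝ))⁻¹ ∂Q') :
    Q = Q' := by
  have hpow : ∀ k : ℕ, ∫ x, (resolventFunction ^ k) x ∂Q = ∫ x, (resolventFunction ^ k) x ∂Q' := by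
    intro k
    have := integral_resolvent_pow_eq h k 1 one_pos
    simpa [resolventFunction_apply, BoundedContinuousFunction.coe_pow] using this
  let A : StarSubalgebra ℝ (BoundedContinuousFunction ℝ≥0 ℝ) :=
    { Algebra.adjoin ℝ {resolventFunction} with
      star_mem' := fun {f} hf => by
        have : star f = f := by ext x; simp
        rw [this]
        exact hf }
  have hmem : resolventFunction ∈ A :=
    Algebra.subset_adjoin (R := ℝ) (Set.mem_singleton resolventFunction)
  refine ext_of_forall_mem_subalgebra_integral_eq_of_pseudoEMetric_complete_countable
    (𝕜 := ℝ) (A := A) ?_ ?_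
  · intro x y hxy
    refine ⟨resolventFunction, ⟨_, ⟨resolventFunction, hmem, rfl⟩, rfl⟩, ?_⟩
    rw [resolventFunction_apply, resolventFunction_apply]
    intro hc
    have := inv_injective hc
    exact hxy (NNReal.coe_injective (add_left_cancel this))
  · intro g hg
    have hg' : g ∈ Algebra.adjoin ℝ {resolventFunction} := hg
    rw [Algebra.adjoin_singleton_eq_range_aeval] at hg'
    obtain ⟨p, rfl⟩ := hg'
    have hlin : ∀ p : Polynomial ℝ, ∀ Q : Measure ℝ≥0, IsProbabilityMeasure Q →
        ∫ x, (Polynomial.aeval resolventFunction p) x ∂Q =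
          p.sum fun k c => c * ∫ x, (resolventFunction ^ k) x ∂Q := by
      intro p Q _
      rw [Polynomial.aeval_eq_sum_range, Polynomial.sum_over_range _ (by simp)]
      simp only [BoundedContinuousFunction.coe_sum, Finset.sum_apply,
        BoundedContinuousFunction.coe_smul, smul_eq_mul]
      rw [integral_finsetSum _ fun k _ =>
        ((resolventFunction ^ k).integrable Q).const_mul _]
      simp only [integral_const_mul]
    change ∫ x, (Polynomial.aeval resolventFunction p) x ∂Q =
      ∫ x, (Polynomial.aeval resolventFunction p) x ∂Q'
    rw [hlin p Q inferInstance, hlin p Q' inferInstance]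
    simp only [hpow]

/-- Probability measures on the half line are determined by the integrals of the functions
`s x / (1 + s x)`. -/
theorem ext_of_integral_ridge {P P' : Measure ℝ} [IsProbabilityMeasure P] [IsProbabilityMeasure P']
    (hP : P (Set.Iio 0) = 0) (hP' : P' (Set.Iio 0) = 0)
    (h : ∀ s : ℝ, 0 < s → ∫ x, ridge s x ∂P = ∫ x, ridge s x ∂P') : P = P' := by
  have hrec : ∀ ν : Measure ℝ, ν (Set.Iio 0) = 0 →
      (ν.map Real.toNNReal).map ((↑) : ℝ≥0 → ℝ) = ν := by
    intro ν hν
    rw [Measure.map_map measurable_coe_nnreal_real measurable_real_toNNReal]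
    conv_rhs => rw [← Measure.map_id (μ := ν)]
    refine Measure.map_congr ?_
    have : ∀ᵐ x ∂ν, x ∉ Set.Iio (0 : ℝ) := measure_eq_zero_iff_ae_notMem.1 hν
    filter_upwards [this] with x hx
    simp only [Function.comp_apply, id]
    exact Real.coe_toNNReal x (not_lt.1 hx)
  have hint : ∀ ν : Measure ℝ, IsProbabilityMeasure ν → ∀ s : ℝ, 0 < s →
      ∫ x : ℝ≥0, (1 + s * (x : ℝ))⁻¹ ∂(ν.map Real.toNNReal) = 1 - ∫ x, ridge s x ∂ν := by
    intro ν _ s hs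
    rw [integral_map measurable_real_toNNReal.aemeasurable
      (Measurable.aestronglyMeasurable (by fun_prop))]
    have : ∀ x : ℝ, (1 + s * (Real.toNNReal x : ℝ))⁻¹ = 1 - ridge s x := by
      intro x
      rw [ridge, Real.coe_toNNReal']
      have : 1 + s * max x 0 ≠ 0 := by positivity
      field_simp
      ring
    simp only [this]
    rw [integral_sub (integrable_const _) (integrable_ridge hs.le ν)]
    simp
  have : IsProbabilityMeasure (P.map Real.toNNReal) :=
    Measure.isProbabilityMeasure_map measurable_real_toNNReal.aemeasurable
  have : IsProbabilityMeasure (P'.map Real.toNNReal) :=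
    Measure.isProbabilityMeasure_map measurable_real_toNNReal.aemeasurable
  rw [← hrec P hP, ← hrec P' hP', ext_of_integral_resolvent (Q := P.map Real.toNNReal)
    (Q' := P'.map Real.toNNReal) fun s hs => by
      rw [hint P inferInstance s hs, hint P' inferInstance s hs, h s hs]]

end resolventDeterminacy

/-! ### Tightness, weak limits and averaged laws. -/

section limits

open scoped ENNReal

/-- Markov's inequality, with the compact set [0, 1 / ε]. -/
theorem isTightMeasureSet_of_mean_le_one :
    IsTightMeasureSet {ν : Measure ℝ | ν (Set.Iio 0) = 0 ∧ ∫⁻ x, ENNReal.ofReal x ∂ν ≤ 1} := by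
  rw [isTightMeasureSet_iff_exists_isCompact_measure_compl_le]
  intro ε hε
  rcases eq_or_ne ε ∞ with rfl | hε'
  · exact ⟨∅, isCompact_empty, fun _ _ => le_top⟩
  have hε0 : 0 < ε.toReal := ENNReal.toReal_pos hε.ne' hε'
  refine ⟨Set.Icc 0 (ε.toReal)⁻¹, isCompact_Icc, fun ν hν => ?_⟩
  have hsub : (Set.Icc (0 : ℝ) (ε.toReal)⁻¹)ᶜ ⊆
      Set.Iio 0 ∪ {x | (ε)⁻¹ ≤ ENNReal.ofReal x} := by
    intro x hx
    by_cases h0 : x < 0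
    · exact Or.inl h0
    · refine Or.inr ?_
      have : (ε.toReal)⁻¹ < x := by
        by_contra h
        exact hx ⟨not_lt.1 h0, not_lt.1 h⟩
      calc ε⁻¹ = ENNReal.ofReal (ε.toReal)⁻¹ := by
            rw [ENNReal.ofReal_inv_of_pos hε0, ENNReal.ofReal_toReal hε']
        _ ≤ ENNReal.ofReal x := ENNReal.ofReal_le_ofReal this.le
  calc ν (Set.Icc (0 : ℝ) (ε.toReal)⁻¹)ᶜ ≤ ν (Set.Iio 0 ∪ {x | (ε)⁻¹ ≤ ENNReal.ofReal x}) :=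
        measure_mono hsub
    _ ≤ ν (Set.Iio 0) + ν {x | (ε)⁻¹ ≤ ENNReal.ofReal x} := measure_union_le _ _
    _ = ν {x | (ε)⁻¹ ≤ ENNReal.ofReal x} := by rw [hν.1, zero_add]
    _ ≤ (∫⁻ x, ENNReal.ofReal x ∂ν) / ε⁻¹ :=
        meas_ge_le_lintegral_div (by fun_prop) (ENNReal.inv_ne_zero.2 hε')
          (ENNReal.inv_ne_top.2 hε.ne')
    _ ≤ 1 / ε⁻¹ := by gcongr; exact hν.2
    _ = ε := by simp

theorem continuous_integral_of_bounded {g : ℝ → ℝ} (hg : Continuous g) {K : ℝ}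
    (hK : ∀ x, |g x| ≤ K) : Continuous fun ν : ProbabilityMeasure ℝ => ∫ x, g x ∂(ν : Measure ℝ) :=
  continuous_iff_continuousAt.2 fun _ =>
    (ProbabilityMeasure.tendsto_iff_forall_integral_tendsto.1 tendsto_id)
      (BoundedContinuousFunction.ofNormedAddCommGroup g hg K hK)

/-- Convergence of the integrals of `s x / (1 + s x)` forces weak convergence, for probability
measures on the half line with bounded means. -/
theorem exists_tendsto_of_tendsto_integral_ridge {α : Type*} {L : Filter α} [L.NeBot]
    (ν : α → ProbabilityMeasure ℝ)
    (h0 : ∀ᶠ i in L, (ν i : Measure ℝ) (Set.Iio 0) = 0)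
    (h1 : ∀ᶠ i in L, ∫⁻ x, ENNReal.ofReal x ∂(ν i : Measure ℝ) ≤ 1) {R : ℝ → ℝ}
    (hR : ∀ s : ℝ, 0 < s → Tendsto (fun i => ∫ x, ridge s x ∂(ν i : Measure ℝ)) L (𝓝 (R s))) :
    ∃ μ : ProbabilityMeasure ℝ, Tendsto ν L (𝓝 μ) ∧ (μ : Measure ℝ) (Set.Iio 0) = 0 ∧
      ∀ s : ℝ, 0 < s → ∫ x, ridge s x ∂(μ : Measure ℝ) = R s := by
  set S : Set (ProbabilityMeasure ℝ) := {ν | (ν : Measure ℝ) (Set.Iio 0) = 0 ∧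
    ∫⁻ x, ENNReal.ofReal x ∂(ν : Measure ℝ) ≤ 1} with hS
  have hcomp : IsCompact (closure S) := by
    refine isCompact_closure_of_isTightMeasureSet (isTightMeasureSet_of_mean_le_one.subset ?_)
    rintro _ ⟨ν, hν, rfl⟩
    exact hν
  have hmem : ∀ᶠ i in L, ν i ∈ closure S := by
    filter_upwards [h0, h1] with i hi hi' using subset_closure ⟨hi, hi'⟩
  have hridge : ∀ s : ℝ, 0 < s → ∀ y, MapClusterPt y L ν →
      ∫ x, ridge s x ∂(y : Measure ℝ) = R s := by
    intro s hs y hy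
    have hc := continuous_integral_of_bounded (continuous_ridge hs.le) (K := 1) fun x => by
      rw [abs_of_nonneg (ridge_nonneg hs.le x)]
      exact ridge_le_one hs.le x
    have h2 := hy.continuousAt_comp hc.continuousAt
    have h3 : ClusterPt (∫ x, ridge s x ∂(y : Measure ℝ)) (𝓝 (R s)) := h2.clusterPt.mono (hR s hs)
    exact eq_of_nhds_neBot h3
  have hnull : ∀ y, MapClusterPt y L ν → (y : Measure ℝ) (Set.Iio 0) = 0 := by
    intro y hy
    -- A bounded continuous function that is positive exactly on the negative axis; its integrals
    -- pass to the limit, unlike the mass of the open half line itself.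
    set g : ℝ → ℝ := fun x => min (max (-x) 0) 1 with hg
    have hgc : Continuous g := by fun_prop
    have hg0 : ∀ x, 0 ≤ g x := fun x => le_min (le_max_right _ _) zero_le_one
    have hgK : ∀ x, |g x| ≤ 1 := fun x => by
      rw [abs_of_nonneg (hg0 x)]
      exact min_le_right _ _
    have hc := continuous_integral_of_bounded hgc hgK
    have h2 := hy.continuousAt_comp hc.continuousAt
    have hz : Tendsto ((fun ν : ProbabilityMeasure ℝ => ∫ x, g x ∂(ν : Measure ℝ)) ∘ ν) L (𝓝 0) := by
      refine tendsto_const_nhds.congr' ?_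
      filter_upwards [h0] with i hi
      refine (integral_eq_zero_of_ae ?_).symm
      filter_upwards [measure_eq_zero_iff_ae_notMem.1 hi] with x hx
      have : 0 ≤ x := not_lt.1 hx
      simp [hg, this]
    have h3 : ClusterPt (∫ x, g x ∂(y : Measure ℝ)) (𝓝 0) := h2.clusterPt.mono hz
    have h4 : ∫ x, g x ∂(y : Measure ℝ) = 0 := eq_of_nhds_neBot h3
    have hint : Integrable g (y : Measure ℝ) :=
      Integrable.of_bound hgc.aestronglyMeasurable 1 (ae_of_all _ hgK)
    have h5 := (integral_eq_zero_iff_of_nonneg hg0 hint).1 h4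
    rw [measure_eq_zero_iff_ae_notMem]
    filter_upwards [h5] with x hx hx0
    have hx0' : x < 0 := hx0
    have : 0 < g x := lt_min (lt_max_of_lt_left (by linarith)) one_pos
    exact this.ne' hx
  -- Compactness supplies a cluster point. All cluster points share the ridge integrals R, hence
  -- coincide, and a unique cluster point in a compact set is a limit.
  obtain ⟨μ, hμS, hμ⟩ := hcomp.exists_mapClusterPt (Filter.tendsto_principal.2 hmem)
  refine ⟨μ, hcomp.tendsto_nhds_of_unique_mapClusterPt hmem ?_, hnull μ hμ, fun s hs =>
    hridge s hs μ hμ⟩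
  intro y _ hy
  have h : (y : Measure ℝ) = (μ : Measure ℝ) :=
    ext_of_integral_ridge (hnull y hy) (hnull μ hμ) fun s hs =>
      (hridge s hs y hy).trans (hridge s hs μ hμ).symm
  exact Subtype.ext h

/-- The average of the laws of finitely many random variables. -/
noncomputable def averageLaw {ι Ω : Type*} [Fintype ι] [MeasurableSpace Ω] (P : Measure Ω)
    (l : ι → Ω → ℝ) : Measure ℝ :=
  (Fintype.card ι : ℝ≥0∞)⁻¹ • ∑ i, P.map (l i)

section averageLaw

variable {ι Ω : Type*} [Fintype ι] [MeasurableSpace Ω] {P : Measure Ω} {l : ι → Ω → ℝ}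

theorem isProbabilityMeasure_averageLaw [Nonempty ι] [IsProbabilityMeasure P]
    (hl : ∀ i, Measurable (l i)) : IsProbabilityMeasure (averageLaw P l) := by
  refine ⟨?_⟩
  have h : ∀ i, P.map (l i) Set.univ = 1 := fun i => by
    rw [Measure.map_apply (hl i) MeasurableSet.univ, Set.preimage_univ, measure_univ]
  rw [averageLaw, Measure.smul_apply, Measure.finsetSum_apply]
  simp only [h, Finset.sum_const, Finset.card_univ, smul_eq_mul, nsmul_eq_mul, mul_one]
  exact ENNReal.inv_mul_cancel (by simp) (by simp)

theorem averageLaw_real [IsProbabilityMeasure P] (hl : ∀ i, Measurable (l i)) {s : Set ℝ}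
    (hs : MeasurableSet s) :
    (averageLaw P l).real s = (Fintype.card ι : ℝ)⁻¹ * ∑ i, P.real (l i ⁻¹' s) := by
  rw [measureReal_def, averageLaw, Measure.smul_apply, Measure.finsetSum_apply, smul_eq_mul,
    ENNReal.toReal_mul, ENNReal.toReal_inv, ENNReal.toReal_natCast, ENNReal.toReal_sum]
  · congr 1
    refine Finset.sum_congr rfl fun i _ => ?_
    rw [Measure.map_apply (hl i) hs, measureReal_def]
  · intro i _
    rw [Measure.map_apply (hl i) hs]
    exact measure_ne_top _ _

theorem integral_averageLaw (hl : ∀ i, Measurable (l i)) {g : ℝ → ℝ} (hg : Continuous g)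
    (hint : ∀ i, Integrable (fun ω => g (l i ω)) P) :
    ∫ x, g x ∂(averageLaw P l) = (Fintype.card ι : ℝ)⁻¹ * ∫ ω, ∑ i, g (l i ω) ∂P := by
  have hint' : ∀ i ∈ Finset.univ, Integrable g (P.map (l i)) := fun i _ =>
    (integrable_map_measure hg.aestronglyMeasurable (hl i).aemeasurable).2 (hint i)
  rw [averageLaw, integral_smul_measure, integral_finsetSum_measure hint', ENNReal.toReal_inv,
    ENNReal.toReal_natCast, smul_eq_mul, integral_finsetSum _ fun i _ => hint i]
  congr 1
  refine Finset.sum_congr rfl fun i _ => ?_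
  rw [integral_map (hl i).aemeasurable hg.aestronglyMeasurable]

theorem lintegral_averageLaw (hl : ∀ i, Measurable (l i)) {g : ℝ → ℝ≥0∞} (hg : Measurable g) :
    ∫⁻ x, g x ∂(averageLaw P l) = (Fintype.card ι : ℝ≥0∞)⁻¹ * ∫⁻ ω, ∑ i, g (l i ω) ∂P := by
  rw [averageLaw, lintegral_smul_measure, lintegral_finsetSum_measure, smul_eq_mul,
    lintegral_finsetSum (f := fun i ω => g (l i ω)) _ fun i _ => hg.comp (hl i)]
  congr 1
  refine Finset.sum_congr rfl fun i _ => ?_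
  rw [lintegral_map hg (hl i)]

end averageLaw

end limits

/-! ### Limiting spectral distributions: uniqueness, and existence from convergence of degrees of
freedom. -/

section lsd

open Matrix ComplexOrder

theorem isProbabilityMeasure_pointLaw {d : ℕ} {f : (Fin d → ℝ) → ℝ} (hf : IsDensityOnCube f) :
    IsProbabilityMeasure (pointLaw f) := by
  refine ⟨?_⟩
  rw [pointLaw, withDensity_apply _ MeasurableSet.univ, Measure.restrict_univ]
  exact hf.lintegral_eq_one

theorem measurable_vandermondeFold (d n m : ℕ) (l : Fin d → Fin n) (q : Fin m) :
    Measurable fun x : Fin m → Fin d → ℝ => vandermondeFold d n m x l q := by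
  simp only [vandermondeFold, Matrix.of_apply]
  fun_prop

theorem measurable_gram_vandermondeFold (d n m : ℕ) (i j : Fin d → Fin n) :
    Measurable fun x : Fin m → Fin d → ℝ =>
      (vandermondeFold d n m x * (vandermondeFold d n m x)ᴴ) i j := by
  simp only [Matrix.mul_apply, Matrix.conjTranspose_apply]
  exact Finset.measurable_sum _ fun q _ => (measurable_vandermondeFold d n m i q).mul
    (Complex.continuous_conj.measurable.comp (measurable_vandermondeFold d n m j q))

theorem measurable_gramEigenvalue (d n m : ℕ) (i : Fin d → Fin n) :
    Measurable fun x : Fin m → Fin d → ℝ => gramEigenvalue d n m x i :=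
  measurable_eigenvalues (measurable_gram_vandermondeFold d n m)
    (fun _ => posSemidef_self_mul_conjTranspose _) i

theorem gramEigenvalue_nonneg (d n m : ℕ) (x : Fin m → Fin d → ℝ) (i : Fin d → Fin n) :
    0 ≤ gramEigenvalue d n m x i :=
  (posSemidef_self_mul_conjTranspose (vandermondeFold d n m x)).eigenvalues_nonneg i

/-- All entries of V have modulus m^(-1/2), so the trace of VVᴴ does not depend on the points. The
mean eigenvalue is therefore 1, which is the source of tightness. -/
theorem sum_gramEigenvalue (d n : ℕ) {m : ℕ} (hm : 0 < m) (x : Fin m → Fin d → ℝ) :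
    ∑ i, gramEigenvalue d n m x i = (n : ℝ) ^ d := by
  have h := (isHermitian_mul_conjTranspose_self
    (vandermondeFold d n m x)).trace_eq_sum_eigenvalues
  have h2 := congrArg Complex.re h
  rw [trace_mul_conjTranspose_self] at h2
  simp only [Complex.coe_algebraMap, Complex.re_sum, Complex.ofReal_re] at h2
  have hm' : (0 : ℝ) < m := by exact_mod_cast hm
  have hnorm : ∀ i j, ‖vandermondeFold d n m x i j‖ ^ 2 = (m : ℝ)⁻¹ := by
    intro i j
    rw [vandermondeFold, Matrix.of_apply, norm_mul, norm_inv, Complex.norm_real, Complex.norm_exp]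
    have : ∀ r : ℝ, (-2 * (Real.pi : ℂ) * Complex.I * (r : ℂ)).re = 0 := by
      intro r
      simp
    rw [this, Real.exp_zero, mul_one, Real.norm_of_nonneg (Real.sqrt_nonneg _), inv_pow,
      Real.sq_sqrt hm'.le]
  simp only [hnorm, Finset.sum_const, Finset.card_univ, Fintype.card_fin, nsmul_eq_mul,
    mul_inv_cancel₀ hm'.ne', mul_one] at h2
  simp only [gramEigenvalue]
  refine h2.symm.trans ?_
  simp

/-- The regime `n, m → ∞`, `n ^ d / m → β` is attained. -/
theorem aspectFilter_neBot {d : ℕ} (hd : 1 ≤ d) {β : ℝ} (hβ : 0 < β) :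
    (aspectFilter d β).NeBot := by
  have hpow : Tendsto (fun n : ℕ => (n : ℝ) ^ d) atTop atTop :=
    (tendsto_pow_atTop (by omega)).comp tendsto_natCast_atTop_atTop
  have hdiv : Tendsto (fun n : ℕ => (n : ℝ) ^ d / β) atTop atTop := hpow.atTop_div_const hβ
  -- The witness is m = ⌈n^d / β⌉.
  have h1 : Tendsto (fun n : ℕ => (n, ⌈(n : ℝ) ^ d / β⌉₊)) atTop (atTop ×ˢ atTop) :=
    tendsto_id.prodMk (tendsto_nat_ceil_atTop.comp hdiv)
  have h2 : Tendsto (fun n : ℕ => (n, ⌈(n : ℝ) ^ d / β⌉₊)) atTop (aspectFilter d β) := by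
    refine tendsto_inf.2 ⟨h1, tendsto_comap_iff.2 ?_⟩
    have h3 : Tendsto (fun n : ℕ => (⌈(n : ℝ) ^ d / β⌉₊ : ℝ) / ((n : ℝ) ^ d / β)) atTop (𝓝 1) :=
      (tendsto_nat_ceil_div_atTop (R := ℝ)).comp hdiv
    have h4 := (h3.inv₀ one_ne_zero).const_mul β
    rw [inv_one, mul_one] at h4
    refine h4.congr fun n => ?_
    simp only [Function.comp_apply]
    rw [inv_div, ← mul_div_assoc, mul_div_cancel₀ _ hβ.ne']
  exact h2.neBot

theorem eventually_aspectFilter_pos (d : ℕ) (β : ℝ) :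
    ∀ᶠ p in aspectFilter d β, 0 < p.1 ∧ 0 < p.2 := by
  have h : ∀ᶠ p in (atTop : Filter ℕ) ×ˢ (atTop : Filter ℕ), 0 < p.1 ∧ 0 < p.2 :=
    (eventually_gt_atTop 0).prod_mk (eventually_gt_atTop 0)
  exact h.filter_mono inf_le_left

/-- The two distribution functions agree off the countable set of atoms, which has dense complement;
right continuity extends the agreement to every point. -/
theorem IsLSD.unique {d : ℕ} (hd : 1 ≤ d) {f : (Fin d → ℝ) → ℝ} {β : ℝ} (hβ : 0 < β)
    {μ ν : Measure ℝ} (hμ : IsLSD f β μ) (hν : IsLSD f β ν) : μ = ν := by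
  have := hμ.isProbabilityMeasure
  have := hν.isProbabilityMeasure
  have := aspectFilter_neBot hd hβ
  have hc : ∀ ρ : Measure ℝ, IsProbabilityMeasure ρ → {z | ρ {z} ≠ 0}.Countable := by
    intro ρ _
    have h := Measure.countable_meas_pos_of_disjoint_iUnion (μ := ρ)
      (As := fun z : ℝ => ({z} : Set ℝ)) (fun z => measurableSet_singleton z)
      fun x y hxy => by simpa using hxy
    simpa only [pos_iff_ne_zero] using h
  have heq : ∀ z ∉ {z | μ {z} ≠ 0} ∪ {z | ν {z} ≠ 0}, μ.real (Set.Iic z) = ν.real (Set.Iic z) := by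
    intro z hz
    simp only [Set.mem_union, Set.mem_ofPred_eq, not_or, not_not] at hz
    exact tendsto_nhds_unique (hμ.tendsto_cdf z hz.1) (hν.tendsto_cdf z hz.2)
  have hdense : Dense ({z | μ {z} ≠ 0} ∪ {z | ν {z} ≠ 0})ᶜ :=
    ((hc μ inferInstance).union (hc ν inferInstance)).dense_compl ℝ
  refine Measure.eq_of_cdf μ ν ?_
  refine StieltjesFunction.ext fun z => ?_
  rw [ProbabilityTheory.cdf_eq_real, ProbabilityTheory.cdf_eq_real]
  obtain ⟨u, hu, huz, hlim⟩ := hdense.exists_seq_strictAnti_tendsto z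
  have hr : ∀ ρ : Measure ℝ, IsProbabilityMeasure ρ →
      Tendsto (fun k => ρ.real (Set.Iic (u k))) atTop (𝓝 (ρ.real (Set.Iic z))) := by
    intro ρ _
    have h1 : ContinuousWithinAt (ProbabilityTheory.cdf ρ) (Set.Ici z) z :=
      (ProbabilityTheory.cdf ρ).right_continuous z
    have h2 : Tendsto u atTop (𝓝[Set.Ici z] z) :=
      tendsto_nhdsWithin_iff.2 ⟨hlim, Eventually.of_forall fun k => Set.mem_Ici_of_Ioi (huz k).1⟩
    have h3 := h1.tendsto.comp h2
    simpa only [Function.comp_def, ProbabilityTheory.cdf_eq_real] using h3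
  refine tendsto_nhds_unique (hr μ inferInstance) ((hr ν inferInstance).congr fun k => ?_)
  exact (heq (u k) (huz k).2).symm

/-- If the normalised expected degrees of freedom of `s V Vᴴ` converge for every `s > 0`, then the
limiting spectral distribution exists and its integrals of `s x / (1 + s x)` are the limits. -/
theorem exists_isLSD_of_tendsto_dof {d : ℕ} (hd : 1 ≤ d) {f : (Fin d → ℝ) → ℝ}
    (hf : IsDensityOnCube f) {β : ℝ} (hβ : 0 < β) {R : ℝ → ℝ}
    (hR : ∀ s : ℝ, 0 < s → Tendsto (fun p : ℕ × ℕ => ((p.1 : ℝ) ^ d)⁻¹ *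
      ∫ x, dof ((s : ℂ) • (vandermondeFold d p.1 p.2 x * (vandermondeFold d p.1 p.2 x)ᴴ))
        ∂(Measure.pi fun _ : Fin p.2 => pointLaw f)) (aspectFilter d β) (𝓝 (R s))) :
    ∃ μ : Measure ℝ, IsLSD f β μ ∧ μ (Set.Iio 0) = 0 ∧
      ∀ s : ℝ, 0 < s → ∫ x, ridge s x ∂μ = R s := by
  have := isProbabilityMeasure_pointLaw hf
  have := aspectFilter_neBot hd hβ
  set ν₀ : ℕ × ℕ → Measure ℝ := fun p =>
    averageLaw (Measure.pi fun _ : Fin p.2 => pointLaw f)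
      fun (i : Fin d → Fin p.1) x => gramEigenvalue d p.1 p.2 x i with hν₀
  have hprob : ∀ p : ℕ × ℕ, 0 < p.1 → IsProbabilityMeasure (ν₀ p) := by
    intro p hp
    have : Nonempty (Fin p.1) := ⟨⟨0, hp⟩⟩
    exact isProbabilityMeasure_averageLaw (measurable_gramEigenvalue d p.1 p.2)
  have hcard : ∀ p : ℕ × ℕ, (Fintype.card (Fin d → Fin p.1) : ℝ) = (p.1 : ℝ) ^ d := by
    intro p
    simp
  classical
  -- For n = 0 the average runs over an empty index set and is not a probability measure. The value
  -- there is irrelevant, as n > 0 eventually.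
  set ν : ℕ × ℕ → ProbabilityMeasure ℝ := fun p =>
    if hp : 0 < p.1 then ⟨ν₀ p, hprob p hp⟩ else ⟨Measure.dirac 0, inferInstance⟩ with hν
  have hνeq : ∀ᶠ p in aspectFilter d β, (ν p : Measure ℝ) = ν₀ p := by
    filter_upwards [eventually_aspectFilter_pos d β] with p hp
    have h : ν p = ⟨ν₀ p, hprob p hp.1⟩ := dif_pos hp.1
    rw [h]
    rfl
  have h0 : ∀ᶠ p in aspectFilter d β, (ν p : Measure ℝ) (Set.Iio 0) = 0 := by
    filter_upwards [hνeq] with p hp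
    rw [hp]
    simp only [hν₀, averageLaw, Measure.smul_apply, Measure.finsetSum_apply, smul_eq_mul]
    rw [Finset.sum_eq_zero, mul_zero]
    intro i _
    rw [Measure.map_apply (measurable_gramEigenvalue d p.1 p.2 i) measurableSet_Iio]
    convert measure_empty (μ := Measure.pi fun _ : Fin p.2 => pointLaw f)
    ext x
    simpa using gramEigenvalue_nonneg d p.1 p.2 x i
  have h1 : ∀ᶠ p in aspectFilter d β, ∫⁻ x, ENNReal.ofReal x ∂(ν p : Measure ℝ) ≤ 1 := by
    filter_upwards [hνeq, eventually_aspectFilter_pos d β] with p hp hpos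
    have : Nonempty (Fin p.1) := ⟨⟨0, hpos.1⟩⟩
    rw [hp, lintegral_averageLaw (measurable_gramEigenvalue d p.1 p.2) (by fun_prop)]
    have hsum : ∀ x : Fin p.2 → Fin d → ℝ,
        ∑ i, ENNReal.ofReal (gramEigenvalue d p.1 p.2 x i) =
          (Fintype.card (Fin d → Fin p.1) : ENNReal) := by
      intro x
      rw [← ENNReal.ofReal_sum_of_nonneg fun i _ => gramEigenvalue_nonneg d p.1 p.2 x i,
        sum_gramEigenvalue d p.1 hpos.2 x, ← hcard, ENNReal.ofReal_natCast]
    simp only [hsum, lintegral_const, measure_univ, mul_one]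
    exact (ENNReal.inv_mul_cancel (Nat.cast_ne_zero.2 Fintype.card_ne_zero)
      (ENNReal.natCast_ne_top _)).le
  have h2 : ∀ s : ℝ, 0 < s → Tendsto (fun p => ∫ x, ridge s x ∂(ν p : Measure ℝ))
      (aspectFilter d β) (𝓝 (R s)) := by
    intro s hs
    refine (hR s hs).congr' ?_
    filter_upwards [hνeq] with p hp
    rw [hp, integral_averageLaw (measurable_gramEigenvalue d p.1 p.2) (continuous_ridge hs.le), hcard]
    · congr 1
      refine integral_congr_ae (ae_of_all _ fun x => ?_)
      simp only
      rw [dof_smul (posSemidef_self_mul_conjTranspose _) hs.le]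
      refine Finset.sum_congr rfl fun i _ => ?_
      rw [ridge_of_nonneg s (gramEigenvalue_nonneg d p.1 p.2 x i)]
      rfl
    · intro i
      refine Integrable.of_bound ((continuous_ridge hs.le).measurable.comp
        (measurable_gramEigenvalue d p.1 p.2 i)).aestronglyMeasurable 1 (ae_of_all _ fun x => ?_)
      rw [Real.norm_eq_abs, abs_of_nonneg (ridge_nonneg hs.le _)]
      exact ridge_le_one hs.le _
  obtain ⟨μ, hμ, hμ0, hμR⟩ := exists_tendsto_of_tendsto_integral_ridge ν h0 h1 h2
  refine ⟨μ, ⟨inferInstance, fun z hz => ?_⟩, hμ0, hμR⟩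
  have hfr : (μ : Measure ℝ) (frontier (Set.Iic z)) = 0 := by
    rw [frontier_Iic]
    exact hz
  have h1 := ProbabilityMeasure.tendsto_measure_of_null_frontier_of_tendsto' hμ hfr
  have h2 := (ENNReal.tendsto_toReal (measure_ne_top _ _)).comp h1
  refine h2.congr' ?_
  filter_upwards [hνeq] with p hp
  simp only [Function.comp_apply]
  rw [hp, ← measureReal_def, averageLaw_real (measurable_gramEigenvalue d p.1 p.2)
    measurableSet_Iic, hcard]
  rfl

end lsd

/-! ### The Dirichlet kernel and its concentration at the diagonal. -/

section dirichlet

open scoped ENNReal ComplexConjugate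

/-- The character `exp (2 π i t)`. -/
noncomputable def unitExp (t : ℝ) : ℂ := Complex.exp (Complex.I * ((2 * Real.pi * t : ℝ) : ℂ))

theorem continuous_unitExp : Continuous unitExp := by
  unfold unitExp
  fun_prop

theorem unitExp_add (s t : ℝ) : unitExp (s + t) = unitExp s * unitExp t := by
  rw [unitExp, unitExp, unitExp, ← Complex.exp_add]
  congr 1
  push_cast
  ring

theorem unitExp_zero : unitExp 0 = 1 := by simp [unitExp]

theorem norm_unitExp (t : ℝ) : ‖unitExp t‖ = 1 := by
  rw [unitExp, mul_comm]
  exact Complex.norm_exp_ofReal_mul_I _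

theorem conj_unitExp (t : ℝ) : conj (unitExp t) = unitExp (-t) := by
  rw [unitExp, unitExp, ← Complex.exp_conj, map_mul, Complex.conj_I, Complex.conj_ofReal]
  congr 1
  push_cast
  ring

theorem unitExp_nat_mul (r : ℕ) (t : ℝ) : unitExp (r * t) = unitExp t ^ r := by
  rw [unitExp, unitExp, ← Complex.exp_nat_mul]
  congr 1
  push_cast
  ring

theorem norm_unitExp_sub_one (t : ℝ) : ‖unitExp t - 1‖ = 2 * |Real.sin (Real.pi * t)| := by
  rw [unitExp, Complex.norm_exp_I_mul_ofReal_sub_one, norm_mul, Real.norm_eq_abs, Real.norm_eq_abs,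
    abs_of_pos (two_pos : (0 : ℝ) < 2)]
  congr 3
  ring

theorem norm_unitExp_sub_one_le (t : ℝ) : ‖unitExp t - 1‖ ≤ 2 * Real.pi * |t| := by
  refine (Real.norm_exp_I_mul_ofReal_sub_one_le).trans ?_
  rw [Real.norm_eq_abs, abs_mul, abs_of_pos Real.two_pi_pos]

/-- The Dirichlet kernel `∑_{r < n} exp (2 π i r u)`. -/
noncomputable def dirichlet (n : ℕ) (u : ℝ) : ℂ := ∑ r ∈ Finset.range n, unitExp (r * u)

theorem continuous_dirichlet (n : ℕ) : Continuous (dirichlet n) := by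
  unfold dirichlet
  exact continuous_finsetSum _ fun r _ => continuous_unitExp.comp (by fun_prop)

theorem norm_dirichlet_le (n : ℕ) (u : ℝ) : ‖dirichlet n u‖ ≤ n := by
  refine (norm_sum_le _ _).trans ?_
  simp [norm_unitExp]

theorem dirichlet_zero (n : ℕ) : dirichlet n 0 = n := by simp [dirichlet, unitExp_zero]

/-- Every frequency below k n is k r + r' with r < n and r' < k. For points of one cell of side 1 /
k, the first factor is the n-frequency kernel of the relative positions and the second is nearly the
constant k. -/
theorem dirichlet_mul (k n : ℕ) (v : ℝ) :
    dirichlet (k * n) v = dirichlet n (k * v) * dirichlet k v := by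
  induction n with
  | zero => simp [dirichlet]
  | succ n ih =>
    rw [Nat.mul_succ, dirichlet, Finset.sum_range_add, ← dirichlet, ih]
    conv_rhs => rw [dirichlet, Finset.sum_range_succ, ← dirichlet, add_mul]
    congr 1
    rw [dirichlet, Finset.mul_sum]
    refine Finset.sum_congr rfl fun r _ => ?_
    rw [← unitExp_add]
    congr 1
    push_cast
    ring

theorem dirichlet_mul_sub (n : ℕ) (u : ℝ) :
    dirichlet n u * (unitExp u - 1) = unitExp (n * u) - 1 := by
  simp only [dirichlet, unitExp_nat_mul]
  exact geom_sum_mul _ _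

/-- The geometric sum is at most 1 / |sin πu|, and Jordan's inequality bounds the sine from below by
twice the distance of u to the integers 0 and ±1. -/
theorem norm_dirichlet_le_of_mem {δ : ℝ} (hδ : 0 < δ) (n : ℕ) {u : ℝ} (h1 : δ ≤ |u|)
    (h2 : |u| ≤ 1 - δ) : ‖dirichlet n u‖ ≤ (2 * δ)⁻¹ := by
  have hsin : 2 * δ ≤ |Real.sin (Real.pi * u)| := by
    have habs : |Real.sin (Real.pi * u)| = |Real.sin (Real.pi * |u|)| := by
      rcases abs_choice u with h | h
      · rw [h]
      · rw [h, mul_neg, Real.sin_neg, abs_neg]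
    rw [habs]
    refine le_trans ?_ (le_abs_self _)
    rcases le_or_gt |u| (1 / 2) with h | h
    · have := Real.mul_le_sin (x := Real.pi * |u|) (by positivity)
        (by nlinarith [Real.pi_pos])
      have h3 : 2 / Real.pi * (Real.pi * |u|) = 2 * |u| := by
        field_simp
      linarith
    · have := Real.mul_le_sin (x := Real.pi * (1 - |u|))
        (mul_nonneg Real.pi_pos.le (by linarith)) (by nlinarith [Real.pi_pos])
      have h3 : 2 / Real.pi * (Real.pi * (1 - |u|)) = 2 * (1 - |u|) := by
        field_simp
      have h4 : Real.sin (Real.pi * |u|) = Real.sin (Real.pi * (1 - |u|)) := by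
        rw [mul_sub, mul_one, Real.sin_pi_sub]
      linarith
  have h3 := congrArg norm (dirichlet_mul_sub n u)
  rw [norm_mul, norm_unitExp_sub_one] at h3
  have h4 : ‖unitExp (n * u) - 1‖ ≤ 2 := by
    refine (norm_sub_le _ _).trans ?_
    rw [norm_unitExp, norm_one]
    norm_num
  rw [← one_div, le_div_iff₀ (by positivity)]
  have h5 : 0 ≤ ‖dirichlet n u‖ := norm_nonneg _
  nlinarith

/-- A bound for `|1 - k⁻¹ D_k (u / k)|` which does not depend on `k`. -/
noncomputable def phaseSpread (u : ℝ) : ℝ := min 2 (2 * Real.pi * |u|)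

/-- D_k(u / k) / k is an average of unit numbers with arguments 2πur / k, r < k, each within 2π|u|
of 1 whatever the value of k. -/
theorem norm_one_sub_dirichlet_le {k : ℕ} (hk : 0 < k) (u : ℝ) :
    ‖1 - dirichlet k (u / k) / k‖ ≤ phaseSpread u := by
  have hk' : (0 : ℝ) < k := by exact_mod_cast hk
  have hkc : (k : ℂ) ≠ 0 := by exact_mod_cast hk.ne'
  have h1 : 1 - dirichlet k (u / k) / k =
      (k : ℂ)⁻¹ * ∑ r ∈ Finset.range k, (1 - unitExp (r * (u / k))) := by
    rw [Finset.sum_sub_distrib, dirichlet]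
    simp only [Finset.sum_const, Finset.card_range, nsmul_eq_mul, mul_one]
    rw [mul_sub, inv_mul_cancel₀ hkc, div_eq_inv_mul]
  rw [h1, norm_mul, norm_inv, Complex.norm_natCast, inv_mul_le_iff₀ hk']
  refine (norm_sum_le _ _).trans ?_
  refine (Finset.sum_le_card_nsmul _ _ (phaseSpread u) fun r hr => ?_).trans (by simp)
  refine le_min ?_ ?_
  · refine (norm_sub_le _ _).trans ?_
    rw [norm_unitExp, norm_one]
    norm_num
  · rw [norm_sub_rev]
    refine (norm_unitExp_sub_one_le _).trans ?_
    have hr' : (r : ℝ) ≤ k := by exact_mod_cast (Finset.mem_range.1 hr).le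
    have h2 : |(r : ℝ) * (u / k)| ≤ |u| := by
      rw [abs_mul, abs_div, Nat.abs_cast, Nat.abs_cast, mul_div_assoc', div_le_iff₀ hk',
        mul_comm]
      gcongr
    have := Real.pi_pos
    gcongr

theorem phaseSpread_nonneg (u : ℝ) : 0 ≤ phaseSpread u := by
  unfold phaseSpread
  have := Real.pi_pos
  positivity

theorem continuous_phaseSpread : Continuous phaseSpread := by
  unfold phaseSpread
  fun_prop

/-- Lebesgue measure on `[-1/2, 1/2)`. -/
noncomputable def unitLaw : Measure ℝ := volume.restrict (Set.Ico (-(1 / 2 : ℝ)) (1 / 2))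

instance : IsProbabilityMeasure unitLaw := by
  refine ⟨?_⟩
  rw [unitLaw, Measure.restrict_apply_univ, Real.volume_Ico]
  norm_num

theorem integral_unitExp_int (h : ℤ) :
    ∫ x, unitExp (h * x) ∂unitLaw = if h = 0 then 1 else 0 := by
  split_ifs with h0
  · subst h0
    simp [unitExp_zero]
  · rw [unitLaw, setIntegral_congr_set Ico_ae_eq_Ioc,
      ← intervalIntegral.integral_of_le (by norm_num)]
    have hc : (2 * Real.pi * Complex.I * h : ℂ) ≠ 0 := by
      have : (h : ℂ) ≠ 0 := by exact_mod_cast h0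
      have := Complex.two_pi_I_ne_zero
      positivity
    have hfun : ∀ x : ℝ, unitExp (h * x) = Complex.exp (2 * Real.pi * Complex.I * h * x) := by
      intro x
      rw [unitExp]
      congr 1
      push_cast
      ring
    simp only [hfun]
    rw [integral_exp_mul_complex hc, div_eq_zero_iff]
    left
    have hper : Complex.exp (2 * Real.pi * Complex.I * h * ((1 / 2 : ℝ) : ℂ)) =
        Complex.exp (2 * Real.pi * Complex.I * h * ((-(1 / 2) : ℝ) : ℂ)) := by
      rw [Complex.exp_eq_exp_iff_exists_int]
      refine ⟨h, ?_⟩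
      push_cast
      ring
    rw [hper, sub_self]

theorem norm_sq_dirichlet (n : ℕ) (u : ℝ) :
    ((‖dirichlet n u‖ ^ 2 : ℝ) : ℂ) =
      ∑ r ∈ Finset.range n, ∑ r' ∈ Finset.range n, unitExp (((r : ℤ) - (r' : ℤ) : ℤ) * u) := by
  rw [← Complex.normSq_eq_norm_sq, ← Complex.mul_conj, dirichlet, map_sum, Finset.sum_mul_sum]
  refine Finset.sum_congr rfl fun r _ => Finset.sum_congr rfl fun r' _ => ?_
  rw [conj_unitExp, ← unitExp_add]
  congr 1
  push_cast
  ring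

/-- Parseval's identity for the Dirichlet kernel. -/
theorem integral_norm_sq_dirichlet (n : ℕ) (y : ℝ) :
    ∫ y', ‖dirichlet n (y - y')‖ ^ 2 ∂unitLaw = n := by
  have h : ∫ y', ((‖dirichlet n (y - y')‖ ^ 2 : ℝ) : ℂ) ∂unitLaw = n := by
    simp only [norm_sq_dirichlet]
    have hint : ∀ h : ℤ, Integrable (fun y' => unitExp (h * (y - y'))) unitLaw := fun h =>
      Integrable.of_bound ((continuous_unitExp.comp (by fun_prop)).aestronglyMeasurable) 1
        (ae_of_all _ fun x => (norm_unitExp _).le)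
    have hval : ∀ h : ℤ, ∫ y', unitExp (h * (y - y')) ∂unitLaw = if h = 0 then 1 else 0 := by
      intro h
      have h1 : ∀ y', unitExp (h * (y - y')) = unitExp (h * y) * unitExp (((-h : ℤ) : ℝ) * y') := by
        intro y'
        rw [← unitExp_add]
        congr 1
        push_cast
        ring
      simp only [h1]
      rw [integral_const_mul, integral_unitExp_int]
      by_cases h0 : h = 0
      · subst h0
        simp [unitExp_zero]
      · simp [h0]
    rw [integral_finsetSum _ fun r _ => integrable_finsetSum _ fun r' _ => hint _]
    simp only [integral_finsetSum _ fun r' _ => hint _, hval, sub_eq_zero, Nat.cast_inj,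
      Finset.sum_ite_eq]
    rw [Finset.sum_congr rfl fun r hr => if_pos hr]
    simp
  rw [integral_complex_ofReal] at h
  exact_mod_cast h

theorem integrable_unitLaw_of_continuous {g : ℝ → ℝ} (hg : Continuous g) {K : ℝ}
    (hK : ∀ x, |g x| ≤ K) : Integrable g unitLaw :=
  Integrable.of_bound hg.aestronglyMeasurable K (ae_of_all _ hK)

/-- The normalised mass of the squared Dirichlet kernel away from the diagonal. -/
noncomputable def dirichletTail (n : ℕ) : ℝ :=
  (n : ℝ)⁻¹ * ∫ y, ∫ y', ‖dirichlet n (y - y')‖ ^ 2 * phaseSpread (y - y') ∂unitLaw ∂unitLaw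

theorem ae_unitLaw_mem : ∀ᵐ y ∂unitLaw, y ∈ Set.Ico (-(1 / 2 : ℝ)) (1 / 2) :=
  ae_restrict_mem measurableSet_Ico

theorem dirichletTail_nonneg (n : ℕ) : 0 ≤ dirichletTail n :=
  mul_nonneg (by positivity) (integral_nonneg fun _ => integral_nonneg fun _ =>
    mul_nonneg (by positivity) (phaseSpread_nonneg _))

/-- Three regions for u = y - y'. For |u| ≤ δ the weight is at most 2πδ; for δ < |u| ≤ 1 - δ the
kernel is bounded independently of n; for |u| > 1 - δ the kernel peaks again by periodicity, but
then y lies within δ of an endpoint, a set of measure 2δ. Parseval's identity controls the mass of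
the kernel in the outer two regions. -/
theorem dirichletTail_le {δ : ℝ} (hδ : 0 < δ) (hδ' : δ < 1 / 2) {n : ℕ} (hn : 0 < n) :
    dirichletTail n ≤ (2 * Real.pi + 4) * δ + (2 * δ ^ 2 * n)⁻¹ := by
  have hn' : (0 : ℝ) < n := by exact_mod_cast hn
  -- The points within δ of the ends of the interval, where the trivial weight bound 2 is used.
  set s : Set ℝ := (Set.Ioo (-(1 / 2 - δ)) (1 / 2 - δ))ᶜ with hs
  have hsm : MeasurableSet s := measurableSet_Ioo.compl
  set b : ℝ → ℝ := s.indicator fun _ => 2 with hb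
  have hb0 : ∀ y, 0 ≤ b y := fun y => Set.indicator_nonneg (fun _ _ => by norm_num) y
  have hbint : Integrable b unitLaw := (integrable_const _).indicator hsm
  have hbval : ∫ y, b y ∂unitLaw ≤ 4 * δ := by
    rw [hb, integral_indicator_const _ hsm, smul_eq_mul]
    have : unitLaw.real s = 2 * δ := by
      rw [hs, probReal_compl_eq_one_sub measurableSet_Ioo, measureReal_def, unitLaw,
        Measure.restrict_apply measurableSet_Ioo,
        Set.inter_eq_left.2 (Set.Ioo_subset_Ico_self.trans
          (Set.Ico_subset_Ico (by linarith) (by linarith))),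
        Real.volume_Ioo, ENNReal.toReal_ofReal (by linarith)]
      ring
    rw [this]
    linarith
  have hpt : ∀ y ∈ Set.Ico (-(1 / 2 : ℝ)) (1 / 2), ∀ y' ∈ Set.Ico (-(1 / 2 : ℝ)) (1 / 2),
      ‖dirichlet n (y - y')‖ ^ 2 * phaseSpread (y - y') ≤
        (2 * Real.pi * δ + b y) * ‖dirichlet n (y - y')‖ ^ 2 + (2 * δ ^ 2)⁻¹ := by
    intro y hy y' hy'
    have hD : 0 ≤ ‖dirichlet n (y - y')‖ ^ 2 := by positivity
    have hc : 0 ≤ (2 * δ ^ 2)⁻¹ := by positivity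
    have hpi := Real.pi_pos
    have hw2 : phaseSpread (y - y') ≤ 2 := min_le_left _ _
    have hbD : 0 ≤ b y * ‖dirichlet n (y - y')‖ ^ 2 := mul_nonneg (hb0 y) hD
    rcases le_or_gt |y - y'| δ with h | h
    · have hw : phaseSpread (y - y') ≤ 2 * Real.pi * δ :=
        (min_le_right _ _).trans (by gcongr)
      nlinarith
    rcases le_or_gt |y - y'| (1 - δ) with h1 | h1
    · have h2 := norm_dirichlet_le_of_mem hδ n h.le h1
      have h3 : ‖dirichlet n (y - y')‖ ^ 2 ≤ ((2 * δ)⁻¹) ^ 2 := by gcongr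
      have h4 : ((2 * δ)⁻¹) ^ 2 * 2 = (2 * δ ^ 2)⁻¹ := by
        field_simp
      have h5 : 0 ≤ 2 * Real.pi * δ * ‖dirichlet n (y - y')‖ ^ 2 := by positivity
      nlinarith
    · have hmem : y ∈ s := by
        rw [hs, Set.mem_compl_iff, Set.mem_Ioo, not_and_or, not_lt, not_lt]
        rcases lt_abs.1 h1 with h2 | h2
        · right
          linarith [hy'.1]
        · left
          linarith [hy'.2]
      have hby : b y = 2 := Set.indicator_of_mem hmem _
      have h5 : 0 ≤ 2 * Real.pi * δ * ‖dirichlet n (y - y')‖ ^ 2 := by positivity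
      rw [hby]
      nlinarith
  have hDb : ∀ y y' : ℝ, |‖dirichlet n (y - y')‖ ^ 2| ≤ (n : ℝ) ^ 2 := by
    intro y y'
    rw [abs_of_nonneg (by positivity)]
    have := norm_dirichlet_le n (y - y')
    gcongr
  have hDint : ∀ y, Integrable (fun y' => ‖dirichlet n (y - y')‖ ^ 2) unitLaw := fun y =>
    integrable_unitLaw_of_continuous
      (((continuous_dirichlet n).comp (by fun_prop)).norm.pow 2) (hDb y)
  have hbint' : Integrable (fun y => 2 * Real.pi * δ + b y) unitLaw :=
    (integrable_const _).add hbint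
  have hinner : ∀ y ∈ Set.Ico (-(1 / 2 : ℝ)) (1 / 2),
      ∫ y', ‖dirichlet n (y - y')‖ ^ 2 * phaseSpread (y - y') ∂unitLaw ≤
        (2 * Real.pi * δ + b y) * n + (2 * δ ^ 2)⁻¹ := by
    intro y hy
    calc ∫ y', ‖dirichlet n (y - y')‖ ^ 2 * phaseSpread (y - y') ∂unitLaw
        ≤ ∫ y', ((2 * Real.pi * δ + b y) * ‖dirichlet n (y - y')‖ ^ 2 + (2 * δ ^ 2)⁻¹)
            ∂unitLaw := by
          refine integral_mono_of_nonneg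
            (ae_of_all _ fun y' => mul_nonneg (by positivity) (phaseSpread_nonneg _))
            (((hDint y).const_mul _).add (integrable_const _)) ?_
          filter_upwards [ae_unitLaw_mem] with y' hy' using hpt y hy y' hy'
      _ = (2 * Real.pi * δ + b y) * n + (2 * δ ^ 2)⁻¹ := by
          rw [integral_add ((hDint y).const_mul _) (integrable_const _), integral_const_mul,
            integral_norm_sq_dirichlet]
          simp
  have houter : ∫ y, ∫ y', ‖dirichlet n (y - y')‖ ^ 2 * phaseSpread (y - y') ∂unitLaw ∂unitLaw ≤
      (2 * Real.pi * δ + 4 * δ) * n + (2 * δ ^ 2)⁻¹ := by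
    calc _ ≤ ∫ y, ((2 * Real.pi * δ + b y) * n + (2 * δ ^ 2)⁻¹) ∂unitLaw := by
          refine integral_mono_of_nonneg
            (ae_of_all _ fun y => integral_nonneg fun y' =>
              mul_nonneg (by positivity) (phaseSpread_nonneg _))
            ((hbint'.mul_const _).add (integrable_const _)) ?_
          filter_upwards [ae_unitLaw_mem] with y hy using hinner y hy
      _ = (2 * Real.pi * δ + ∫ y, b y ∂unitLaw) * n + (2 * δ ^ 2)⁻¹ := by
          rw [integral_add (hbint'.mul_const _) (integrable_const _),
            integral_mul_const, integral_add (integrable_const _) hbint]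
          simp
      _ ≤ _ := by gcongr
  rw [dirichletTail, inv_mul_le_iff₀ hn']
  refine houter.trans_eq ?_
  field_simp

theorem tendsto_dirichletTail : Tendsto dirichletTail atTop (𝓝 0) := by
  rw [Metric.tendsto_atTop]
  intro ε hε
  have hpi := Real.pi_pos
  set δ : ℝ := min (1 / 4) (ε / (2 * (2 * Real.pi + 4))) with hδ
  have hδ0 : 0 < δ := by positivity
  have hδ1 : δ < 1 / 2 := (min_le_left _ _).trans_lt (by norm_num)
  have hδ2 : (2 * Real.pi + 4) * δ ≤ ε / 2 := by
    have : δ ≤ ε / (2 * (2 * Real.pi + 4)) := min_le_right _ _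
    rw [le_div_iff₀ (by positivity)] at this
    linarith
  have hlim : Tendsto (fun n : ℕ => (2 * δ ^ 2 * (n : ℝ))⁻¹) atTop (𝓝 0) :=
    (tendsto_natCast_atTop_atTop.const_mul_atTop (by positivity)).inv_tendsto_atTop
  obtain ⟨N, hN⟩ := eventually_atTop.1
    ((hlim.eventually_lt_const (half_pos hε)).and (eventually_gt_atTop 0))
  refine ⟨N, fun n hn => ?_⟩
  rw [Real.dist_eq, sub_zero, abs_of_nonneg (dirichletTail_nonneg n)]
  have := dirichletTail_le hδ0 hδ1 (hN n hn).2
  linarith [(hN n hn).1]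

end dirichlet

/-! ### Subdivision of the cube into k^d cells. -/

section grid

open scoped ENNReal ComplexConjugate

/-- The point with relative position `y` in the `c`-th of the `k` cells of `[-1/2, 1/2)`. -/
noncomputable def gridPoint₁ (k : ℕ) (c : Fin k) (y : ℝ) : ℝ := ((c : ℝ) + 1 / 2 + y) / k - 1 / 2

theorem gridPoint₁_sub (k : ℕ) (c c' : Fin k) (y y' : ℝ) :
    gridPoint₁ k c y - gridPoint₁ k c' y' = ((c : ℝ) - c' + y - y') / k := by
  unfold gridPoint₁
  ring

theorem measurable_gridPoint₁ (k : ℕ) : Measurable fun z : Fin k × ℝ => gridPoint₁ k z.1 z.2 := by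
  unfold gridPoint₁
  have : Measurable fun z : Fin k × ℝ => ((z.1 : ℕ) : ℝ) :=
    (measurable_from_top (f := fun c : Fin k => ((c : ℕ) : ℝ))).comp measurable_fst
  fun_prop

/-- The uniform law on `k` cells. -/
noncomputable def uniformCell₁ (k : ℕ) : Measure (Fin k) := (k : ℝ≥0∞)⁻¹ • Measure.count

theorem isProbabilityMeasure_uniformCell₁ {k : ℕ} (hk : 0 < k) :
    IsProbabilityMeasure (uniformCell₁ k) := by
  refine ⟨?_⟩
  rw [uniformCell₁, Measure.smul_apply, Measure.count_univ, smul_eq_mul]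
  simp only [ENat.card_eq_coe_fintype_card, Fintype.card_fin, ENat.toENNReal_coe]
  exact ENNReal.inv_mul_cancel (by exact_mod_cast hk.ne') (by simp)

theorem uniformCell₁_singleton (k : ℕ) (c : Fin k) : uniformCell₁ k {c} = (k : ℝ≥0∞)⁻¹ := by
  rw [uniformCell₁, Measure.smul_apply, Measure.count_singleton, smul_eq_mul, mul_one]

/-- Each relative position map contracts [-1/2, 1/2) by k onto one cell, and the k cells tile the
interval. A uniform point is thus a uniform cell together with an independent uniform relative
position. -/
theorem measurePreserving_gridPoint₁ {k : ℕ} (hk : 0 < k) :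
    MeasurePreserving (fun z : Fin k × ℝ => gridPoint₁ k z.1 z.2)
      ((uniformCell₁ k).prod unitLaw) unitLaw := by
  have hk' : (0 : ℝ) < k := by exact_mod_cast hk
  have := isProbabilityMeasure_uniformCell₁ hk
  refine ⟨measurable_gridPoint₁ k, Measure.ext fun s hs => ?_⟩
  set cell : Fin k → Set ℝ := fun c => Set.Ico ((c : ℝ) / k - 1 / 2) (((c : ℝ) + 1) / k - 1 / 2)
    with hcell
  have hpre : ∀ c : Fin k, unitLaw (gridPoint₁ k c ⁻¹' s) = k * volume (cell c ∩ s) := by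
    intro c
    have hg : Measurable (gridPoint₁ k c) := by unfold gridPoint₁; fun_prop
    have h1 : gridPoint₁ k c ⁻¹' s ∩ Set.Ico (-(1 / 2 : ℝ)) (1 / 2) =
        gridPoint₁ k c ⁻¹' (cell c ∩ s) := by
      ext y
      simp only [Set.mem_inter_iff, Set.mem_preimage, hcell, Set.mem_Ico, gridPoint₁]
      rw [sub_le_sub_iff_right, sub_lt_sub_iff_right, div_le_div_iff_of_pos_right hk',
        div_lt_div_iff_of_pos_right hk', and_comm]
      refine and_congr (and_congr ⟨fun h => by linarith, fun h => by linarith⟩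
        ⟨fun h => by linarith, fun h => by linarith⟩) Iff.rfl
    have h2 : gridPoint₁ k c ⁻¹' (cell c ∩ s) =
        (fun y => (k : ℝ)⁻¹ * y) ⁻¹' ((fun y => y + (((c : ℝ) + 1 / 2) / k - 1 / 2)) ⁻¹'
          (cell c ∩ s)) := by
      ext y
      simp only [Set.mem_preimage, gridPoint₁]
      have : ((c : ℝ) + 1 / 2 + y) / k - 1 / 2 =
          (k : ℝ)⁻¹ * y + (((c : ℝ) + 1 / 2) / k - 1 / 2) := by
        field_simp
        ring
      rw [this]
    rw [unitLaw, Measure.restrict_apply (hg hs), h1, h2, Real.volume_preimage_mul_left (by positivity),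
      measure_preimage_add_right, inv_inv, abs_of_pos hk', ENNReal.ofReal_natCast]
  have hdisj : Pairwise fun c c' : Fin k => Disjoint (cell c ∩ s) (cell c' ∩ s) := by
    intro c c' hcc'
    refine Set.disjoint_left.2 fun x hx hx' => hcc' ?_
    have h1 := hx.1
    have h2 := hx'.1
    simp only [hcell, Set.mem_Ico] at h1 h2
    have h3 : (c : ℝ) / k < ((c' : ℝ) + 1) / k := by linarith
    have h4 : (c' : ℝ) / k < ((c : ℝ) + 1) / k := by linarith
    rw [div_lt_div_iff_of_pos_right hk'] at h3 h4
    have h5 : (c : ℕ) < c' + 1 := by exact_mod_cast h3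
    have h6 : (c' : ℕ) < c + 1 := by exact_mod_cast h4
    exact Fin.ext (by omega)
  have hunion : ⋃ c, cell c ∩ s = s ∩ Set.Ico (-(1 / 2 : ℝ)) (1 / 2) := by
    ext x
    simp only [Set.mem_iUnion, Set.mem_inter_iff, hcell, Set.mem_Ico]
    constructor
    · rintro ⟨c, ⟨h1, h2⟩, hx⟩
      have hc : ((c : ℝ) + 1) / k ≤ 1 := by
        rw [div_le_one hk']
        exact_mod_cast c.2
      have hc0 : 0 ≤ (c : ℝ) / k := by positivity
      exact ⟨hx, by linarith, by linarith⟩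
    · rintro ⟨hx, h1, h2⟩
      have h0 : 0 ≤ (k : ℝ) * (x + 1 / 2) := mul_nonneg hk'.le (by linarith)
      have hlt : ⌊(k : ℝ) * (x + 1 / 2)⌋₊ < k := by
        rw [Nat.floor_lt h0]
        nlinarith
      refine ⟨⟨_, hlt⟩, ⟨?_, ?_⟩, hx⟩
      · rw [sub_le_iff_le_add, div_le_iff₀ hk']
        have := Nat.floor_le h0
        simp only
        linarith
      · rw [lt_sub_iff_add_lt, lt_div_iff₀ hk']
        have := Nat.lt_floor_add_one ((k : ℝ) * (x + 1 / 2))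
        simp only
        linarith
  have hcellm : ∀ c, MeasurableSet (cell c ∩ s) := fun c => measurableSet_Ico.inter hs
  rw [Measure.map_apply (measurable_gridPoint₁ k) hs,
    Measure.prod_apply (measurable_gridPoint₁ k hs), lintegral_fintype]
  simp only [uniformCell₁_singleton]
  have hcongr : ∀ c : Fin k, unitLaw (Prod.mk c ⁻¹' ((fun z : Fin k × ℝ => gridPoint₁ k z.1 z.2)
      ⁻¹' s)) * (k : ℝ≥0∞)⁻¹ = volume (cell c ∩ s) := by
    intro c
    have : Prod.mk c ⁻¹' ((fun z : Fin k × ℝ => gridPoint₁ k z.1 z.2) ⁻¹' s) =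
        gridPoint₁ k c ⁻¹' s := rfl
    rw [this, hpre, mul_comm, ← mul_assoc, ENNReal.inv_mul_cancel (by exact_mod_cast hk.ne')
      (by simp), one_mul]
  rw [Finset.sum_congr rfl fun c _ => hcongr c, ← tsum_fintype (L := .unconditional _), ← measure_iUnion hdisj hcellm, hunion,
    unitLaw, Measure.restrict_apply hs]

/-- Lebesgue measure on the cube. -/
noncomputable def cubeLaw (d : ℕ) : Measure (Fin d → ℝ) := Measure.pi fun _ => unitLaw

instance (d : ℕ) : IsProbabilityMeasure (cubeLaw d) := by
  unfold cubeLaw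
  infer_instance

theorem cubeLaw_eq (d : ℕ) : cubeLaw d = volume.restrict (cube d) := by
  rw [cubeLaw, cube, volume_pi, Measure.restrict_pi_pi]
  rfl

/-- The uniform law on the `k ^ d` cells of the cube. -/
noncomputable def uniformCell (d k : ℕ) : Measure (Fin d → Fin k) :=
  Measure.pi fun _ => uniformCell₁ k

theorem isProbabilityMeasure_uniformCell (d : ℕ) {k : ℕ} (hk : 0 < k) :
    IsProbabilityMeasure (uniformCell d k) := by
  have := isProbabilityMeasure_uniformCell₁ hk
  unfold uniformCell
  infer_instance

theorem uniformCell_real_singleton {d k : ℕ} (hk : 0 < k) (c : Fin d → Fin k) :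
    (uniformCell d k).real {c} = ((k : ℝ) ^ d)⁻¹ := by
  have := isProbabilityMeasure_uniformCell₁ hk
  rw [measureReal_def, uniformCell, Measure.pi_singleton]
  simp [uniformCell₁_singleton]

/-- The point with relative position `y` in the cell `c` of the cube. -/
noncomputable def gridPoint {d k : ℕ} (c : Fin d → Fin k) (y : Fin d → ℝ) : Fin d → ℝ :=
  fun j => gridPoint₁ k (c j) (y j)

theorem measurePreserving_gridPoint (d : ℕ) {k : ℕ} (hk : 0 < k) :
    MeasurePreserving (fun z : (Fin d → Fin k) × (Fin d → ℝ) => gridPoint z.1 z.2)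
      ((uniformCell d k).prod (cubeLaw d)) (cubeLaw d) := by
  have := isProbabilityMeasure_uniformCell₁ hk
  have h1 : MeasurePreserving (fun (a : Fin d → Fin k × ℝ) i => gridPoint₁ k (a i).1 (a i).2)
      (Measure.pi fun _ => (uniformCell₁ k).prod unitLaw) (Measure.pi fun _ => unitLaw) :=
    measurePreserving_pi _ _ fun _ => measurePreserving_gridPoint₁ hk
  have h2 : MeasurePreserving (MeasurableEquiv.arrowProdEquivProdArrow (Fin k) ℝ (Fin d)).symm
      ((Measure.pi fun _ => uniformCell₁ k).prod (Measure.pi fun _ => unitLaw))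
      (Measure.pi fun _ => (uniformCell₁ k).prod unitLaw) :=
    (measurePreserving_arrowProdEquivProdArrow (Fin k) ℝ (Fin d)
      (fun _ => uniformCell₁ k) (fun _ => unitLaw)).symm
  have h3 : (fun z : (Fin d → Fin k) × (Fin d → ℝ) => gridPoint z.1 z.2) =
      (fun a i => gridPoint₁ k (a i).1 (a i).2) ∘
        (MeasurableEquiv.arrowProdEquivProdArrow (Fin k) ℝ (Fin d)).symm := by
    funext z j
    rfl
  rw [h3]
  unfold uniformCell cubeLaw
  exact h1.comp h2

theorem measurable_gridPoint (d k : ℕ) :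
    Measurable fun z : (Fin d → Fin k) × (Fin d → ℝ) => gridPoint z.1 z.2 := by
  unfold gridPoint gridPoint₁
  refine measurable_pi_lambda _ fun j => ?_
  have h1 : Measurable fun z : (Fin d → Fin k) × (Fin d → ℝ) => z.1 j :=
    (measurable_pi_apply j).comp measurable_fst
  have h2 : Measurable fun z : (Fin d → Fin k) × (Fin d → ℝ) => z.2 j :=
    (measurable_pi_apply j).comp measurable_snd
  have h3 : Measurable fun z : (Fin d → Fin k) × (Fin d → ℝ) => ((z.1 j : ℕ) : ℝ) :=
    (measurable_from_top (f := fun c : Fin k => ((c : ℕ) : ℝ))).comp h1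
  exact (((h3.add_const _).add h2).div_const _).sub_const _

theorem continuous_gridPoint₁ {k : ℕ} (c : Fin k) : Continuous (gridPoint₁ k c) := by
  unfold gridPoint₁
  fun_prop

theorem continuous_gridPoint {d k : ℕ} (c : Fin d → Fin k) : Continuous (gridPoint c) :=
  continuous_pi fun j => (continuous_gridPoint₁ (c j)).comp (continuous_apply j)

/-- Averages over the cube as averages over cells. -/
theorem integral_cubeLaw_eq_sum {E : Type*} [NormedAddCommGroup E] [NormedSpace ℝ E]
    [CompleteSpace E] {d k : ℕ} (hk : 0 < k)
    {g : (Fin d → ℝ) → E} (hg : Integrable g (cubeLaw d)) :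
    ∫ x, g x ∂(cubeLaw d) = ((k : ℝ) ^ d)⁻¹ • ∑ c : Fin d → Fin k,
      ∫ y, g (gridPoint c y) ∂(cubeLaw d) := by
  have := isProbabilityMeasure_uniformCell d hk
  have hmp := measurePreserving_gridPoint d hk
  have hg' : Integrable (fun z : (Fin d → Fin k) × (Fin d → ℝ) => g (gridPoint z.1 z.2))
      ((uniformCell d k).prod (cubeLaw d)) := hmp.integrable_comp_of_integrable hg
  have h1 : ∫ x, g x ∂(cubeLaw d) =
      ∫ z, g (gridPoint z.1 z.2) ∂((uniformCell d k).prod (cubeLaw d)) := by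
    conv_lhs => rw [← hmp.map_eq]
    rw [integral_map hmp.measurable.aemeasurable]
    rw [hmp.map_eq]
    exact hg.aestronglyMeasurable
  rw [h1, integral_prod _ hg', integral_fintype .of_finite, Finset.smul_sum]
  simp only [uniformCell_real_singleton hk]

theorem integral_unitLaw_eq_sum {E : Type*} [NormedAddCommGroup E] [NormedSpace ℝ E]
    [CompleteSpace E] {k : ℕ} (hk : 0 < k)
    {g : ℝ → E} (hg : Integrable g unitLaw) :
    ∫ x, g x ∂unitLaw = (k : ℝ)⁻¹ • ∑ c : Fin k, ∫ y, g (gridPoint₁ k c y) ∂unitLaw := by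
  have := isProbabilityMeasure_uniformCell₁ hk
  have hmp := measurePreserving_gridPoint₁ hk
  have hg' : Integrable (fun z : Fin k × ℝ => g (gridPoint₁ k z.1 z.2))
      ((uniformCell₁ k).prod unitLaw) := hmp.integrable_comp_of_integrable hg
  have h1 : ∫ x, g x ∂unitLaw =
      ∫ z, g (gridPoint₁ k z.1 z.2) ∂((uniformCell₁ k).prod unitLaw) := by
    conv_lhs => rw [← hmp.map_eq]
    rw [integral_map hmp.measurable.aemeasurable]
    rw [hmp.map_eq]
    exact hg.aestronglyMeasurable
  rw [h1, integral_prod _ hg', integral_fintype .of_finite, Finset.smul_sum]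
  simp [measureReal_def, uniformCell₁_singleton]

end grid

/-! ### Mean square comparison of the full kernel with the cellwise kernel. -/

section kernelComparison

open scoped ComplexConjugate

/-- The Gram kernel `∏_j D_n (x_j - x'_j)` of the phases of two points. -/
noncomputable def boxKernel {d : ℕ} (n : ℕ) (x x' : Fin d → ℝ) : ℂ :=
  ∏ j, dirichlet n (x j - x' j)

theorem Continuous.boxKernel {X : Type*} [TopologicalSpace X] {d : ℕ} (n : ℕ)
    {f g : X → Fin d → ℝ} (hf : Continuous f) (hg : Continuous g) :
    Continuous fun x => boxKernel n (f x) (g x) := by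
  unfold _root_.boxKernel
  exact continuous_finsetProd _ fun j _ => (continuous_dirichlet n).comp
    (((continuous_apply j).comp hf).sub ((continuous_apply j).comp hg))

theorem norm_boxKernel_le {d : ℕ} (n : ℕ) (x x' : Fin d → ℝ) :
    ‖boxKernel n x x'‖ ≤ (n : ℝ) ^ d := by
  rw [boxKernel, norm_prod]
  refine (Finset.prod_le_prod (fun _ _ => norm_nonneg _) fun j _ => norm_dirichlet_le n _).trans ?_
  simp

/-- Fubini and distributivity. Both kernels, their squared norms and their correlation factor over
the coordinates, so each reduces to dimension one. -/
theorem sum_integral_prod {𝕜 : Type*} [RCLike 𝕜] {d k : ℕ} (F : Fin k → Fin k → ℝ → ℝ → 𝕜) :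
    ∑ c : Fin d → Fin k, ∑ c' : Fin d → Fin k,
      ∫ y, ∫ y', ∏ j, F (c j) (c' j) (y j) (y' j) ∂(cubeLaw d) ∂(cubeLaw d) =
    (∑ c, ∑ c', ∫ y, ∫ y', F c c' y y' ∂unitLaw ∂unitLaw) ^ d := by
  have h1 : ∀ c c' : Fin d → Fin k,
      ∫ y, ∫ y', ∏ j, F (c j) (c' j) (y j) (y' j) ∂(cubeLaw d) ∂(cubeLaw d) =
        ∏ j, ∫ y, ∫ y', F (c j) (c' j) y y' ∂unitLaw ∂unitLaw := by
    intro c c'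
    have h2 : ∀ y : Fin d → ℝ, ∫ y', ∏ j, F (c j) (c' j) (y j) (y' j) ∂(cubeLaw d) =
        ∏ j, ∫ y', F (c j) (c' j) (y j) y' ∂unitLaw := fun y =>
      integral_fintype_prod_eq_prod (fun j y' => F (c j) (c' j) (y j) y')
    simp only [h2]
    exact integral_fintype_prod_eq_prod (fun j y => ∫ y', F (c j) (c' j) y y' ∂unitLaw)
  simp only [h1]
  have h3 : ∀ G : Fin k → 𝕜, ∀ _ : Unit, (∑ c, G c) ^ d = ∑ c : Fin d → Fin k, ∏ j, G (c j) := by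
    intro G _
    rw [← Fintype.piFinset_univ, ← Finset.prod_univ_sum]
    simp
  rw [h3 _ ()]
  refine Finset.sum_congr rfl fun c _ => ?_
  rw [Finset.prod_univ_sum, Fintype.piFinset_univ]

/-- The kernel on labelled points which only couples points of the same cell. -/
noncomputable def cellKernel {d k : ℕ} (n : ℕ) (c c' : Fin d → Fin k) (y y' : Fin d → ℝ) : ℂ :=
  if c = c' then (k : ℂ) ^ d * boxKernel n y y' else 0

theorem cellKernel_eq_prod {d k : ℕ} (n : ℕ) (c c' : Fin d → Fin k) (y y' : Fin d → ℝ) :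
    cellKernel n c c' y y' =
      ∏ j, if c j = c' j then (k : ℂ) * dirichlet n (y j - y' j) else 0 := by
  unfold cellKernel boxKernel
  split_ifs with h
  · subst h
    simp [Finset.prod_mul_distrib]
  · obtain ⟨j, hj⟩ := Function.ne_iff.1 h
    exact (Finset.prod_eq_zero (Finset.mem_univ j) (if_neg hj)).symm

/-- The normalised correlation of the two one-dimensional kernels. -/
noncomputable def cellCorrelation (k n : ℕ) : ℂ :=
  (n : ℂ)⁻¹ * ∫ y, ∫ y', ((‖dirichlet n (y - y')‖ ^ 2 : ℝ) : ℂ) *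
    (dirichlet k ((y - y') / k) / k) ∂unitLaw ∂unitLaw

theorem norm_integral_integral_dirichlet_le (n : ℕ) (g : ℝ → ℂ) (w : ℝ → ℝ)
    (hw : Continuous w) {K : ℝ} (hK : ∀ x, |w x| ≤ K) (hg : ∀ x, ‖g x‖ ≤ w x) :
    ‖∫ y, ∫ y', ((‖dirichlet n (y - y')‖ ^ 2 : ℝ) : ℂ) * g (y - y') ∂unitLaw ∂unitLaw‖ ≤
      ∫ y, ∫ y', ‖dirichlet n (y - y')‖ ^ 2 * w (y - y') ∂unitLaw ∂unitLaw := by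
  have hc : Continuous fun z : ℝ × ℝ => ‖dirichlet n (z.1 - z.2)‖ ^ 2 * w (z.1 - z.2) :=
    (((continuous_dirichlet n).comp (by fun_prop)).norm.pow 2).mul (hw.comp (by fun_prop))
  have hbound : ∀ z : ℝ × ℝ, ‖‖dirichlet n (z.1 - z.2)‖ ^ 2 * w (z.1 - z.2)‖ ≤ (n : ℝ) ^ 2 * K := by
    intro z
    rw [norm_mul, norm_pow, norm_norm, Real.norm_eq_abs]
    have := norm_dirichlet_le n (z.1 - z.2)
    gcongr
    exact hK _
  have hint : Integrable (fun z : ℝ × ℝ => ‖dirichlet n (z.1 - z.2)‖ ^ 2 * w (z.1 - z.2))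
      (unitLaw.prod unitLaw) :=
    Integrable.of_bound hc.aestronglyMeasurable _ (ae_of_all _ hbound)
  refine (norm_integral_le_integral_norm _).trans ?_
  refine integral_mono_of_nonneg (ae_of_all _ fun _ => norm_nonneg _) hint.integral_prod_left
    (ae_of_all _ fun y => ?_)
  refine (norm_integral_le_integral_norm _).trans ?_
  refine integral_mono_of_nonneg (ae_of_all _ fun _ => norm_nonneg _) ?_
    (ae_of_all _ fun y' => ?_)
  · exact Integrable.of_bound (hc.comp (by fun_prop : Continuous fun y' => (y, y'))
      ).aestronglyMeasurable _ (ae_of_all _ fun y' => hbound (y, y'))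
  · simp only [norm_mul, Complex.norm_real, norm_pow, norm_norm]
    have := hg (y - y')
    gcongr

theorem integral_integral_norm_sq_dirichlet (n : ℕ) :
    ∫ y, ∫ y', ((‖dirichlet n (y - y')‖ ^ 2 : ℝ) : ℂ) ∂unitLaw ∂unitLaw = n := by
  simp only [integral_complex_ofReal, integral_norm_sq_dirichlet]
  simp

theorem integrable_dirichlet_mul (n : ℕ) {g : ℝ → ℂ} (hg : Continuous g) {K : ℝ}
    (hK : ∀ x, ‖g x‖ ≤ K) : Integrable (fun z : ℝ × ℝ =>
      ((‖dirichlet n (z.1 - z.2)‖ ^ 2 : ℝ) : ℂ) * g (z.1 - z.2)) (unitLaw.prod unitLaw) := by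
  have h1 : Continuous fun z : ℝ × ℝ => dirichlet n (z.1 - z.2) :=
    (continuous_dirichlet n).comp (by fun_prop)
  have h2 : Continuous fun z : ℝ × ℝ => g (z.1 - z.2) := hg.comp (by fun_prop)
  refine Integrable.of_bound (Continuous.aestronglyMeasurable (by fun_prop)) ((n : ℝ) ^ 2 * K)
    (ae_of_all _ fun z => ?_)
  rw [norm_mul, Complex.norm_real, norm_pow, norm_norm]
  have := norm_dirichlet_le n (z.1 - z.2)
  gcongr
  exact hK _

theorem norm_dirichlet_div_le {k : ℕ} (u : ℝ) : ‖dirichlet k u / k‖ ≤ 1 := by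
  rw [norm_div, Complex.norm_natCast]
  exact div_le_one_of_le₀ (norm_dirichlet_le k u) (Nat.cast_nonneg k)

theorem norm_cellCorrelation_le {k n : ℕ} (hn : 0 < n) : ‖cellCorrelation k n‖ ≤ 1 := by
  have hn' : (0 : ℝ) < n := by exact_mod_cast hn
  rw [cellCorrelation, norm_mul, norm_inv, Complex.norm_natCast, inv_mul_le_iff₀ hn']
  refine (norm_integral_integral_dirichlet_le n (fun u => dirichlet k (u / k) / k) (fun _ => 1)
    continuous_const (K := 1) (by simp) fun x => norm_dirichlet_div_le _).trans ?_
  simp [integral_norm_sq_dirichlet]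

/-- By Parseval |D_n|² / n has total mass 1, so the quantity is an average of 1 - D_k(u / k) / k,
for which there is a bound free of k. -/
theorem norm_one_sub_cellCorrelation_le {k n : ℕ} (hk : 0 < k) (hn : 0 < n) :
    ‖1 - cellCorrelation k n‖ ≤ dirichletTail n := by
  have hn' : (n : ℂ) ≠ 0 := by exact_mod_cast hn.ne'
  have hc : Continuous fun u : ℝ => dirichlet k (u / k) / k :=
    ((continuous_dirichlet k).comp (by fun_prop)).div_const _
  have h1 := integrable_dirichlet_mul n (g := fun _ => 1) continuous_const (K := 1) (by simp)
  have h2 := integrable_dirichlet_mul n (g := fun u => dirichlet k (u / k) / k) hc (K := 1)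
    fun x => norm_dirichlet_div_le _
  have heq : 1 - cellCorrelation k n = (n : ℂ)⁻¹ * ∫ y, ∫ y',
      ((‖dirichlet n (y - y')‖ ^ 2 : ℝ) : ℂ) * (1 - dirichlet k ((y - y') / k) / k)
        ∂unitLaw ∂unitLaw := by
    have h3 := integral_prod _ h1
    have h4 := integral_prod _ h2
    have h5 := integral_prod _ (h1.sub h2)
    simp only [Pi.sub_apply] at h5
    rw [integral_sub h1 h2] at h5
    simp only [← mul_sub] at h5
    rw [← h5, h3, h4, cellCorrelation, mul_sub]
    simp only [mul_one]
    rw [integral_integral_norm_sq_dirichlet, inv_mul_cancel₀ hn']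
  rw [heq, norm_mul, norm_inv, Complex.norm_natCast, dirichletTail]
  refine mul_le_mul_of_nonneg_left ?_ (by positivity)
  refine norm_integral_integral_dirichlet_le n (fun u => 1 - dirichlet k (u / k) / k) phaseSpread
    continuous_phaseSpread (K := 2) (fun x => ?_) fun x => norm_one_sub_dirichlet_le hk x
  rw [abs_of_nonneg (phaseSpread_nonneg x)]
  exact min_le_left _ _

theorem norm_one_sub_pow_le {z : ℂ} (hz : ‖z‖ ≤ 1) (d : ℕ) : ‖1 - z ^ d‖ ≤ d * ‖1 - z‖ := by
  induction d with
  | zero => simp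
  | succ d ih =>
    have : 1 - z ^ (d + 1) = (1 - z ^ d) + z ^ d * (1 - z) := by ring
    rw [this]
    refine (norm_add_le _ _).trans ?_
    rw [norm_mul, norm_pow]
    have h1 : ‖z‖ ^ d ≤ 1 := pow_le_one₀ (norm_nonneg _) hz
    have h2 : ‖z‖ ^ d * ‖1 - z‖ ≤ 1 * ‖1 - z‖ := by gcongr
    push_cast
    linarith

/-- The cells reassemble to the whole interval, where Parseval's identity applies. -/
theorem sum_integral_norm_sq_dirichlet_grid {k : ℕ} (hk : 0 < k) (N : ℕ) :
    ∑ c : Fin k, ∑ c' : Fin k, ∫ y, ∫ y',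
      ‖dirichlet N (gridPoint₁ k c y - gridPoint₁ k c' y')‖ ^ 2 ∂unitLaw ∂unitLaw =
        (k : ℝ) ^ 2 * N := by
  have hk' : (k : ℝ) ≠ 0 := by exact_mod_cast hk.ne'
  have hint : ∀ x : ℝ, Integrable (fun x' => ‖dirichlet N (x - x')‖ ^ 2) unitLaw := fun x =>
    integrable_unitLaw_of_continuous (K := (N : ℝ) ^ 2)
      (((continuous_dirichlet N).comp (by fun_prop)).norm.pow 2) fun x' => by
        rw [abs_of_nonneg (by positivity)]
        have := norm_dirichlet_le N (x - x')
        gcongr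
  have hgc : ∀ c, Continuous (gridPoint₁ k c) := continuous_gridPoint₁
  have h1 : ∀ x : ℝ, ∑ c' : Fin k, ∫ y', ‖dirichlet N (x - gridPoint₁ k c' y')‖ ^ 2 ∂unitLaw =
      k * N := by
    intro x
    have := integral_unitLaw_eq_sum hk (hint x)
    rw [integral_norm_sq_dirichlet, smul_eq_mul, eq_inv_mul_iff_mul_eq₀ hk'] at this
    exact this.symm
  have hint2 : ∀ c c' : Fin k, Integrable (fun y => ∫ y',
      ‖dirichlet N (gridPoint₁ k c y - gridPoint₁ k c' y')‖ ^ 2 ∂unitLaw) unitLaw := by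
    intro c c'
    refine Integrable.integral_prod_left (f := fun z : ℝ × ℝ =>
      ‖dirichlet N (gridPoint₁ k c z.1 - gridPoint₁ k c' z.2)‖ ^ 2) ?_
    have hc : Continuous fun z : ℝ × ℝ => gridPoint₁ k c z.1 - gridPoint₁ k c' z.2 :=
      ((hgc c).comp continuous_fst).sub ((hgc c').comp continuous_snd)
    refine Integrable.of_bound (((continuous_dirichlet N).comp hc).norm.pow 2).aestronglyMeasurable
      ((N : ℝ) ^ 2) (ae_of_all _ fun z => ?_)
    rw [norm_pow, norm_norm]
    have := norm_dirichlet_le N (gridPoint₁ k c z.1 - gridPoint₁ k c' z.2)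
    gcongr
  have h2 : ∀ c : Fin k, ∑ c' : Fin k, ∫ y, ∫ y',
      ‖dirichlet N (gridPoint₁ k c y - gridPoint₁ k c' y')‖ ^ 2 ∂unitLaw ∂unitLaw = k * N := by
    intro c
    rw [← integral_finsetSum _ fun c' _ => hint2 c c']
    simp [h1]
  simp only [h2, Finset.sum_const, Finset.card_univ, Fintype.card_fin, nsmul_eq_mul]
  ring

/-- The kernel of `(k n) ^ d` frequencies on the whole cube is close in mean square to the kernel
of `n ^ d` frequencies on each of the `k ^ d` cells, uniformly in `k`. -/
theorem sum_integral_norm_sq_boxKernel_sub_le (d : ℕ) {k n : ℕ} (hk : 0 < k) (hn : 0 < n) :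
    ∑ c : Fin d → Fin k, ∑ c' : Fin d → Fin k, ∫ y, ∫ y',
      ‖boxKernel (k * n) (gridPoint c y) (gridPoint c' y') - cellKernel n c c' y y'‖ ^ 2
        ∂(cubeLaw d) ∂(cubeLaw d) ≤
      ((k : ℝ) ^ d) ^ 2 * (2 * ((k * n : ℕ) : ℝ) ^ d * (d * dirichletTail n)) := by
  have hk' : (k : ℝ) ≠ 0 := by exact_mod_cast hk.ne'
  have hkc : (k : ℂ) ≠ 0 := by exact_mod_cast hk.ne'
  have hnc : (n : ℂ) ≠ 0 := by exact_mod_cast hn.ne'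
  set A : (Fin d → Fin k) → (Fin d → Fin k) → (Fin d → ℝ) → (Fin d → ℝ) → ℂ :=
    fun c c' y y' => boxKernel (k * n) (gridPoint c y) (gridPoint c' y') with hA
  set B : (Fin d → Fin k) → (Fin d → Fin k) → (Fin d → ℝ) → (Fin d → ℝ) → ℂ :=
    fun c c' y y' => cellKernel n c c' y y' with hB
  set a : Fin k → Fin k → ℝ → ℝ → ℂ :=
    fun c c' y y' => dirichlet (k * n) (gridPoint₁ k c y - gridPoint₁ k c' y') with ha
  set b : Fin k → Fin k → ℝ → ℝ → ℂ :=
    fun c c' y y' => if c = c' then (k : ℂ) * dirichlet n (y - y') else 0 with hb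
  have hAa : ∀ c c' y y', A c c' y y' = ∏ j, a (c j) (c' j) (y j) (y' j) := fun _ _ _ _ => rfl
  have hBb : ∀ c c' y y', B c c' y y' = ∏ j, b (c j) (c' j) (y j) (y' j) :=
    fun c c' y y' => cellKernel_eq_prod n c c' y y'
  have hgc : ∀ c : Fin d → Fin k, Continuous (gridPoint c) := continuous_gridPoint
  have hAc : ∀ c c', Continuous fun z : (Fin d → ℝ) × (Fin d → ℝ) => A c c' z.1 z.2 :=
    fun c c' => Continuous.boxKernel (k * n) ((hgc c).comp continuous_fst)
      ((hgc c').comp continuous_snd)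
  have hBc : ∀ c c', Continuous fun z : (Fin d → ℝ) × (Fin d → ℝ) => B c c' z.1 z.2 := by
    intro c c'
    simp only [hB, cellKernel]
    split_ifs
    · exact continuous_const.mul (Continuous.boxKernel n continuous_fst continuous_snd)
    · exact continuous_const
  have hAn : ∀ c c' y y', ‖A c c' y y'‖ ≤ ((k * n : ℕ) : ℝ) ^ d := fun c c' y y' =>
    norm_boxKernel_le _ _ _
  have hBn : ∀ c c' y y', ‖B c c' y y'‖ ≤ (k : ℝ) ^ d * (n : ℝ) ^ d := by
    intro c c' y y'
    simp only [hB, cellKernel]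
    split_ifs
    · rw [norm_mul, norm_pow, Complex.norm_natCast]
      gcongr
      exact norm_boxKernel_le _ _ _
    · rw [norm_zero]
      positivity
  -- Expand the square. The two kernels have equal total energy, so only their correlation must be
  -- estimated. The energy of A between different cells needs no separate bound: equal norms and
  -- almost full correlation make it small.
  have hsplit : ∀ c c', ∫ y, ∫ y', ‖A c c' y y' - B c c' y y'‖ ^ 2 ∂(cubeLaw d) ∂(cubeLaw d) =
      ∫ y, ∫ y', ‖A c c' y y'‖ ^ 2 ∂(cubeLaw d) ∂(cubeLaw d) +
      ∫ y, ∫ y', ‖B c c' y y'‖ ^ 2 ∂(cubeLaw d) ∂(cubeLaw d) -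
      2 * (∫ y, ∫ y', A c c' y y' * conj (B c c' y y') ∂(cubeLaw d) ∂(cubeLaw d)).re := by
    intro c c'
    have hi1 : Integrable (fun z : (Fin d → ℝ) × (Fin d → ℝ) => ‖A c c' z.1 z.2‖ ^ 2)
        ((cubeLaw d).prod (cubeLaw d)) :=
      Integrable.of_bound ((hAc c c').norm.pow 2).aestronglyMeasurable ((((k * n : ℕ) : ℝ) ^ d) ^ 2)
        (ae_of_all _ fun z => by
          rw [norm_pow, norm_norm]
          have := hAn c c' z.1 z.2
          gcongr)
    have hi2 : Integrable (fun z : (Fin d → ℝ) × (Fin d → ℝ) => ‖B c c' z.1 z.2‖ ^ 2)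
        ((cubeLaw d).prod (cubeLaw d)) :=
      Integrable.of_bound ((hBc c c').norm.pow 2).aestronglyMeasurable
        (((k : ℝ) ^ d * (n : ℝ) ^ d) ^ 2)
        (ae_of_all _ fun z => by
          rw [norm_pow, norm_norm]
          have := hBn c c' z.1 z.2
          gcongr)
    have hi3 : Integrable (fun z : (Fin d → ℝ) × (Fin d → ℝ) =>
        A c c' z.1 z.2 * conj (B c c' z.1 z.2)) ((cubeLaw d).prod (cubeLaw d)) :=
      Integrable.of_bound ((hAc c c').mul
        (Complex.continuous_conj.comp (hBc c c'))).aestronglyMeasurable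
        (((k * n : ℕ) : ℝ) ^ d * ((k : ℝ) ^ d * (n : ℝ) ^ d))
        (ae_of_all _ fun z => by
          rw [norm_mul, RCLike.norm_conj]
          have h1 := hAn c c' z.1 z.2
          have h2 := hBn c c' z.1 z.2
          gcongr)
    have hi3' : Integrable (fun z : (Fin d → ℝ) × (Fin d → ℝ) =>
        (A c c' z.1 z.2 * conj (B c c' z.1 z.2)).re) ((cubeLaw d).prod (cubeLaw d)) := hi3.re
    have hpt : ∀ z : (Fin d → ℝ) × (Fin d → ℝ), ‖A c c' z.1 z.2 - B c c' z.1 z.2‖ ^ 2 =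
        ‖A c c' z.1 z.2‖ ^ 2 + ‖B c c' z.1 z.2‖ ^ 2 -
          2 * (A c c' z.1 z.2 * conj (B c c' z.1 z.2)).re := by
      intro z
      rw [← Complex.normSq_eq_norm_sq, ← Complex.normSq_eq_norm_sq, ← Complex.normSq_eq_norm_sq,
        Complex.normSq_sub]
    have hi12 : Integrable (fun z : (Fin d → ℝ) × (Fin d → ℝ) =>
        ‖A c c' z.1 z.2‖ ^ 2 + ‖B c c' z.1 z.2‖ ^ 2) ((cubeLaw d).prod (cubeLaw d)) := hi1.add hi2
    have hi4 : Integrable (fun z : (Fin d → ℝ) × (Fin d → ℝ) =>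
        ‖A c c' z.1 z.2 - B c c' z.1 z.2‖ ^ 2) ((cubeLaw d).prod (cubeLaw d)) := by
      simp only [hpt]
      exact hi12.sub (hi3'.const_mul 2)
    rw [← integral_prod _ hi4, ← integral_prod _ hi1, ← integral_prod _ hi2, ← integral_prod _ hi3]
    simp only [hpt]
    rw [integral_sub hi12 (hi3'.const_mul 2), integral_add hi1 hi2, integral_const_mul]
    congr 2
    exact integral_re hi3
  have hα : ∑ c : Fin d → Fin k, ∑ c' : Fin d → Fin k,
      ∫ y, ∫ y', ‖A c c' y y'‖ ^ 2 ∂(cubeLaw d) ∂(cubeLaw d) =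
      ((k : ℝ) ^ 2 * (k * n : ℕ)) ^ d := by
    simp only [hAa, norm_prod, ← Finset.prod_pow]
    rw [sum_integral_prod (fun c c' y y' => ‖a c c' y y'‖ ^ 2)]
    simp only [ha]
    rw [sum_integral_norm_sq_dirichlet_grid hk]
  have hβ : ∑ c : Fin d → Fin k, ∑ c' : Fin d → Fin k,
      ∫ y, ∫ y', ‖B c c' y y'‖ ^ 2 ∂(cubeLaw d) ∂(cubeLaw d) =
      ((k : ℝ) ^ 2 * (k * n : ℕ)) ^ d := by
    simp only [hBb, norm_prod, ← Finset.prod_pow]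
    rw [sum_integral_prod (fun c c' y y' => ‖b c c' y y'‖ ^ 2)]
    congr 1
    have h1 : ∀ c c' : Fin k, ∫ y, ∫ y', ‖b c c' y y'‖ ^ 2 ∂unitLaw ∂unitLaw =
        if c = c' then (k : ℝ) ^ 2 * n else 0 := by
      intro c c'
      simp only [hb]
      split_ifs
      · simp only [norm_mul, Complex.norm_natCast, mul_pow, integral_const_mul,
          integral_norm_sq_dirichlet]
        simp
      · simp
    simp only [h1, Finset.sum_ite_eq, Finset.mem_univ, if_true, Finset.sum_const, Finset.card_univ,
      Fintype.card_fin, nsmul_eq_mul]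
    push_cast
    ring
  have hγ : ∑ c : Fin d → Fin k, ∑ c' : Fin d → Fin k,
      ∫ y, ∫ y', A c c' y y' * conj (B c c' y y') ∂(cubeLaw d) ∂(cubeLaw d) =
      ((k : ℂ) ^ 2 * (k * n : ℕ) * cellCorrelation k n) ^ d := by
    simp only [hAa, hBb, map_prod, ← Finset.prod_mul_distrib]
    rw [sum_integral_prod (fun c c' y y' => a c c' y y' * conj (b c c' y y'))]
    congr 1
    -- Only equal cells contribute, because b vanishes otherwise; there the factorisation of D_{kn}
    -- produces |D_n|² times D_k / k.
    have h1 : ∀ c c' : Fin k, ∫ y, ∫ y', a c c' y y' * conj (b c c' y y') ∂unitLaw ∂unitLaw =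
        if c = c' then (k : ℂ) ^ 2 * n * cellCorrelation k n else 0 := by
      intro c c'
      simp only [ha, hb]
      split_ifs with h
      · subst h
        have h2 : ∀ y y' : ℝ, dirichlet (k * n) (gridPoint₁ k c y - gridPoint₁ k c y') *
            conj ((k : ℂ) * dirichlet n (y - y')) = (k : ℂ) ^ 2 *
              (((‖dirichlet n (y - y')‖ ^ 2 : ℝ) : ℂ) * (dirichlet k ((y - y') / k) / k)) := by
          intro y y'
          have h3 : (k : ℝ) * ((y - y') / k) = y - y' := by
            field_simp
          rw [gridPoint₁_sub, sub_self, zero_add, dirichlet_mul, h3, map_mul, Complex.conj_natCast,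
            ← Complex.normSq_eq_norm_sq, ← Complex.mul_conj]
          field_simp
        simp only [h2, integral_const_mul]
        rw [cellCorrelation]
        field_simp
      · simp
    simp only [h1, Finset.sum_ite_eq, Finset.mem_univ, if_true, Finset.sum_const, Finset.card_univ,
      Fintype.card_fin, nsmul_eq_mul]
    push_cast
    ring
  calc ∑ c : Fin d → Fin k, ∑ c' : Fin d → Fin k, ∫ y, ∫ y', ‖A c c' y y' - B c c' y y'‖ ^ 2
        ∂(cubeLaw d) ∂(cubeLaw d)
      = ((k : ℝ) ^ d) ^ 2 * (2 * ((k * n : ℕ) : ℝ) ^ d * (1 - cellCorrelation k n ^ d).re) := by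
        simp only [hsplit, Finset.sum_sub_distrib, Finset.sum_add_distrib, ← Finset.mul_sum,
          ← Complex.re_sum]
        rw [hα, hβ, hγ, mul_pow _ (cellCorrelation k n)]
        have : ((k : ℂ) ^ 2 * (k * n : ℕ)) ^ d = ((((k : ℝ) ^ 2 * (k * n : ℕ)) ^ d : ℝ) : ℂ) := by
          push_cast
          ring
        rw [this, Complex.re_ofReal_mul, Complex.sub_re, Complex.one_re]
        ring
    _ ≤ ((k : ℝ) ^ d) ^ 2 * (2 * ((k * n : ℕ) : ℝ) ^ d * (d * dirichletTail n)) := by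
        gcongr
        refine (Complex.re_le_norm _).trans ?_
        refine (norm_one_sub_pow_le (norm_cellCorrelation_le hn) d).trans ?_
        gcongr
        exact norm_one_sub_cellCorrelation_le hk hn

end kernelComparison

/-! ### Phase vectors and the degrees of freedom of a set of points. -/

section phases

open Matrix ComplexOrder
open scoped ComplexConjugate

/-- The vector of the phases `exp (-2 π i l ᵀ z)`, `l ∈ {0, …, n - 1} ^ d`. -/
noncomputable def phaseVector {d : ℕ} (n : ℕ) (z : Fin d → ℝ) : (Fin d → Fin n) → ℂ :=
  fun l => unitExp (-∑ j, ((l j : ℕ) : ℝ) * z j)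

/-- The degrees of freedom of `s ∑_{q ∈ Q} v_q v_qᴴ`, with the phase vectors `v_q` of the points
`x_q`. -/
noncomputable def phaseDof {ι : Type*} {d : ℕ} (n : ℕ) (s : ℝ) (x : ι → Fin d → ℝ)
    (Q : Finset ι) : ℝ :=
  dof ((s : ℂ) • ∑ q ∈ Q, vecMulVec (phaseVector n (x q)) (star (phaseVector n (x q))))

theorem star_phaseVector_dotProduct {d : ℕ} (n : ℕ) (z z' : Fin d → ℝ) :
    ∑ l, conj (phaseVector n z l) * phaseVector n z' l = boxKernel n z z' := by
  have h : ∀ l : Fin d → Fin n, conj (phaseVector n z l) * phaseVector n z' l =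
      ∏ j, unitExp (((l j : ℕ) : ℝ) * (z j - z' j)) := by
    intro l
    rw [phaseVector, phaseVector, conj_unitExp, ← unitExp_add, neg_neg, ← sub_eq_add_neg,
      ← Finset.sum_sub_distrib]
    have hs : ∀ (s : Finset (Fin d)) (g : Fin d → ℝ),
        unitExp (∑ j ∈ s, g j) = ∏ j ∈ s, unitExp (g j) := by
      intro s g
      induction s using Finset.induction_on with
      | empty => simp [unitExp_zero]
      | insert i s hi ih => rw [Finset.sum_insert hi, Finset.prod_insert hi, unitExp_add, ih]
    rw [hs]
    simp only [mul_sub]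
  have hD : ∀ j, dirichlet n (z j - z' j) =
      ∑ r : Fin n, unitExp (((r : ℕ) : ℝ) * (z j - z' j)) := fun j => by
    rw [dirichlet, Finset.sum_range]
  simp only [h, boxKernel, hD]
  rw [Finset.prod_univ_sum, Fintype.piFinset_univ]

/-- Absorbing √s into the vectors brings the weighted sum into the form required by the rank-one
update bounds. -/
theorem sum_smul_vecMulVec {ι a : Type*} {s : ℝ} (hs : 0 ≤ s) (v : ι → a → ℂ) (Q : Finset ι) :
    (s : ℂ) • ∑ q ∈ Q, vecMulVec (v q) (star (v q)) =
      ∑ q ∈ Q, vecMulVec ((Real.sqrt s : ℂ) • v q) (star ((Real.sqrt s : ℂ) • v q)) := by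
  rw [Finset.smul_sum]
  refine Finset.sum_congr rfl fun q _ => ?_
  ext i j
  simp only [Matrix.smul_apply, vecMulVec_apply, Pi.smul_apply, Pi.star_apply, smul_eq_mul, star_mul',
    Complex.star_def, Complex.conj_ofReal]
  have h : (s : ℂ) = (Real.sqrt s : ℂ) * (Real.sqrt s : ℂ) := by
    rw [← Complex.ofReal_mul, Real.mul_self_sqrt hs]
  nth_rw 1 [h]
  ring

theorem posSemidef_ofReal_smul {a : Type*} {A : Matrix a a ℂ} (hA : A.PosSemidef) {s : ℝ}
    (hs : 0 ≤ s) : ((s : ℂ) • A).PosSemidef :=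
  hA.smul (by exact_mod_cast hs)

theorem posSemidef_sum_phase {ι : Type*} {d : ℕ} (n : ℕ) (x : ι → Fin d → ℝ) (Q : Finset ι) :
    (∑ q ∈ Q, vecMulVec (phaseVector n (x q)) (star (phaseVector n (x q)))).PosSemidef :=
  posSemidef_sum _ fun _ _ => posSemidef_vecMulVec_self_star _

section phaseDof

variable {ι κ : Type*} {d : ℕ} (n : ℕ) {s : ℝ} (x : ι → Fin d → ℝ)

theorem phaseDof_nonneg (hs : 0 ≤ s) (Q : Finset ι) : 0 ≤ phaseDof n s x Q :=
  dof_nonneg (posSemidef_ofReal_smul (posSemidef_sum_phase n x Q) hs)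

theorem phaseDof_le (hs : 0 ≤ s) (Q : Finset ι) : phaseDof n s x Q ≤ (n : ℝ) ^ d := by
  refine (dof_le_card (posSemidef_ofReal_smul (posSemidef_sum_phase n x Q) hs)).trans_eq ?_
  simp

theorem phaseDof_mono [DecidableEq ι] (hs : 0 ≤ s) {Q Q' : Finset ι} (h : Q ⊆ Q') :
    phaseDof n s x Q ≤ phaseDof n s x Q' ∧
      phaseDof n s x Q' ≤ phaseDof n s x Q + ((Q'.card : ℝ) - Q.card) := by
  unfold phaseDof
  rw [sum_smul_vecMulVec hs, sum_smul_vecMulVec hs]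
  exact dof_sum_vecMulVec_mono _ h

theorem phaseDof_comp (s : ℝ) (e : κ ↪ ι) (Q : Finset κ) :
    phaseDof n s (x ∘ e) Q = phaseDof n s x (Q.map e) := by
  unfold phaseDof
  rw [Finset.sum_map]
  rfl

variable {n x} in
theorem phaseDof_congr {x' : ι → Fin d → ℝ} (s : ℝ) {Q : Finset ι} (h : ∀ q ∈ Q, x q = x' q) :
    phaseDof n s x Q = phaseDof n s x' Q := by
  unfold phaseDof
  rw [Finset.sum_congr rfl fun q hq => by rw [h q hq]]

/-- Moving one point changes the degrees of freedom by at most one. -/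
theorem abs_phaseDof_sub_le [DecidableEq ι] (hs : 0 ≤ s) (Q : Finset ι) {x' : ι → Fin d → ℝ}
    (i : ι) (h : ∀ q, q ≠ i → x q = x' q) :
    |phaseDof n s x Q - phaseDof n s x' Q| ≤ 1 := by
  have h1 := phaseDof_mono n x hs (Q.erase_subset i)
  have h2 := phaseDof_mono n x' hs (Q.erase_subset i)
  have h3 : phaseDof n s x (Q.erase i) = phaseDof n s x' (Q.erase i) :=
    phaseDof_congr s fun q hq => h q (Finset.ne_of_mem_erase hq)
  have h4 : (Q.card : ℝ) - (Q.erase i).card ≤ 1 := by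
    have : Q.card ≤ (Q.erase i).card + 1 := by
      have := Finset.pred_card_le_card_erase (s := Q) (a := i)
      omega
    have : (Q.card : ℝ) ≤ (Q.erase i).card + 1 := by exact_mod_cast this
    linarith
  rw [abs_le]
  constructor <;> linarith [h1.1, h1.2, h2.1, h2.2]

theorem continuous_phaseVector (l : Fin d → Fin n) :
    Continuous fun z : Fin d → ℝ => phaseVector n z l := by
  unfold phaseVector
  exact continuous_unitExp.comp (continuous_finsetSum _ fun j _ =>
    continuous_const.mul (continuous_apply j)).neg

theorem measurable_phaseDof {Ω : Type*} [MeasurableSpace Ω] {n : ℕ} {s : ℝ}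
    {x : Ω → ι → Fin d → ℝ} (hx : ∀ q, Measurable fun ω => x ω q) (Q : Finset ι) :
    Measurable fun ω => phaseDof n s (x ω) Q := by
  refine measurable_dof fun i j => ?_
  simp only [Matrix.smul_apply, Matrix.sum_apply, vecMulVec_apply, Pi.star_apply]
  refine Measurable.const_mul (Finset.measurable_sum _ fun q _ => ?_) _
  exact ((continuous_phaseVector n i).measurable.comp (hx q)).mul
    (Complex.continuous_conj.measurable.comp ((continuous_phaseVector n j).measurable.comp (hx q)))

theorem integrable_phaseDof {Ω : Type*} [MeasurableSpace Ω] {P : Measure Ω} [IsFiniteMeasure P]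
    {n : ℕ} {s : ℝ} (hs : 0 ≤ s) {x : Ω → ι → Fin d → ℝ} (hx : ∀ q, Measurable fun ω => x ω q)
    (Q : Finset ι) : Integrable (fun ω => phaseDof n s (x ω) Q) P := by
  refine Integrable.of_bound (measurable_phaseDof hx Q).aestronglyMeasurable ((n : ℝ) ^ d)
    (ae_of_all _ fun ω => ?_)
  rw [Real.norm_eq_abs, abs_of_nonneg (phaseDof_nonneg n _ hs Q)]
  exact phaseDof_le n _ hs Q

/-- The degrees of freedom in terms of the Gram matrix of the points. -/
theorem phaseDof_eq_dof_gram [Fintype ι] [DecidableEq ι] (hs : 0 ≤ s) (Q : Finset ι) :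
    phaseDof n s x Q = dof ((s : ℂ) • (Matrix.of fun p q =>
      if p ∈ Q ∧ q ∈ Q then boxKernel n (x p) (x q) else 0)) ∧
    ((s : ℂ) • (Matrix.of fun p q =>
      if p ∈ Q ∧ q ∈ Q then boxKernel n (x p) (x q) else 0)).PosSemidef := by
  set M : Matrix (Fin d → Fin n) ι ℂ := Matrix.of fun l q =>
    if q ∈ Q then (Real.sqrt s : ℂ) * phaseVector n (x q) l else 0 with hM
  have hss : (s : ℂ) = (Real.sqrt s : ℂ) * (Real.sqrt s : ℂ) := by
    rw [← Complex.ofReal_mul, Real.mul_self_sqrt hs]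
  have h1 : M * Mᴴ =
      (s : ℂ) • ∑ q ∈ Q, vecMulVec (phaseVector n (x q)) (star (phaseVector n (x q))) := by
    rw [sum_smul_vecMulVec hs]
    ext i j
    simp only [mul_apply, conjTranspose_apply, Matrix.sum_apply, vecMulVec_apply, hM, Matrix.of_apply,
      Pi.smul_apply, Pi.star_apply, smul_eq_mul]
    rw [← Finset.sum_filter_add_sum_filter_not Finset.univ (· ∈ Q)]
    rw [Finset.sum_eq_zero (s := Finset.univ.filter (· ∉ Q)) fun q hq => by
      rw [if_neg (Finset.mem_filter.1 hq).2, zero_mul], add_zero]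
    refine Finset.sum_congr (by ext; simp) fun q hq => ?_
    rw [if_pos hq, if_pos hq]
  have h2 : Mᴴ * M = (s : ℂ) • (Matrix.of fun p q =>
      if p ∈ Q ∧ q ∈ Q then boxKernel n (x p) (x q) else 0) := by
    ext p q
    simp only [mul_apply, conjTranspose_apply, hM, Matrix.of_apply, Matrix.smul_apply, smul_eq_mul]
    by_cases hp : p ∈ Q <;> by_cases hq : q ∈ Q
    · simp only [hp, hq, and_self, if_true]
      rw [← star_phaseVector_dotProduct, Finset.mul_sum]
      refine Finset.sum_congr rfl fun l _ => ?_
      rw [star_mul', Complex.star_def, Complex.conj_ofReal, hss]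
      ring
    all_goals simp [hp, hq]
  constructor
  · rw [← h2, ← dof_mul_conjTranspose_comm, h1]
    rfl
  · rw [← h2]
    exact posSemidef_conjTranspose_mul_self M

end phaseDof

/-- Labelled points: the degrees of freedom of all points are close to the sum of the degrees of
freedom of the points in the different cells, with fewer frequencies. -/
theorem abs_phaseDof_gridPoint_sub_le {ι : Type*} [Fintype ι] [DecidableEq ι] {d k : ℕ} (n : ℕ)
    {s : ℝ} (hs : 0 ≤ s) (c : ι → Fin d → Fin k) (y : ι → Fin d → ℝ) {η : ℝ} (hη : 0 < η) :
    |phaseDof (k * n) s (fun q => gridPoint (c q) (y q)) Finset.univ -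
        ∑ C, phaseDof n (s * (k : ℝ) ^ d) y (Finset.univ.filter fun q => c q = C)| ≤
      η * Fintype.card ι + η⁻¹ * ∑ p, ∑ q, s ^ 2 *
        ‖boxKernel (k * n) (gridPoint (c p) (y p)) (gridPoint (c q) (y q)) -
          cellKernel n (c p) (c q) (y p) (y q)‖ ^ 2 := by
  obtain ⟨hG, hGp⟩ := phaseDof_eq_dof_gram (k * n) (fun q => gridPoint (c q) (y q)) hs Finset.univ
  have hs' : 0 ≤ s * (k : ℝ) ^ d := by positivity
  have hH := fun C => phaseDof_eq_dof_gram n y hs' (Finset.univ.filter fun q => c q = C)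
  set H : (Fin d → Fin k) → Matrix ι ι ℂ := fun C => ((s * (k : ℝ) ^ d : ℝ) : ℂ) •
    (Matrix.of fun p q => if p ∈ Finset.univ.filter (fun q => c q = C) ∧
      q ∈ Finset.univ.filter (fun q => c q = C) then boxKernel n (y p) (y q) else 0) with hHdef
  have hHapp : ∀ C p q, H C p q = if c p = C ∧ c q = C then
      ((s * (k : ℝ) ^ d : ℝ) : ℂ) * boxKernel n (y p) (y q) else 0 := by
    intro C p q
    simp only [hHdef, Matrix.smul_apply, Matrix.of_apply, Finset.mem_filter, Finset.mem_univ,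
      true_and, smul_eq_mul, mul_ite, mul_zero]
  -- The factor k^d of the cellwise kernel is what turns the weight s into s k^d inside a cell.
  have hsum : ∀ p q, (∑ C, H C) p q = s * cellKernel n (c p) (c q) (y p) (y q) := by
    intro p q
    simp only [Matrix.sum_apply, hHapp, cellKernel]
    by_cases h : c p = c q
    · simp only [h, and_self, Finset.sum_ite_eq, Finset.mem_univ, if_true]
      push_cast
      ring
    · rw [if_neg h, mul_zero, Finset.sum_eq_zero]
      intro C _
      rw [if_neg]
      rintro ⟨h1, h2⟩
      exact h (h1.trans h2.symm)
  -- The block of the cell C is supported on indices labelled C, so different blocks annihilate each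
  -- other.
  have hadd : dof (∑ C, H C) =
      ∑ C, phaseDof n (s * (k : ℝ) ^ d) y (Finset.univ.filter fun q => c q = C) := by
    rw [dof_sum_of_mul_eq_zero H fun C => (hH C).2]
    · exact Finset.sum_congr rfl fun C _ => (hH C).1.symm
    · intro C C' hCC'
      ext p q
      rw [mul_apply, Matrix.zero_apply]
      refine Finset.sum_eq_zero fun r _ => ?_
      rw [hHapp, hHapp]
      by_cases h : c r = C
      · have h' : ¬ c r = C' := fun h' => hCC' (h.symm.trans h')
        simp [h']
      · simp [h]
  rw [hG, ← hadd]
  refine (abs_dof_sub_dof_le hGp (posSemidef_sum _ fun C _ => (hH C).2) hη).trans_eq ?_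
  congr 2
  refine Finset.sum_congr rfl fun p _ => Finset.sum_congr rfl fun q _ => ?_
  rw [hsum]
  simp only [Matrix.smul_apply, Matrix.of_apply, Finset.mem_univ, and_self, if_true, smul_eq_mul]
  rw [← mul_sub, norm_mul, mul_pow, Complex.norm_real, Real.norm_eq_abs, sq_abs]

end phases

/-! ### Marginals of product laws and the expected degrees of freedom of uniform points. -/

section marginals

/-- A box pulls back to a box with full factors off the range of the embedding, and those factors
have mass one. -/
theorem measurePreserving_comp_embedding {ι κ α : Type*} [Fintype ι] [Fintype κ]
    [MeasurableSpace α] (ν : Measure α) [IsProbabilityMeasure ν] (e : κ ↪ ι) :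
    MeasurePreserving (fun (y : ι → α) (i : κ) => y (e i)) (Measure.pi fun _ => ν)
      (Measure.pi fun _ => ν) := by
  classical
  have hm : Measurable fun (y : ι → α) (i : κ) => y (e i) :=
    measurable_pi_lambda _ fun i => measurable_pi_apply (e i)
  refine ⟨hm, (Measure.pi_eq fun s hs => ?_).symm⟩
  rw [Measure.map_apply hm (MeasurableSet.univ_pi hs)]
  set t : ι → Set α := fun j => if h : ∃ i, e i = j then s h.choose else Set.univ with ht
  have hte : ∀ i, t (e i) = s i := by
    intro i
    have h : ∃ i', e i' = e i := ⟨i, rfl⟩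
    simp only [ht, dif_pos h]
    rw [e.injective h.choose_spec]
  have hpre : (fun (y : ι → α) (i : κ) => y (e i)) ⁻¹' (Set.univ.pi s) = Set.univ.pi t := by
    ext y
    simp only [Set.mem_preimage, Set.mem_univ_pi]
    constructor
    · intro h j
      by_cases hj : ∃ i, e i = j
      · obtain ⟨i, rfl⟩ := hj
        rw [hte]
        exact h i
      · simp only [ht, dif_neg hj, Set.mem_univ]
    · intro h i
      rw [← hte]
      exact h (e i)
  rw [hpre, Measure.pi_pi, ← Finset.prod_subset (Finset.subset_univ (Finset.univ.map e)),
    Finset.prod_map]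
  · exact Finset.prod_congr rfl fun i _ => by rw [hte]
  · intro j _ hj
    have : ¬ ∃ i, e i = j := fun ⟨i, hi⟩ => hj (by simp [← hi])
    simp only [ht, dif_neg this, measure_univ]

theorem measurePreserving_pair {ι α : Type*} [Fintype ι] [MeasurableSpace α] (ν : Measure α)
    [IsProbabilityMeasure ν] {p q : ι} (hpq : p ≠ q) :
    MeasurePreserving (fun y : ι → α => (y p, y q)) (Measure.pi fun _ => ν) (ν.prod ν) := by
  have hinj : Function.Injective ![p, q] := by
    intro i j hij
    fin_cases i <;> fin_cases j <;> simp_all [eq_comm]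
  have h := (measurePreserving_finTwoArrow ν).comp
    (measurePreserving_comp_embedding (ι := ι) ν ⟨![p, q], hinj⟩)
  exact h

variable {d : ℕ}

/-- The expected degrees of freedom of `N` independent uniform points. -/
noncomputable def meanDof (d n : ℕ) (s : ℝ) (N : ℕ) : ℝ :=
  ∫ y : Fin N → Fin d → ℝ, phaseDof n s y Finset.univ ∂(Measure.pi fun _ => cubeLaw d)

/-- The points are independent with the same law, so only the number of selected points matters. -/
theorem integral_phaseDof_subset {ι : Type*} [Fintype ι] (n : ℕ) (s : ℝ) (Q : Finset ι) :
    ∫ y : ι → Fin d → ℝ, phaseDof n s y Q ∂(Measure.pi fun _ => cubeLaw d) =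
      meanDof d n s Q.card := by
  set e : Fin Q.card ↪ ι := Q.equivFin.symm.toEmbedding.trans (Function.Embedding.subtype _)
  have hmap : (Finset.univ : Finset (Fin Q.card)).map e = Q := by
    ext i
    simp only [Finset.mem_map, Finset.mem_univ, true_and, e, Function.Embedding.trans_apply,
      Equiv.coe_toEmbedding, Function.Embedding.coe_subtype]
    constructor
    · rintro ⟨j, rfl⟩
      exact (Q.equivFin.symm j).2
    · intro hi
      exact ⟨Q.equivFin ⟨i, hi⟩, by simp⟩
  have hmp := measurePreserving_comp_embedding (cubeLaw d) e
  have hmeas : Measurable fun y : Fin Q.card → Fin d → ℝ => phaseDof n s y Finset.univ :=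
    measurable_phaseDof (fun q => measurable_pi_apply q) _
  rw [meanDof, ← hmp.map_eq, integral_map hmp.measurable.aemeasurable hmeas.aestronglyMeasurable]
  refine integral_congr_ae (ae_of_all _ fun y => ?_)
  have := phaseDof_comp n y s e Finset.univ
  rw [hmap] at this
  exact this.symm

/-- Couple the two samples by taking the smaller one as the initial part of the larger one; each
extra point adds between 0 and 1. -/
theorem abs_meanDof_sub_le (n : ℕ) {s : ℝ} (hs : 0 ≤ s) (N N' : ℕ) :
    |meanDof d n s N - meanDof d n s N'| ≤ |(N : ℝ) - N'| := by
  wlog h : N ≤ N' generalizing N N'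
  · rw [abs_sub_comm, abs_sub_comm (N : ℝ)]
    exact this N' N (le_of_not_ge h)
  set Q : Finset (Fin N') := Finset.univ.map (Fin.castLEEmb h)
  have hcard : Q.card = N := by simp [Q]
  have h1 := integral_phaseDof_subset (d := d) n s Q
  have h2 := integral_phaseDof_subset (d := d) n s (Finset.univ : Finset (Fin N'))
  rw [hcard] at h1
  rw [Finset.card_univ, Fintype.card_fin] at h2
  have hi : ∀ Q : Finset (Fin N'), Integrable (fun y : Fin N' → Fin d → ℝ => phaseDof n s y Q)
      (Measure.pi fun _ => cubeLaw d) := fun Q =>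
    integrable_phaseDof hs (fun q => measurable_pi_apply q) Q
  rw [← h1, ← h2, ← integral_sub (hi _) (hi _)]
  have hb : ∀ y : Fin N' → Fin d → ℝ,
      ‖phaseDof n s y Q - phaseDof n s y Finset.univ‖ ≤ |(N : ℝ) - N'| := by
    intro y
    have h3 := phaseDof_mono n y hs (Finset.subset_univ Q)
    rw [hcard, Finset.card_univ, Fintype.card_fin] at h3
    have h4 : (N : ℝ) ≤ N' := by exact_mod_cast h
    rw [Real.norm_eq_abs, abs_le, abs_of_nonpos (by linarith)]
    constructor <;> linarith [h3.1, h3.2]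
  refine (norm_integral_le_of_norm_le_const (ae_of_all _ hb)).trans_eq ?_
  simp

theorem meanDof_zero (n : ℕ) (s : ℝ) : meanDof d n s 0 = 0 := by
  simp [meanDof, phaseDof, dof_zero]

end marginals

/-! ### Localization to cells for points with a piecewise constant density. -/

section localization

variable {d k : ℕ}

/-- The law of a uniform point of a random cell. -/
noncomputable def stepLaw (P : Measure (Fin d → Fin k)) : Measure (Fin d → ℝ) :=
  (P.prod (cubeLaw d)).map fun z => gridPoint z.1 z.2

instance (P : Measure (Fin d → Fin k)) [IsProbabilityMeasure P] :
    IsProbabilityMeasure (stepLaw P) :=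
  Measure.isProbabilityMeasure_map (measurable_gridPoint d k).aemeasurable

theorem measurePreserving_stepLaw (P : Measure (Fin d → Fin k)) [IsProbabilityMeasure P] (m : ℕ) :
    MeasurePreserving (fun (z : (Fin m → Fin d → Fin k) × (Fin m → Fin d → ℝ)) q =>
        gridPoint (z.1 q) (z.2 q))
      ((Measure.pi fun _ => P).prod (Measure.pi fun _ => cubeLaw d))
      (Measure.pi fun _ => stepLaw P) := by
  have h0 : MeasurePreserving (fun z : (Fin d → Fin k) × (Fin d → ℝ) => gridPoint z.1 z.2)
      (P.prod (cubeLaw d)) (stepLaw P) := ⟨measurable_gridPoint d k, rfl⟩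
  have h1 : MeasurePreserving (fun (a : Fin m → (Fin d → Fin k) × (Fin d → ℝ)) i =>
      gridPoint (a i).1 (a i).2) (Measure.pi fun _ => P.prod (cubeLaw d))
      (Measure.pi fun _ => stepLaw P) :=
    measurePreserving_pi _ _ fun _ => h0
  have h2 : MeasurePreserving
      (MeasurableEquiv.arrowProdEquivProdArrow (Fin d → Fin k) (Fin d → ℝ) (Fin m)).symm
      ((Measure.pi fun _ => P).prod (Measure.pi fun _ => cubeLaw d))
      (Measure.pi fun _ => P.prod (cubeLaw d)) :=
    (measurePreserving_arrowProdEquivProdArrow (Fin d → Fin k) (Fin d → ℝ) (Fin m)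
      (fun _ => P) (fun _ => cubeLaw d)).symm
  have h3 : (fun (z : (Fin m → Fin d → Fin k) × (Fin m → Fin d → ℝ)) q =>
        gridPoint (z.1 q) (z.2 q)) = (fun (a : Fin m → (Fin d → Fin k) × (Fin d → ℝ)) i =>
      gridPoint (a i).1 (a i).2) ∘
        (MeasurableEquiv.arrowProdEquivProdArrow (Fin d → Fin k) (Fin d → ℝ) (Fin m)).symm := by
    funext z q
    rfl
  rw [h3]
  exact h1.comp h2

/-- Conditioning on the cell labels: the relative positions remain independent and uniform. -/
theorem integral_pi_stepLaw (P : Measure (Fin d → Fin k)) [IsProbabilityMeasure P] {m : ℕ}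
    {F : (Fin m → Fin d → ℝ) → ℝ} (hF : Integrable F (Measure.pi fun _ => stepLaw P)) :
    ∫ x, F x ∂(Measure.pi fun _ => stepLaw P) =
      ∫ c : Fin m → Fin d → Fin k, ∫ y, F (fun q => gridPoint (c q) (y q))
        ∂(Measure.pi fun _ => cubeLaw d) ∂(Measure.pi fun _ => P) := by
  have hmp := measurePreserving_stepLaw P m
  have hint : Integrable (fun z : (Fin m → Fin d → Fin k) × (Fin m → Fin d → ℝ) =>
      F (fun q => gridPoint (z.1 q) (z.2 q)))
      ((Measure.pi fun _ => P).prod (Measure.pi fun _ => cubeLaw d)) :=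
    hmp.integrable_comp_of_integrable hF
  rw [← integral_prod _ hint]
  conv_lhs => rw [← hmp.map_eq]
  rw [integral_map hmp.measurable.aemeasurable]
  rw [hmp.map_eq]
  exact hF.aestronglyMeasurable

/-- The mean square distance of the two kernels, for given labels. -/
noncomputable def kernelDefect (n : ℕ) (c c' : Fin d → Fin k) : ℝ :=
  ∫ y, ∫ y', ‖boxKernel (k * n) (gridPoint c y) (gridPoint c' y') - cellKernel n c c' y y'‖ ^ 2
    ∂(cubeLaw d) ∂(cubeLaw d)

theorem kernelDefect_nonneg (n : ℕ) (c c' : Fin d → Fin k) : 0 ≤ kernelDefect n c c' :=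
  integral_nonneg fun _ => integral_nonneg fun _ => by positivity

theorem continuous_kernel_sub {X : Type*} [TopologicalSpace X] (n : ℕ) (c c' : Fin d → Fin k)
    {f g : X → Fin d → ℝ} (hf : Continuous f) (hg : Continuous g) :
    Continuous fun x => boxKernel (k * n) (gridPoint c (f x)) (gridPoint c' (g x)) -
      cellKernel n c c' (f x) (g x) := by
  refine Continuous.sub (Continuous.boxKernel (k * n) ((continuous_gridPoint c).comp hf)
    ((continuous_gridPoint c').comp hg)) ?_
  unfold cellKernel
  split_ifs
  · exact continuous_const.mul (Continuous.boxKernel n hf hg)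
  · exact continuous_const

theorem norm_sq_kernel_sub_le (n : ℕ) (c c' : Fin d → Fin k) (y y' : Fin d → ℝ) :
    ‖boxKernel (k * n) (gridPoint c y) (gridPoint c' y') - cellKernel n c c' y y'‖ ^ 2 ≤
      (((k * n : ℕ) : ℝ) ^ d + (k : ℝ) ^ d * (n : ℝ) ^ d) ^ 2 := by
  have h1 := norm_boxKernel_le (k * n) (gridPoint c y) (gridPoint c' y')
  have h2 : ‖cellKernel n c c' y y'‖ ≤ (k : ℝ) ^ d * (n : ℝ) ^ d := by
    unfold cellKernel
    split_ifs
    · rw [norm_mul, norm_pow, Complex.norm_natCast]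
      gcongr
      exact norm_boxKernel_le _ _ _
    · rw [norm_zero]
      positivity
  have h3 := norm_sub_le (boxKernel (k * n) (gridPoint c y) (gridPoint c' y'))
    (cellKernel n c c' y y')
  gcongr
  linarith

theorem boxKernel_self (n : ℕ) (x : Fin d → ℝ) : boxKernel n x x = (n : ℂ) ^ d := by
  simp [boxKernel, dirichlet_zero]

/-- Both kernels equal (k n)^d at coincident points, so the diagonal of the double sum over points
drops out and only independent pairs remain. -/
theorem kernel_sub_self (n : ℕ) (c : Fin d → Fin k) (y : Fin d → ℝ) :
    boxKernel (k * n) (gridPoint c y) (gridPoint c y) - cellKernel n c c y y = 0 := by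
  simp [cellKernel, boxKernel_self, mul_pow]

theorem integrable_kernel_pair {ι : Type*} [Fintype ι] (n : ℕ) (c : ι → Fin d → Fin k) (p q : ι) :
    Integrable (fun y : ι → Fin d → ℝ => ‖boxKernel (k * n) (gridPoint (c p) (y p))
      (gridPoint (c q) (y q)) - cellKernel n (c p) (c q) (y p) (y q)‖ ^ 2)
      (Measure.pi fun _ => cubeLaw d) := by
  refine Integrable.of_bound ((continuous_kernel_sub n (c p) (c q) (continuous_apply p)
    (continuous_apply q)).norm.pow 2).aestronglyMeasurable
    ((((k * n : ℕ) : ℝ) ^ d + (k : ℝ) ^ d * (n : ℝ) ^ d) ^ 2) (ae_of_all _ fun y => ?_)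
  rw [norm_pow, norm_norm]
  exact norm_sq_kernel_sub_le n (c p) (c q) (y p) (y q)

theorem integral_kernel_pair {ι : Type*} [Fintype ι] [DecidableEq ι] (n : ℕ)
    (c : ι → Fin d → Fin k) (p q : ι) :
    ∫ y : ι → Fin d → ℝ, ‖boxKernel (k * n) (gridPoint (c p) (y p)) (gridPoint (c q) (y q)) -
        cellKernel n (c p) (c q) (y p) (y q)‖ ^ 2 ∂(Measure.pi fun _ => cubeLaw d) =
      if p = q then 0 else kernelDefect n (c p) (c q) := by
  split_ifs with h
  · subst h
    simp [kernel_sub_self]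
  · have hmp := measurePreserving_pair (cubeLaw d) h
    have hc : Continuous fun z : (Fin d → ℝ) × (Fin d → ℝ) =>
        ‖boxKernel (k * n) (gridPoint (c p) z.1) (gridPoint (c q) z.2) -
          cellKernel n (c p) (c q) z.1 z.2‖ ^ 2 :=
      (continuous_kernel_sub n (c p) (c q) continuous_fst continuous_snd).norm.pow 2
    have hint : Integrable (fun z : (Fin d → ℝ) × (Fin d → ℝ) =>
        ‖boxKernel (k * n) (gridPoint (c p) z.1) (gridPoint (c q) z.2) -
          cellKernel n (c p) (c q) z.1 z.2‖ ^ 2) ((cubeLaw d).prod (cubeLaw d)) := by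
      refine Integrable.of_bound hc.aestronglyMeasurable
        ((((k * n : ℕ) : ℝ) ^ d + (k : ℝ) ^ d * (n : ℝ) ^ d) ^ 2) (ae_of_all _ fun z => ?_)
      rw [norm_pow, norm_norm]
      exact norm_sq_kernel_sub_le n (c p) (c q) z.1 z.2
    rw [kernelDefect, ← integral_prod _ hint, ← hmp.map_eq,
      integral_map hmp.measurable.aemeasurable hc.aestronglyMeasurable]

theorem integral_pair_label {ι : Type*} [Fintype ι] (P : Measure (Fin d → Fin k))
    [IsProbabilityMeasure P] {p q : ι} (hpq : p ≠ q) (g : (Fin d → Fin k) → (Fin d → Fin k) → ℝ) :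
    ∫ c : ι → Fin d → Fin k, g (c p) (c q) ∂(Measure.pi fun _ => P) =
      ∑ C, ∑ C', P.real {C} * P.real {C'} * g C C' := by
  have hmp := measurePreserving_pair P hpq
  have h1 : ∫ c : ι → Fin d → Fin k, g (c p) (c q) ∂(Measure.pi fun _ => P) =
      ∫ z, g z.1 z.2 ∂(P.prod P) := by
    rw [← hmp.map_eq, integral_map hmp.measurable.aemeasurable
      (Measurable.of_discrete).aestronglyMeasurable]
  rw [h1, integral_prod _ .of_finite, integral_fintype .of_finite]
  refine Finset.sum_congr rfl fun C _ => ?_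
  rw [integral_fintype .of_finite, smul_eq_mul, Finset.mul_sum]
  refine Finset.sum_congr rfl fun C' _ => ?_
  rw [smul_eq_mul, mul_assoc]

theorem integral_single_label {ι : Type*} [Fintype ι] (P : Measure (Fin d → Fin k))
    [IsProbabilityMeasure P] (p : ι) (g : (Fin d → Fin k) → ℝ) :
    ∫ c : ι → Fin d → Fin k, g (c p) ∂(Measure.pi fun _ => P) = ∫ C, g C ∂P := by
  have hmp := measurePreserving_eval (fun _ : ι => P) p
  conv_rhs => rw [← hmp.map_eq]
  rw [integral_map hmp.measurable.aemeasurable (Measurable.of_discrete).aestronglyMeasurable]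

/-- Label weights at most a times the uniform ones lose at most a factor a² against the sum over all
pairs of cells. -/
theorem sum_kernelDefect_le {n : ℕ} (hk : 0 < k) (hn : 0 < n) (P : Measure (Fin d → Fin k))
    {a : ℝ} (hP : ∀ C, P.real {C} ≤ a * ((k : ℝ) ^ d)⁻¹) :
    ∑ C, ∑ C', P.real {C} * P.real {C'} * kernelDefect n C C' ≤
      a ^ 2 * (2 * ((k * n : ℕ) : ℝ) ^ d * (d * dirichletTail n)) := by
  have hk' : (0 : ℝ) < (k : ℝ) ^ d := by positivity
  have h := sum_integral_norm_sq_boxKernel_sub_le d hk hn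
  calc ∑ C, ∑ C', P.real {C} * P.real {C'} * kernelDefect n C C'
      ≤ ∑ C : Fin d → Fin k, ∑ C' : Fin d → Fin k,
          (a * ((k : ℝ) ^ d)⁻¹) * (a * ((k : ℝ) ^ d)⁻¹) * kernelDefect n C C' := by
        refine Finset.sum_le_sum fun C _ => Finset.sum_le_sum fun C' _ => ?_
        refine mul_le_mul_of_nonneg_right ?_ (kernelDefect_nonneg n C C')
        exact mul_le_mul (hP C) (hP C') measureReal_nonneg (measureReal_nonneg.trans (hP C))
    _ = a ^ 2 * (((k : ℝ) ^ d) ^ 2)⁻¹ * ∑ C : Fin d → Fin k, ∑ C' : Fin d → Fin k,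
          kernelDefect n C C' := by
        simp only [Finset.mul_sum]
        refine Finset.sum_congr rfl fun C _ => Finset.sum_congr rfl fun C' _ => ?_
        field_simp
    _ ≤ a ^ 2 * (((k : ℝ) ^ d) ^ 2)⁻¹ *
          (((k : ℝ) ^ d) ^ 2 * (2 * ((k * n : ℕ) : ℝ) ^ d * (d * dirichletTail n))) := by
        gcongr
        exact h
    _ = _ := by
        field_simp

/-- The numbers of points in the cells are concentrated. -/
theorem integral_abs_card_sub_le (P : Measure (Fin d → Fin k)) [IsProbabilityMeasure P] (m : ℕ)
    (C : Fin d → Fin k) {η : ℝ} (hη : 0 < η) :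
    ∫ c : Fin m → Fin d → Fin k,
      |((Finset.univ.filter fun q => c q = C).card : ℝ) - m * P.real {C}|
        ∂(Measure.pi fun _ => P) ≤ η + η⁻¹ * (m * P.real {C}) := by
  set p := P.real {C} with hp
  have hp0 : 0 ≤ p := measureReal_nonneg
  set g : (Fin d → Fin k) → ℝ := fun C' => (if C' = C then 1 else 0) - p with hg
  have hcard : ∀ c : Fin m → Fin d → Fin k,
      ((Finset.univ.filter fun q => c q = C).card : ℝ) - m * p = ∑ q, g (c q) := by
    intro c
    simp [hg, Finset.sum_sub_distrib]
  have hsum : ∑ C', P.real {C'} = 1 := by simp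
  have hmean : ∑ C', P.real {C'} * g C' = 0 := by
    simp only [hg, mul_sub, mul_ite, mul_one, mul_zero, Finset.sum_sub_distrib, Finset.sum_ite_eq',
      Finset.mem_univ, if_true, ← Finset.sum_mul, hsum, one_mul]
    rw [hp, sub_self]
  have hsq : ∫ C', g C' * g C' ∂P ≤ p := by
    rw [integral_fintype .of_finite]
    have : ∀ C', P.real {C'} • (g C' * g C') =
        (if C' = C then P.real {C'} * (1 - 2 * p) else 0) + P.real {C'} * (p * p) := by
      intro C'
      simp only [hg, smul_eq_mul]
      split_ifs <;> ring
    simp only [this, Finset.sum_add_distrib, Finset.sum_ite_eq', Finset.mem_univ, if_true,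
      ← Finset.sum_mul, hsum]
    rw [← hp]
    nlinarith
  -- The variance of a binomial count: the cross terms vanish by independence and centring.
  have hvar : ∫ c : Fin m → Fin d → Fin k, (∑ q, g (c q)) ^ 2 ∂(Measure.pi fun _ => P) ≤
      m * p := by
    have h1 : ∀ c : Fin m → Fin d → Fin k,
        (∑ q, g (c q)) ^ 2 = ∑ q, ∑ q', g (c q) * g (c q') := by
      intro c
      rw [sq, Finset.sum_mul_sum]
    simp only [h1]
    rw [integral_finsetSum _ fun q _ => .of_finite]
    calc ∑ q : Fin m, ∫ c : Fin m → Fin d → Fin k, ∑ q', g (c q) * g (c q')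
          ∂(Measure.pi fun _ => P) ≤ ∑ q : Fin m, p := by
          refine Finset.sum_le_sum fun q _ => ?_
          rw [integral_finsetSum _ fun q' _ => .of_finite, Finset.sum_eq_single q]
          · rw [integral_single_label P q fun C' => g C' * g C']
            exact hsq
          · intro q' _ hqq'
            rw [integral_pair_label P hqq'.symm fun C C' => g C * g C']
            have : ∀ C₁ : Fin d → Fin k, ∑ C₂, P.real {C₁} * P.real {C₂} * (g C₁ * g C₂) =
                P.real {C₁} * g C₁ * ∑ C₂, P.real {C₂} * g C₂ := by
              intro C₁
              rw [Finset.mul_sum]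
              exact Finset.sum_congr rfl fun C₂ _ => by ring
            simp only [this, hmean, mul_zero, Finset.sum_const_zero]
          · intro h
            exact absurd (Finset.mem_univ q) h
      _ = m * p := by simp
  simp only [hcard]
  calc ∫ c : Fin m → Fin d → Fin k, |∑ q, g (c q)| ∂(Measure.pi fun _ => P)
      ≤ ∫ c : Fin m → Fin d → Fin k, (η + η⁻¹ * (∑ q, g (c q)) ^ 2) ∂(Measure.pi fun _ => P) := by
        refine integral_mono .of_finite .of_finite fun c => ?_
        simp only
        set u := ∑ q, g (c q)
        rw [← sq_abs u]
        have h1 : 0 ≤ η * (1 - η⁻¹ * |u| / 2) ^ 2 := by positivity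
        have h2 : 0 ≤ η⁻¹ * |u| ^ 2 := by positivity
        have h3 : η * (1 - η⁻¹ * |u| / 2) ^ 2 = η - |u| + η⁻¹ * |u| ^ 2 / 4 := by
          field_simp
          ring
        linarith
    _ = η + η⁻¹ * ∫ c : Fin m → Fin d → Fin k, (∑ q, g (c q)) ^ 2 ∂(Measure.pi fun _ => P) := by
        rw [integral_add .of_finite .of_finite, integral_const_mul η⁻¹]
        simp
    _ ≤ _ := by gcongr

/-- The expected degrees of freedom of `m` points with a step law, compared with the expected
degrees of freedom of the deterministic numbers `⌊m P(C)⌋` of points in the cells `C`. -/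
theorem abs_integral_stepLaw_sub_le {n : ℕ} (hk : 0 < k) (hn : 0 < n) {s : ℝ} (hs : 0 ≤ s)
    (P : Measure (Fin d → Fin k)) [IsProbabilityMeasure P] {a : ℝ}
    (hP : ∀ C, P.real {C} ≤ a * ((k : ℝ) ^ d)⁻¹) (m : ℕ) {η η' : ℝ} (hη : 0 < η) (hη' : 0 < η') :
    |∫ x : Fin m → Fin d → ℝ, phaseDof (k * n) s x Finset.univ ∂(Measure.pi fun _ => stepLaw P) -
        ∑ C, meanDof d n (s * (k : ℝ) ^ d) ⌊m * P.real {C}⌋₊| ≤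
      η * m + η⁻¹ * (s ^ 2 * (m : ℝ) ^ 2 *
        (a ^ 2 * (2 * ((k * n : ℕ) : ℝ) ^ d * (d * dirichletTail n)))) +
      ((k : ℝ) ^ d * (η' + 1) + η'⁻¹ * m) := by
  have hs' : 0 ≤ s * (k : ℝ) ^ d := by positivity
  have hsum : ∑ C, P.real {C} = 1 := by simp
  have hmeasgp : ∀ (c : Fin m → Fin d → Fin k) (q : Fin m),
      Measurable fun y : Fin m → Fin d → ℝ => gridPoint (c q) (y q) := fun c q =>
    ((continuous_gridPoint (c q)).comp (continuous_apply q)).measurable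
  rw [integral_pi_stepLaw P (integrable_phaseDof hs (fun q => measurable_pi_apply q) _)]
  set N : (Fin m → Fin d → Fin k) → (Fin d → Fin k) → ℕ :=
    fun c C => (Finset.univ.filter fun q => c q = C).card with hN
  -- For frozen labels, exchange the kernels; the cells then contribute expected degrees of freedom
  -- of as many uniform points as they contain.
  have hfix : ∀ c : Fin m → Fin d → Fin k,
      |∫ y, phaseDof (k * n) s (fun q => gridPoint (c q) (y q)) Finset.univ
          ∂(Measure.pi fun _ => cubeLaw d) - ∑ C, meanDof d n (s * (k : ℝ) ^ d) (N c C)| ≤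
        η * m + η⁻¹ * ∑ p, ∑ q, s ^ 2 * if p = q then 0 else kernelDefect n (c p) (c q) := by
    intro c
    have hi1 : Integrable (fun y : Fin m → Fin d → ℝ =>
        phaseDof (k * n) s (fun q => gridPoint (c q) (y q)) Finset.univ)
        (Measure.pi fun _ => cubeLaw d) := integrable_phaseDof hs (hmeasgp c) _
    have hi2 : ∀ C, Integrable (fun y : Fin m → Fin d → ℝ =>
        phaseDof n (s * (k : ℝ) ^ d) y (Finset.univ.filter fun q => c q = C))
        (Measure.pi fun _ => cubeLaw d) := fun C =>
      integrable_phaseDof hs' (fun q => measurable_pi_apply q) _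
    have hi3 : ∀ p q : Fin m, Integrable (fun y : Fin m → Fin d → ℝ => s ^ 2 *
        ‖boxKernel (k * n) (gridPoint (c p) (y p)) (gridPoint (c q) (y q)) -
          cellKernel n (c p) (c q) (y p) (y q)‖ ^ 2) (Measure.pi fun _ => cubeLaw d) :=
      fun p q => (integrable_kernel_pair n c p q).const_mul _
    have hi4 : Integrable (fun y : Fin m → Fin d → ℝ => ∑ p, ∑ q, s ^ 2 *
        ‖boxKernel (k * n) (gridPoint (c p) (y p)) (gridPoint (c q) (y q)) -
          cellKernel n (c p) (c q) (y p) (y q)‖ ^ 2) (Measure.pi fun _ => cubeLaw d) :=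
      integrable_finsetSum _ fun p _ => integrable_finsetSum _ fun q _ => hi3 p q
    have h1 : ∑ C, meanDof d n (s * (k : ℝ) ^ d) (N c C) = ∫ y : Fin m → Fin d → ℝ,
        ∑ C, phaseDof n (s * (k : ℝ) ^ d) y (Finset.univ.filter fun q => c q = C)
          ∂(Measure.pi fun _ => cubeLaw d) := by
      rw [integral_finsetSum _ fun C _ => hi2 C]
      exact Finset.sum_congr rfl fun C _ => (integral_phaseDof_subset n _ _).symm
    rw [h1, ← integral_sub hi1 (integrable_finsetSum _ fun C _ => hi2 C)]
    refine (abs_integral_le_integral_abs).trans ?_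
    refine (integral_mono_of_nonneg (ae_of_all _ fun _ => abs_nonneg _)
      ((integrable_const (η * (Fintype.card (Fin m) : ℝ))).add (hi4.const_mul η⁻¹))
      (ae_of_all _ fun y => abs_phaseDof_gridPoint_sub_le n hs c y hη)).trans_eq ?_
    simp only [Pi.add_apply]
    rw [integral_add (integrable_const _) (hi4.const_mul η⁻¹), integral_const_mul η⁻¹,
      integral_finsetSum _ fun p _ => integrable_finsetSum _ fun q _ => hi3 p q]
    congr 1
    · simp
    · congr 1
      refine Finset.sum_congr rfl fun p _ => ?_
      rw [integral_finsetSum _ fun q _ => hi3 p q]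
      refine Finset.sum_congr rfl fun q _ => ?_
      rw [integral_const_mul, integral_kernel_pair]
  -- Average the kernel error over the labels of independent pairs.
  have hlabel : ∫ c : Fin m → Fin d → Fin k, ∑ p, ∑ q, s ^ 2 *
      (if p = q then 0 else kernelDefect n (c p) (c q)) ∂(Measure.pi fun _ => P) ≤
      s ^ 2 * (m : ℝ) ^ 2 * (a ^ 2 * (2 * ((k * n : ℕ) : ℝ) ^ d * (d * dirichletTail n))) := by
    rw [integral_finsetSum _ fun p _ => .of_finite]
    have hB : 0 ≤ a ^ 2 * (2 * ((k * n : ℕ) : ℝ) ^ d * (d * dirichletTail n)) := by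
      have := dirichletTail_nonneg n
      positivity
    calc ∑ p : Fin m, ∫ c : Fin m → Fin d → Fin k, ∑ q, s ^ 2 *
          (if p = q then 0 else kernelDefect n (c p) (c q)) ∂(Measure.pi fun _ => P)
        ≤ ∑ p : Fin m, ∑ q : Fin m,
            s ^ 2 * (a ^ 2 * (2 * ((k * n : ℕ) : ℝ) ^ d * (d * dirichletTail n))) := by
          refine Finset.sum_le_sum fun p _ => ?_
          rw [integral_finsetSum _ fun q _ => .of_finite]
          refine Finset.sum_le_sum fun q _ => ?_
          rw [integral_const_mul]
          refine mul_le_mul_of_nonneg_left ?_ (sq_nonneg s)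
          split_ifs with h
          · simpa using hB
          · rw [integral_pair_label P h]
            exact sum_kernelDefect_le hk hn P hP
      _ = _ := by
          simp only [Finset.sum_const, Finset.card_univ, Fintype.card_fin, nsmul_eq_mul]
          ring
  -- Replace the counts by their means, using that `meanDof` is 1-Lipschitz in the number of points;
  -- the floor costs the extra 1 per cell.
  have hcount : |∫ c : Fin m → Fin d → Fin k, ∑ C, meanDof d n (s * (k : ℝ) ^ d) (N c C)
        ∂(Measure.pi fun _ => P) - ∑ C, meanDof d n (s * (k : ℝ) ^ d) ⌊m * P.real {C}⌋₊| ≤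
      (k : ℝ) ^ d * (η' + 1) + η'⁻¹ * m := by
    rw [integral_finsetSum _ fun C _ => .of_finite, ← Finset.sum_sub_distrib]
    refine (Finset.abs_sum_le_sum_abs _ _).trans ?_
    calc ∑ C, |∫ c : Fin m → Fin d → Fin k, meanDof d n (s * (k : ℝ) ^ d) (N c C)
          ∂(Measure.pi fun _ => P) - meanDof d n (s * (k : ℝ) ^ d) ⌊m * P.real {C}⌋₊|
        ≤ ∑ C : Fin d → Fin k, ((η' + η'⁻¹ * (m * P.real {C})) + 1) := by
          refine Finset.sum_le_sum fun C _ => ?_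
          have h1 : ∫ c : Fin m → Fin d → Fin k, meanDof d n (s * (k : ℝ) ^ d) (N c C)
              ∂(Measure.pi fun _ => P) - meanDof d n (s * (k : ℝ) ^ d) ⌊m * P.real {C}⌋₊ =
              ∫ c : Fin m → Fin d → Fin k, (meanDof d n (s * (k : ℝ) ^ d) (N c C) -
                meanDof d n (s * (k : ℝ) ^ d) ⌊m * P.real {C}⌋₊) ∂(Measure.pi fun _ => P) := by
            rw [integral_sub .of_finite .of_finite]
            simp
          rw [h1]
          refine abs_integral_le_integral_abs.trans ?_
          refine (integral_mono (g := fun c : Fin m → Fin d → Fin k =>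
            |(N c C : ℝ) - m * P.real {C}| + 1) .of_finite .of_finite fun c => ?_).trans ?_
          · simp only
            refine (abs_meanDof_sub_le n hs' _ _).trans ?_
            have h0 : 0 ≤ m * P.real {C} := by positivity
            have h2 := Nat.floor_le h0
            have h3 := Nat.lt_floor_add_one (m * P.real {C})
            have h4 : |m * P.real {C} - (⌊m * P.real {C}⌋₊ : ℝ)| ≤ 1 := by
              rw [abs_of_nonneg (by linarith)]
              linarith
            have h5 := abs_add_le ((N c C : ℝ) - m * P.real {C})
              (m * P.real {C} - (⌊m * P.real {C}⌋₊ : ℝ))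
            rw [sub_add_sub_cancel] at h5
            linarith
          · rw [integral_add .of_finite .of_finite]
            have := integral_abs_card_sub_le P m C hη'
            simp only [integral_const, probReal_univ, smul_eq_mul, mul_one]
            linarith
      _ = _ := by
          simp only [Finset.sum_add_distrib, ← Finset.mul_sum, hsum, Finset.sum_const,
            Finset.card_univ, Fintype.card_fun, Fintype.card_fin, nsmul_eq_mul]
          push_cast
          ring
  have hmain : |∫ c : Fin m → Fin d → Fin k, ∫ y, phaseDof (k * n) s
        (fun q => gridPoint (c q) (y q)) Finset.univ ∂(Measure.pi fun _ => cubeLaw d)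
        ∂(Measure.pi fun _ => P) -
      ∫ c : Fin m → Fin d → Fin k, ∑ C, meanDof d n (s * (k : ℝ) ^ d) (N c C)
        ∂(Measure.pi fun _ => P)| ≤
      η * m + η⁻¹ * (s ^ 2 * (m : ℝ) ^ 2 *
        (a ^ 2 * (2 * ((k * n : ℕ) : ℝ) ^ d * (d * dirichletTail n)))) := by
    rw [← integral_sub .of_finite .of_finite]
    refine abs_integral_le_integral_abs.trans ?_
    refine (integral_mono .of_finite .of_finite hfix).trans ?_
    rw [integral_add .of_finite .of_finite, integral_const_mul η⁻¹]
    simp only [integral_const, probReal_univ, smul_eq_mul, one_mul]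
    gcongr
  have htri := abs_sub_le
    (∫ c : Fin m → Fin d → Fin k, ∫ y, phaseDof (k * n) s
        (fun q => gridPoint (c q) (y q)) Finset.univ ∂(Measure.pi fun _ => cubeLaw d)
        ∂(Measure.pi fun _ => P))
    (∫ c : Fin m → Fin d → Fin k, ∑ C, meanDof d n (s * (k : ℝ) ^ d) (N c C)
        ∂(Measure.pi fun _ => P))
    (∑ C, meanDof d n (s * (k : ℝ) ^ d) ⌊m * P.real {C}⌋₊)
  linarith

end localization

/-! ### The limit for uniform points, by self-similarity. -/

section limits

variable {d k : ℕ}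

/-- The error scale of the localization to cells. -/
noncomputable def localScale (d n : ℕ) : ℝ := Real.sqrt (dirichletTail n + ((n : ℝ) ^ d)⁻¹)

theorem localScale_pos {n : ℕ} (hn : 0 < n) : 0 < localScale d n :=
  Real.sqrt_pos.2 (add_pos_of_nonneg_of_pos (dirichletTail_nonneg n) (by positivity))

theorem tendsto_pow_inv_atTop (hd : 1 ≤ d) :
    Tendsto (fun n : ℕ => ((n : ℝ) ^ d)⁻¹) atTop (𝓝 0) :=
  tendsto_inv_atTop_zero.comp
    ((tendsto_pow_atTop (by omega)).comp tendsto_natCast_atTop_atTop)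

theorem tendsto_localScale (hd : 1 ≤ d) : Tendsto (localScale d) atTop (𝓝 0) := by
  have h := (Real.continuous_sqrt.tendsto _).comp
    (tendsto_dirichletTail.add (tendsto_pow_inv_atTop hd))
  rw [add_zero, Real.sqrt_zero] at h
  exact h

/-- Both Young weights are tied to η = `localScale d n`, namely η and η n^d. Since η² is the sum of
the kernel tail and n^(-d), each of these divided by η is at most η. The bound involves k only
through r and a. -/
theorem abs_stepLaw_sub_le_localScale {n : ℕ} (hk : 0 < k) (hn : 0 < n) {t : ℝ} (ht : 0 ≤ t)
    (P : Measure (Fin d → Fin k)) [IsProbabilityMeasure P] {a : ℝ}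
    (hP : ∀ C, P.real {C} ≤ a * ((k : ℝ) ^ d)⁻¹) (m : ℕ) {r : ℝ}
    (hr : r = m / ((k * n : ℕ) : ℝ) ^ d) :
    (((k * n : ℕ) : ℝ) ^ d)⁻¹ *
      |∫ x : Fin m → Fin d → ℝ, phaseDof (k * n) (t / ((k * n : ℕ) : ℝ) ^ d) x Finset.univ
          ∂(Measure.pi fun _ => stepLaw P) -
        ∑ C, meanDof d n (t / (n : ℝ) ^ d) ⌊m * P.real {C}⌋₊| ≤
      localScale d n * (2 * r + 2 * t ^ 2 * r ^ 2 * a ^ 2 * d + 1 + localScale d n) := by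
  set η := localScale d n with hη
  have hη0 : 0 < η := localScale_pos hn
  have hK : (0 : ℝ) < (k : ℝ) ^ d := by positivity
  have hN : (0 : ℝ) < (n : ℝ) ^ d := by positivity
  have hKN : ((k * n : ℕ) : ℝ) ^ d = (k : ℝ) ^ d * (n : ℝ) ^ d := by
    push_cast
    exact mul_pow _ _ _
  have hs : 0 ≤ t / ((k * n : ℕ) : ℝ) ^ d := by positivity
  have key := abs_integral_stepLaw_sub_le hk hn hs P hP m hη0 (η' := η * (n : ℝ) ^ d)
    (by positivity)
  have hsk : t / ((k * n : ℕ) : ℝ) ^ d * (k : ℝ) ^ d = t / (n : ℝ) ^ d := by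
    rw [hKN]
    field_simp
  rw [hsk] at key
  rw [hKN] at key hr ⊢
  have hm : (m : ℝ) = r * ((k : ℝ) ^ d * (n : ℝ) ^ d) := by
    rw [hr]
    field_simp
  have hr0 : 0 ≤ r := by
    rw [hr]
    positivity
  have hsq : η ^ 2 = dirichletTail n + ((n : ℝ) ^ d)⁻¹ :=
    Real.sq_sqrt (add_nonneg (dirichletTail_nonneg n) (by positivity))
  have h1 : η⁻¹ * dirichletTail n ≤ η := by
    rw [inv_mul_le_iff₀ hη0, ← sq, hsq]
    have : 0 < ((n : ℝ) ^ d)⁻¹ := by positivity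
    linarith
  have h2 : η⁻¹ * ((n : ℝ) ^ d)⁻¹ ≤ η := by
    rw [inv_mul_le_iff₀ hη0, ← sq, hsq]
    linarith [dirichletTail_nonneg n]
  have h3 : ((n : ℝ) ^ d)⁻¹ ≤ η * η := by
    rw [← sq, hsq]
    linarith [dirichletTail_nonneg n]
  refine (mul_le_mul_of_nonneg_left key (by positivity)).trans ?_
  have e : ((k : ℝ) ^ d * (n : ℝ) ^ d)⁻¹ * (η * m + η⁻¹ * ((t / ((k : ℝ) ^ d * (n : ℝ) ^ d)) ^ 2 *
      (m : ℝ) ^ 2 * (a ^ 2 * (2 * ((k : ℝ) ^ d * (n : ℝ) ^ d) * (d * dirichletTail n)))) +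
      ((k : ℝ) ^ d * (η * (n : ℝ) ^ d + 1) + (η * (n : ℝ) ^ d)⁻¹ * m)) =
      η * r + (η⁻¹ * dirichletTail n) * (2 * t ^ 2 * r ^ 2 * a ^ 2 * d) + η + ((n : ℝ) ^ d)⁻¹ +
        (η⁻¹ * ((n : ℝ) ^ d)⁻¹) * r := by
    rw [hm]
    field_simp
    ring
  rw [e]
  have h4 := mul_le_mul_of_nonneg_right h1 (show 0 ≤ 2 * t ^ 2 * r ^ 2 * a ^ 2 * d by positivity)
  have h5 := mul_le_mul_of_nonneg_right h2 hr0
  linarith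

/-- The normalized expected degrees of freedom of `ρ n ^ d` uniform points. -/
noncomputable def normDof (d : ℕ) (t : ℝ) (n : ℕ) (ρ : ℝ) : ℝ :=
  ((n : ℝ) ^ d)⁻¹ * meanDof d n (t / (n : ℝ) ^ d) ⌊ρ * (n : ℝ) ^ d⌋₊

theorem stepLaw_uniformCell (d : ℕ) (hk : 0 < k) : stepLaw (uniformCell d k) = cubeLaw d :=
  (measurePreserving_gridPoint d hk).map_eq

/-- The uniform law is the step law with equal weights, so a = 1 and all k^d cells contribute the
same amount. The resulting error is uniform in k. -/
theorem abs_normDof_mul_sub_le {n : ℕ} (hk : 0 < k) (hn : 0 < n) {t : ℝ} (ht : 0 ≤ t) {ρ : ℝ}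
    (hρ : 0 ≤ ρ) :
    |normDof d t (k * n) ρ - normDof d t n ρ| ≤
      localScale d n * (2 * ρ + 2 * t ^ 2 * ρ ^ 2 * d + 1 + localScale d n) := by
  have := isProbabilityMeasure_uniformCell d hk
  set η := localScale d n with hη
  have hη0 : 0 < η := localScale_pos hn
  have hK : (0 : ℝ) < (k : ℝ) ^ d := by positivity
  have hN : (0 : ℝ) < (n : ℝ) ^ d := by positivity
  have hKN : ((k * n : ℕ) : ℝ) ^ d = (k : ℝ) ^ d * (n : ℝ) ^ d := by
    push_cast
    exact mul_pow _ _ _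
  set m := ⌊ρ * ((k * n : ℕ) : ℝ) ^ d⌋₊ with hm
  set r := (m : ℝ) / ((k * n : ℕ) : ℝ) ^ d with hr
  have hr0 : 0 ≤ r := by positivity
  have hrρ : r ≤ ρ := by
    rw [hr, div_le_iff₀ (by rw [hKN]; positivity)]
    exact Nat.floor_le (by positivity)
  have key := abs_stepLaw_sub_le_localScale hk hn ht (uniformCell d k) (a := 1)
    (fun C => (uniformCell_real_singleton hk C).trans_le (one_mul _).ge) m hr
  simp only [uniformCell_real_singleton hk, stepLaw_uniformCell d hk] at key
  -- Nested floors with an integer divisor collapse, so the number of points per cell matches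
  -- exactly.
  have hfl : ⌊(m : ℝ) * ((k : ℝ) ^ d)⁻¹⌋₊ = ⌊ρ * (n : ℝ) ^ d⌋₊ := by
    have h1 : (m : ℝ) * ((k : ℝ) ^ d)⁻¹ = (m : ℝ) / ((k ^ d : ℕ) : ℝ) := by
      push_cast
      rw [div_eq_mul_inv]
    rw [h1, Nat.floor_div_natCast, Nat.floor_natCast, hm, ← Nat.floor_div_natCast, hKN]
    congr 1
    push_cast
    field_simp
  rw [hfl, Finset.sum_const, Finset.card_univ, Fintype.card_fun, Fintype.card_fin,
    Fintype.card_fin, nsmul_eq_mul] at key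
  have e : normDof d t (k * n) ρ - normDof d t n ρ = (((k * n : ℕ) : ℝ) ^ d)⁻¹ *
      (∫ x : Fin m → Fin d → ℝ, phaseDof (k * n) (t / ((k * n : ℕ) : ℝ) ^ d) x Finset.univ
          ∂(Measure.pi fun _ => cubeLaw d) -
        ((k ^ d : ℕ) : ℝ) * meanDof d n (t / (n : ℝ) ^ d) ⌊ρ * (n : ℝ) ^ d⌋₊) := by
    rw [mul_sub, normDof, normDof, ← hm, ← meanDof]
    congr 1
    rw [hKN]
    push_cast
    field_simp
  rw [e, abs_mul, abs_of_nonneg (by positivity)]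
  refine key.trans (mul_le_mul_of_nonneg_left ?_ hη0.le)
  rw [one_pow, mul_one]
  gcongr

/-- Two sizes are compared through their product, which is a multiple of each; the two errors depend
only on the respective factors. -/
theorem cauchySeq_normDof (hd : 1 ≤ d) {t : ℝ} (ht : 0 ≤ t) {ρ : ℝ} (hρ : 0 ≤ ρ) :
    CauchySeq fun n => normDof d t n ρ := by
  have hlim : Tendsto (fun n => localScale d n *
      (2 * ρ + 2 * t ^ 2 * ρ ^ 2 * d + 1 + localScale d n)) atTop (𝓝 0) := by
    simpa using (tendsto_localScale hd).mul
      (((tendsto_const_nhds (x := 2 * ρ + 2 * t ^ 2 * ρ ^ 2 * d + 1)).add (tendsto_localScale hd)))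
  refine Metric.cauchySeq_iff'.2 fun ε hε => ?_
  obtain ⟨N, hN⟩ := eventually_atTop.1 (hlim.eventually_lt_const (half_pos hε))
  refine ⟨N + 1, fun n hn => ?_⟩
  have h1 := abs_normDof_mul_sub_le (d := d) (k := N + 1) (n := n) (by omega) (by omega) ht hρ
  have h2 := abs_normDof_mul_sub_le (d := d) (k := n) (n := N + 1) (by omega) (by omega) ht hρ
  have h3 := hN n (by omega)
  have h4 := hN (N + 1) (by omega)
  rw [mul_comm n] at h2
  rw [Real.dist_eq]
  have h5 := abs_sub_le (normDof d t n ρ) (normDof d t ((N + 1) * n) ρ) (normDof d t (N + 1) ρ)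
  rw [abs_sub_comm (normDof d t n ρ) (normDof d t ((N + 1) * n) ρ)] at h5
  linarith

/-- The limit of the normalized expected degrees of freedom of `ρ n ^ d` uniform points. -/
noncomputable def limDof (d : ℕ) (t ρ : ℝ) : ℝ := limUnder atTop fun n => normDof d t n ρ

theorem tendsto_normDof (hd : 1 ≤ d) {t : ℝ} (ht : 0 ≤ t) {ρ : ℝ} (hρ : 0 ≤ ρ) :
    Tendsto (fun n => normDof d t n ρ) atTop (𝓝 (limDof d t ρ)) :=
  (cauchySeq_normDof hd ht hρ).tendsto_limUnder

theorem abs_meanDof_floor_sub_le (n : ℕ) {s : ℝ} (hs : 0 ≤ s) {x y : ℝ} (hx : 0 ≤ x) (hy : 0 ≤ y) :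
    |meanDof d n s ⌊x⌋₊ - meanDof d n s ⌊y⌋₊| ≤ |x - y| + 1 := by
  refine (abs_meanDof_sub_le n hs _ _).trans ?_
  have h1 := Nat.floor_le hx
  have h2 := Nat.floor_le hy
  have h3 := Nat.lt_floor_add_one x
  have h4 := Nat.lt_floor_add_one y
  have h5 := neg_abs_le (x - y)
  have h6 := le_abs_self (x - y)
  rw [abs_le]
  constructor <;> linarith

/-- The floors cost 1 before normalisation and n^(-d) after it, which disappears in the limit. This
Lipschitz bound lets the limit be composed with any integrable density. -/
theorem abs_limDof_sub_le (hd : 1 ≤ d) {t : ℝ} (ht : 0 ≤ t) {ρ ρ' : ℝ} (hρ : 0 ≤ ρ)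
    (hρ' : 0 ≤ ρ') : |limDof d t ρ - limDof d t ρ'| ≤ |ρ - ρ'| := by
  have h1 := ((tendsto_normDof hd ht hρ).sub (tendsto_normDof hd ht hρ')).abs
  have h2 : Tendsto (fun n : ℕ => |ρ - ρ'| + ((n : ℝ) ^ d)⁻¹) atTop (𝓝 (|ρ - ρ'| + 0)) :=
    tendsto_const_nhds.add (tendsto_pow_inv_atTop hd)
  rw [add_zero] at h2
  refine le_of_tendsto_of_tendsto h1 h2 ?_
  filter_upwards [eventually_gt_atTop 0] with n hn
  have hN : (0 : ℝ) < (n : ℝ) ^ d := by positivity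
  rw [normDof, normDof, ← mul_sub, abs_mul, abs_of_pos (inv_pos.2 hN)]
  refine (mul_le_mul_of_nonneg_left (abs_meanDof_floor_sub_le n (by positivity) (by positivity)
    (by positivity)) (inv_pos.2 hN).le).trans_eq ?_
  rw [← sub_mul, abs_mul, abs_of_pos hN]
  field_simp

/-- A region without points contributes nothing, which is where the atom at 0 comes from. -/
theorem limDof_zero (hd : 1 ≤ d) {t : ℝ} (ht : 0 ≤ t) : limDof d t 0 = 0 := by
  refine tendsto_nhds_unique (tendsto_normDof hd ht le_rfl) ?_
  simp [normDof, meanDof_zero]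

open Matrix in
/-- Removing rows changes the degrees of freedom by at most the number of rows removed. -/
theorem phaseDof_mono_dim {ι : Type*} [Fintype ι] {n n' : ℕ} (h : n ≤ n') {s : ℝ} (hs : 0 ≤ s)
    (x : ι → Fin d → ℝ) :
    phaseDof n s x Finset.univ ≤ phaseDof n' s x Finset.univ ∧
      phaseDof n' s x Finset.univ ≤
        phaseDof n s x Finset.univ + ((n' : ℝ) ^ d - (n : ℝ) ^ d) := by
  classical
  set w : (Fin d → ℕ) → ι → ℂ :=
    fun l q => star ((Real.sqrt s : ℂ) * unitExp (-∑ j, ((l j : ℕ) : ℝ) * x q j)) with hw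
  -- In the dual picture the rank-one terms are indexed by frequencies instead of points, so
  -- removing rows means removing terms.
  have key : ∀ n : ℕ, phaseDof n s x Finset.univ =
      dof (∑ l : Fin d → Fin n, vecMulVec (w fun j => l j) (star (w fun j => l j))) := by
    intro n
    set M : Matrix (Fin d → Fin n) ι ℂ :=
      Matrix.of fun l q => (Real.sqrt s : ℂ) * phaseVector n (x q) l with hM
    rw [phaseDof, sum_smul_vecMulVec hs]
    have h1 : ∑ q, vecMulVec ((Real.sqrt s : ℂ) • phaseVector n (x q))
        (star ((Real.sqrt s : ℂ) • phaseVector n (x q))) = M * Mᴴ := by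
      ext i j
      simp only [hM, mul_apply, Matrix.sum_apply, vecMulVec_apply, conjTranspose_apply, of_apply,
        Pi.smul_apply, Pi.star_apply, smul_eq_mul]
    have h2 : ∑ l : Fin d → Fin n, vecMulVec (w fun j => l j) (star (w fun j => l j)) = Mᴴ * M := by
      ext i j
      simp [hM, hw, mul_apply, Matrix.sum_apply, vecMulVec_apply, phaseVector]
    rw [h1, h2, dof_mul_conjTranspose_comm]
  set e : (Fin d → Fin n) ↪ (Fin d → Fin n') :=
    ⟨fun l j => Fin.castLE h (l j), fun l l' hl => by
      funext j
      exact Fin.castLE_injective h (congrFun hl j)⟩ with he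
  have hmono := dof_sum_vecMulVec_mono (fun l : Fin d → Fin n' => w fun j => l j)
    (Finset.subset_univ (Finset.univ.map e))
  have hsum : ∑ l ∈ Finset.univ.map e, vecMulVec (w fun j => l j) (star (w fun j => l j)) =
      ∑ l : Fin d → Fin n, vecMulVec (w fun j => l j) (star (w fun j => l j)) := by
    rw [Finset.sum_map]
    rfl
  rw [hsum, ← key, ← key] at hmono
  simpa using hmono

end limits

/-! ### The limit for piecewise constant densities. -/

section stepLimit

variable {d k : ℕ}

theorem abs_integral_sub_integral_le {Ω : Type*} [MeasurableSpace Ω] {P : Measure Ω}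
    [IsProbabilityMeasure P] {F G : Ω → ℝ} (hF : Integrable F P) (hG : Integrable G P) {b : ℝ}
    (h : ∀ ω, |F ω - G ω| ≤ b) : |∫ ω, F ω ∂P - ∫ ω, G ω ∂P| ≤ b := by
  rw [← integral_sub hF hG, ← Real.norm_eq_abs]
  refine (norm_integral_le_of_norm_le_const (ae_of_all _ h)).trans_eq ?_
  simp

/-- Four successive comparisons: N is lowered to the multiple k n, the weight s / m becomes sβ / (k
n)^d, the points are localized to cells, and the cell counts m P(C) become (k n)^d P(C) / β. In the
limit α tends to 1 and r to 1 / β. -/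
theorem abs_stepLaw_sub_normDof_le {N n m : ℕ} (hk : 0 < k) (hn : 0 < n) (hN : k * n ≤ N)
    (hm : 0 < m) {s β : ℝ} (hs : 0 < s) (hβ : 0 < β)
    (P : Measure (Fin d → Fin k)) [IsProbabilityMeasure P] {α r : ℝ}
    (hα : α = ((k * n : ℕ) : ℝ) ^ d / (N : ℝ) ^ d) (hr : r = m / ((k * n : ℕ) : ℝ) ^ d) :
    |((N : ℝ) ^ d)⁻¹ * ∫ x : Fin m → Fin d → ℝ, phaseDof N (s / m) x Finset.univ
          ∂(Measure.pi fun _ => stepLaw P) -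
        α * (((k : ℝ) ^ d)⁻¹ * ∑ C, normDof d (s * β) n ((k : ℝ) ^ d * P.real {C} / β))| ≤
      (1 - α) + α * (|r⁻¹ / β - 1| + localScale d n * (2 * r + 2 * (s * β) ^ 2 * r ^ 2 *
        ((k : ℝ) ^ d) ^ 2 * d + 1 + localScale d n) + (|r - β⁻¹| + ((n : ℝ) ^ d)⁻¹)) := by
  have hKN : ((k * n : ℕ) : ℝ) ^ d = (k : ℝ) ^ d * (n : ℝ) ^ d := by
    push_cast
    exact mul_pow _ _ _
  have hk0 : (0 : ℝ) < (k : ℝ) ^ d := by positivity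
  have hn0 : (0 : ℝ) < (n : ℝ) ^ d := by positivity
  have hN0 : (0 : ℝ) < (N : ℝ) ^ d := by
    have : 0 < N := (Nat.mul_pos hk hn).trans_le hN
    positivity
  have hm0 : (0 : ℝ) < m := by exact_mod_cast hm
  set K := ((k * n : ℕ) : ℝ) ^ d with hK
  have hK0 : 0 < K := by
    rw [hKN]
    positivity
  have hα0 : 0 < α := by
    rw [hα]
    positivity
  have hαN : ((N : ℝ) ^ d)⁻¹ = α * K⁻¹ := by
    rw [hα]
    field_simp
  set t := s * β with ht
  have ht0 : 0 < t := mul_pos hs hβ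
  have hi : ∀ n' (s' : ℝ), 0 ≤ s' → Integrable (fun x : Fin m → Fin d → ℝ =>
      phaseDof n' s' x Finset.univ) (Measure.pi fun _ => stepLaw P) := fun n' s' hs' =>
    integrable_phaseDof hs' (fun q => measurable_pi_apply q) _
  set I0 := ∫ x : Fin m → Fin d → ℝ, phaseDof N (s / m) x Finset.univ
    ∂(Measure.pi fun _ => stepLaw P)
  set I1 := ∫ x : Fin m → Fin d → ℝ, phaseDof (k * n) (s / m) x Finset.univ
    ∂(Measure.pi fun _ => stepLaw P)
  set I2 := ∫ x : Fin m → Fin d → ℝ, phaseDof (k * n) (t / K) x Finset.univ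
    ∂(Measure.pi fun _ => stepLaw P)
  have hsm : 0 ≤ s / m := by positivity
  have h01 : |I0 - I1| ≤ (N : ℝ) ^ d - K := by
    refine abs_integral_sub_integral_le (hi _ _ hsm) (hi _ _ hsm) fun x => ?_
    have h := phaseDof_mono_dim hN hsm x
    rw [abs_of_nonneg (by linarith [h.1])]
    linarith [h.2]
  have h12 : |I1 - I2| ≤ K * |r⁻¹ / β - 1| := by
    refine abs_integral_sub_integral_le (hi _ _ hsm) (hi _ _ (by positivity)) fun x => ?_
    have h := abs_dof_smul_sub_le (posSemidef_sum_phase (k * n) x Finset.univ) hsm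
      (show 0 < t / K by positivity)
    have e1 : s / m / (t / K) = r⁻¹ / β := by
      rw [hr, ht]
      field_simp
    rw [e1] at h
    refine h.trans_eq ?_
    simp [hK]
  set S3 := ∑ C, meanDof d n (t / (n : ℝ) ^ d) ⌊m * P.real {C}⌋₊
  set S4 := ∑ C, meanDof d n (t / (n : ℝ) ^ d) ⌊(k : ℝ) ^ d * P.real {C} / β * (n : ℝ) ^ d⌋₊
    with hS4
  -- The crude choice a = k^d only uses that weights are at most 1; it suffices because k stays
  -- fixed while n grows.
  have h23 := abs_stepLaw_sub_le_localScale hk hn ht0.le P (a := (k : ℝ) ^ d) (fun C => by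
    rw [mul_inv_cancel₀ hk0.ne']
    exact measureReal_le_one) m hr
  change K⁻¹ * |I2 - S3| ≤ _ at h23
  have h34 : |S3 - S4| ≤ K * |r - β⁻¹| + (k : ℝ) ^ d := by
    rw [← Finset.sum_sub_distrib]
    refine (Finset.abs_sum_le_sum_abs _ _).trans ?_
    have hsum : ∑ C, P.real {C} = 1 := by simp
    calc ∑ C, |meanDof d n (t / (n : ℝ) ^ d) ⌊m * P.real {C}⌋₊ - meanDof d n (t / (n : ℝ) ^ d)
          ⌊(k : ℝ) ^ d * P.real {C} / β * (n : ℝ) ^ d⌋₊|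
        ≤ ∑ C, (P.real {C} * (K * |r - β⁻¹|) + 1) := by
          refine Finset.sum_le_sum fun C _ => ?_
          refine (abs_meanDof_floor_sub_le n (by positivity) (by positivity)
            (by positivity)).trans_eq ?_
          congr 1
          have : m * P.real {C} - (k : ℝ) ^ d * P.real {C} / β * (n : ℝ) ^ d =
              P.real {C} * (K * (r - β⁻¹)) := by
            rw [mul_sub K, hr, mul_div_cancel₀ _ hK0.ne', hKN]
            field_simp
          rw [this, abs_mul, abs_mul, abs_of_pos hK0, abs_of_nonneg measureReal_nonneg]
      _ = _ := by
          rw [Finset.sum_add_distrib, ← Finset.sum_mul, hsum]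
          simp
  have hX : α * (((k : ℝ) ^ d)⁻¹ * ∑ C, normDof d t n ((k : ℝ) ^ d * P.real {C} / β)) =
      α * K⁻¹ * S4 := by
    simp only [normDof, ← Finset.mul_sum]
    rw [← hS4, hKN]
    field_simp
  rw [hX, hαN, ← mul_sub, abs_mul, abs_of_pos (mul_pos hα0 (inv_pos.2 hK0))]
  have htri : |I0 - S4| ≤ |I0 - I1| + |I1 - I2| + |I2 - S3| + |S3 - S4| := by
    have e : I0 - S4 = (I0 - I1) + (I1 - I2) + (I2 - S3) + (S3 - S4) := by ring
    rw [e]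
    exact (abs_add_le _ _).trans (add_le_add_left ((abs_add_le _ _).trans
      (add_le_add_left (abs_add_le _ _) _)) _)
  have hβ' : α * K⁻¹ * |I0 - S4| ≤ α * K⁻¹ * ((N : ℝ) ^ d - K) + α * (K⁻¹ * K * |r⁻¹ / β - 1| +
      K⁻¹ * |I2 - S3| + (K⁻¹ * K * |r - β⁻¹| + K⁻¹ * (k : ℝ) ^ d)) := by
    have h := mul_le_mul_of_nonneg_left (htri.trans (add_le_add (add_le_add (add_le_add h01 h12)
      le_rfl) h34)) (mul_pos hα0 (inv_pos.2 hK0)).le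
    refine h.trans_eq ?_
    ring
  refine hβ'.trans (add_le_add (le_of_eq ?_) (mul_le_mul_of_nonneg_left (add_le_add
    (add_le_add (le_of_eq ?_) h23) (add_le_add (le_of_eq ?_) (le_of_eq ?_))) hα0.le))
  · rw [hα]
    field_simp
  · rw [inv_mul_cancel₀ hK0.ne', one_mul]
  · rw [inv_mul_cancel₀ hK0.ne', one_mul]
  · rw [hKN]
    field_simp

theorem tendsto_aspectFilter_ratio (d : ℕ) (β : ℝ) :
    Tendsto (fun p : ℕ × ℕ => (p.1 : ℝ) ^ d / (p.2 : ℝ)) (aspectFilter d β) (𝓝 β) :=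
  tendsto_comap.mono_left inf_le_right

theorem tendsto_aspectFilter_fst (d : ℕ) (β : ℝ) :
    Tendsto Prod.fst (aspectFilter d β) atTop :=
  tendsto_fst.mono_left inf_le_left

theorem tendsto_natMul_div_ratio (hk : 0 < k) :
    Tendsto (fun N : ℕ => ((k * (N / k) : ℕ) : ℝ) / N) atTop (𝓝 1) := by
  have h1 : Tendsto (fun N : ℕ => 1 - (k : ℝ) * (N : ℝ)⁻¹) atTop (𝓝 (1 - k * 0)) :=
    tendsto_const_nhds.sub ((tendsto_inv_atTop_nhds_zero_nat (𝕜 := ℝ)).const_mul _)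
  rw [mul_zero, sub_zero] at h1
  refine tendsto_of_tendsto_of_tendsto_of_le_of_le' h1 tendsto_const_nhds ?_ ?_
  · filter_upwards [eventually_gt_atTop 0] with N hN
    have hN0 : (0 : ℝ) < N := by exact_mod_cast hN
    rw [le_div_iff₀ hN0, sub_mul, mul_assoc, inv_mul_cancel₀ hN0.ne']
    have h2 : N ≤ k * (N / k) + k := by
      have := Nat.div_add_mod N k
      have := Nat.mod_lt N hk
      omega
    have : (N : ℝ) ≤ ((k * (N / k) : ℕ) : ℝ) + k := by exact_mod_cast h2
    linarith
  · filter_upwards [eventually_gt_atTop 0] with N hN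
    have hN0 : (0 : ℝ) < N := by exact_mod_cast hN
    rw [div_le_one hN0]
    exact_mod_cast Nat.mul_div_le N k

/-- The limit of the normalized expected degrees of freedom for points with a step law. -/
theorem tendsto_phaseDof_stepLaw (hd : 1 ≤ d) (hk : 0 < k) {s β : ℝ} (hs : 0 < s) (hβ : 0 < β)
    (P : Measure (Fin d → Fin k)) [IsProbabilityMeasure P] :
    Tendsto (fun p : ℕ × ℕ => ((p.1 : ℝ) ^ d)⁻¹ * ∫ x : Fin p.2 → Fin d → ℝ,
        phaseDof p.1 (s / p.2) x Finset.univ ∂(Measure.pi fun _ => stepLaw P)) (aspectFilter d β)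
      (𝓝 (((k : ℝ) ^ d)⁻¹ * ∑ C, limDof d (s * β) ((k : ℝ) ^ d * P.real {C} / β))) := by
  have hfst := tendsto_aspectFilter_fst d β
  -- The number of frequencies is rounded down to a multiple of k.
  have hn : Tendsto (fun p : ℕ × ℕ => p.1 / k) (aspectFilter d β) atTop :=
    (Nat.tendsto_div_const_atTop hk.ne').comp hfst
  have hα : Tendsto (fun p : ℕ × ℕ => ((k * (p.1 / k) : ℕ) : ℝ) ^ d / (p.1 : ℝ) ^ d)
      (aspectFilter d β) (𝓝 1) := by
    have h := ((tendsto_natMul_div_ratio hk).comp hfst).pow d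
    rw [one_pow] at h
    refine h.congr fun p => ?_
    simp only [Function.comp_apply, div_pow]
  have hpos : ∀ᶠ p : ℕ × ℕ in aspectFilter d β, 0 < p.1 / k ∧ 0 < p.2 :=
    (hn.eventually_gt_atTop 0).and
      ((tendsto_snd.mono_left inf_le_left).eventually_gt_atTop 0)
  have hr : Tendsto (fun p : ℕ × ℕ => (p.2 : ℝ) / ((k * (p.1 / k) : ℕ) : ℝ) ^ d)
      (aspectFilter d β) (𝓝 β⁻¹) := by
    have h := (hα.mul (tendsto_aspectFilter_ratio d β)).inv₀ (by simpa using hβ.ne')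
    rw [one_mul] at h
    refine h.congr' ?_
    filter_upwards [hpos] with p hp
    have h1 : (p.1 : ℝ) ≠ 0 := by
      have := Nat.pos_of_div_pos hp.1
      positivity
    field_simp
  have hη := (tendsto_localScale hd).comp hn
  have hlim : Tendsto (fun p : ℕ × ℕ => ((k * (p.1 / k) : ℕ) : ℝ) ^ d / (p.1 : ℝ) ^ d *
      (((k : ℝ) ^ d)⁻¹ * ∑ C, normDof d (s * β) (p.1 / k) ((k : ℝ) ^ d * P.real {C} / β)))
      (aspectFilter d β)
      (𝓝 (1 * (((k : ℝ) ^ d)⁻¹ * ∑ C, limDof d (s * β) ((k : ℝ) ^ d * P.real {C} / β)))) :=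
    hα.mul ((tendsto_finsetSum _ fun C _ =>
      (tendsto_normDof hd (by positivity) (by positivity)).comp hn).const_mul _)
  rw [one_mul] at hlim
  have herr : Tendsto (fun p : ℕ × ℕ =>
      (1 - ((k * (p.1 / k) : ℕ) : ℝ) ^ d / (p.1 : ℝ) ^ d) +
        ((k * (p.1 / k) : ℕ) : ℝ) ^ d / (p.1 : ℝ) ^ d *
        (|((p.2 : ℝ) / ((k * (p.1 / k) : ℕ) : ℝ) ^ d)⁻¹ / β - 1| +
        localScale d (p.1 / k) * (2 * ((p.2 : ℝ) / ((k * (p.1 / k) : ℕ) : ℝ) ^ d) +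
          2 * (s * β) ^ 2 * ((p.2 : ℝ) / ((k * (p.1 / k) : ℕ) : ℝ) ^ d) ^ 2 *
          ((k : ℝ) ^ d) ^ 2 * d + 1 + localScale d (p.1 / k)) +
        (|(p.2 : ℝ) / ((k * (p.1 / k) : ℕ) : ℝ) ^ d - β⁻¹| + (((p.1 / k : ℕ) : ℝ) ^ d)⁻¹)))
      (aspectFilter d β) (𝓝 ((1 - 1) + 1 * (|β⁻¹⁻¹ / β - 1| + 0 * (2 * β⁻¹ + 2 * (s * β) ^ 2 *
        β⁻¹ ^ 2 * ((k : ℝ) ^ d) ^ 2 * d + 1 + 0) + (|β⁻¹ - β⁻¹| + 0)))) := by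
    refine (tendsto_const_nhds.sub hα).add (hα.mul (((((hr.inv₀ (inv_ne_zero hβ.ne')).div_const
      β).sub_const 1).abs.add (hη.mul ((((hr.const_mul 2).add ((((hr.pow 2).const_mul
      (2 * (s * β) ^ 2)).mul_const _).mul_const _)).add_const 1).add hη))).add
      ((hr.sub_const _).abs.add ((tendsto_pow_inv_atTop hd).comp hn))))
  have hz : (1 - 1) + 1 * (|β⁻¹⁻¹ / β - 1| + 0 * (2 * β⁻¹ + 2 * (s * β) ^ 2 *
        β⁻¹ ^ 2 * ((k : ℝ) ^ d) ^ 2 * d + 1 + 0) + (|β⁻¹ - β⁻¹| + 0)) = 0 := by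
    rw [inv_inv, div_self hβ.ne']
    simp
  rw [hz] at herr
  refine tendsto_of_tendsto_of_dist hlim ?_
  refine squeeze_zero' (Eventually.of_forall fun _ => dist_nonneg) ?_ herr
  filter_upwards [hpos] with p hp
  rw [dist_comm, Real.dist_eq]
  exact abs_stepLaw_sub_normDof_le hk hp.1 (Nat.mul_div_le _ _) hp.2 hs hβ P rfl rfl

end stepLimit

/-! ### Exchanging the law of the points one at a time. -/

section boundedDifferences

/-- Replacing the law of independent points, for functions with bounded differences. -/
theorem abs_integral_pi_sub_le {α : Type*} [MeasurableSpace α] (μ ν : Measure α)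
    [IsProbabilityMeasure μ] [IsProbabilityMeasure ν] {δ : ℝ}
    (hδ : ∀ g : α → ℝ, Measurable g → (∀ a, |g a| ≤ 1) → |∫ a, g a ∂μ - ∫ a, g a ∂ν| ≤ δ)
    (m : ℕ) (F : (Fin m → α) → ℝ) (hF : Measurable F) {B : ℝ} (hB : ∀ x, |F x| ≤ B)
    (hL : ∀ x i a, |F (Function.update x i a) - F x| ≤ 1) :
    |∫ x, F x ∂(Measure.pi fun _ => μ) - ∫ x, F x ∂(Measure.pi fun _ => ν)| ≤ m * δ := by
  induction m with
  | zero =>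
    have h : ∀ x, F x = F finZeroElim := fun x => congrArg F (Subsingleton.elim _ _)
    simp only [h]
    simp
  | succ m ih =>
    obtain ⟨a₀⟩ : Nonempty α := nonempty_of_isProbabilityMeasure μ
    have hcons : Measurable fun z : α × (Fin m → α) => (Fin.cons z.1 z.2 : Fin (m + 1) → α) := by
      refine measurable_pi_lambda _ fun i => ?_
      refine Fin.cases ?_ (fun j => ?_) i
      · simpa using measurable_fst
      · simp only [Fin.cons_succ]
        exact (measurable_pi_apply j).comp measurable_snd
    have hG : Measurable fun z : α × (Fin m → α) => F (Fin.cons z.1 z.2) := hF.comp hcons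
    have hsplit : ∀ ρ : Measure α, IsProbabilityMeasure ρ →
        ∫ x, F x ∂(Measure.pi fun _ => ρ) =
          ∫ z : α × (Fin m → α), F (Fin.cons z.1 z.2) ∂(ρ.prod (Measure.pi fun _ => ρ)) := by
      intro ρ _
      have hmp := (measurePreserving_piFinSuccAbove (fun _ : Fin (m + 1) => ρ) 0).symm
      rw [← hmp.integral_comp' (f := (MeasurableEquiv.piFinSuccAbove (fun _ => α) 0).symm)]
      refine integral_congr_ae (ae_of_all _ fun z => congrArg F ?_)
      exact Fin.insertNth_zero' z.1 z.2
    have hint : ∀ (ρ : Measure α) (ρ' : Measure (Fin m → α)), IsProbabilityMeasure ρ →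
        IsProbabilityMeasure ρ' → Integrable (fun z : α × (Fin m → α) => F (Fin.cons z.1 z.2))
          (ρ.prod ρ') := by
      intro ρ ρ' _ _
      exact Integrable.of_bound hG.aestronglyMeasurable B
        (ae_of_all _ fun z => (Real.norm_eq_abs _).trans_le (hB _))
    rw [hsplit μ inferInstance, hsplit ν inferInstance]
    have h1 : |∫ z : α × (Fin m → α), F (Fin.cons z.1 z.2) ∂(μ.prod (Measure.pi fun _ => μ)) -
        ∫ z : α × (Fin m → α), F (Fin.cons z.1 z.2) ∂(ν.prod (Measure.pi fun _ => μ))| ≤ δ := by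
      rw [integral_prod_symm _ (hint _ _ inferInstance inferInstance),
        integral_prod_symm _ (hint _ _ inferInstance inferInstance)]
      refine abs_integral_sub_integral_le
        (hint _ _ inferInstance inferInstance).integral_prod_right
        (hint _ _ inferInstance inferInstance).integral_prod_right fun y => ?_
      have hy : Measurable fun a => F (Fin.cons a y) :=
        hG.comp (measurable_id.prodMk measurable_const)
      have hi : ∀ ρ : Measure α, IsProbabilityMeasure ρ →
          Integrable (fun a => F (Fin.cons a y)) ρ := fun ρ _ =>
        Integrable.of_bound hy.aestronglyMeasurable B
          (ae_of_all _ fun z => (Real.norm_eq_abs _).trans_le (hB _))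
      -- Subtracting the value at a reference point makes the section bounded by 1; the constant
      -- cancels between the two probability laws.
      have h := hδ (fun a => F (Fin.cons a y) - F (Fin.cons a₀ y)) (hy.sub_const _) fun a => by
        have := hL (Fin.cons a₀ y) 0 a
        rwa [Fin.update_cons_zero] at this
      rw [integral_sub (hi μ inferInstance) (integrable_const _),
        integral_sub (hi ν inferInstance) (integrable_const _)] at h
      simpa using h
    have h2 : |∫ z : α × (Fin m → α), F (Fin.cons z.1 z.2) ∂(ν.prod (Measure.pi fun _ => μ)) -
        ∫ z : α × (Fin m → α), F (Fin.cons z.1 z.2) ∂(ν.prod (Measure.pi fun _ => ν))| ≤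
          m * δ := by
      rw [integral_prod _ (hint _ _ inferInstance inferInstance),
        integral_prod _ (hint _ _ inferInstance inferInstance)]
      refine abs_integral_sub_integral_le
        (hint _ _ inferInstance inferInstance).integral_prod_left
        (hint _ _ inferInstance inferInstance).integral_prod_left fun a => ?_
      refine ih (fun y => F (Fin.cons a y)) (hG.comp (measurable_const.prodMk measurable_id))
        (fun _ => hB _) fun y i b => ?_
      rw [Fin.cons_update]
      exact hL _ _ _
    have h3 := abs_sub_le
      (∫ z : α × (Fin m → α), F (Fin.cons z.1 z.2) ∂(μ.prod (Measure.pi fun _ => μ)))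
      (∫ z : α × (Fin m → α), F (Fin.cons z.1 z.2) ∂(ν.prod (Measure.pi fun _ => μ)))
      (∫ z : α × (Fin m → α), F (Fin.cons z.1 z.2) ∂(ν.prod (Measure.pi fun _ => ν)))
    push_cast
    linarith

end boundedDifferences

/-! ### Integrable functions oscillate little on small cells. -/

section oscillation

variable {d k : ℕ}

theorem ae_mem_cube (d : ℕ) : ∀ᵐ y ∂(cubeLaw d), y ∈ cube d := by
  rw [cubeLaw_eq]
  exact ae_restrict_mem (MeasurableSet.univ_pi fun _ => measurableSet_Ico)

theorem integrable_gridPoint (hk : 0 < k) {g : (Fin d → ℝ) → ℝ} (hg : Integrable g (cubeLaw d))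
    (c : Fin d → Fin k) : Integrable (fun y => g (gridPoint c y)) (cubeLaw d) := by
  have := isProbabilityMeasure_uniformCell d hk
  have hg' : Integrable (fun z : (Fin d → Fin k) × (Fin d → ℝ) => g (gridPoint z.1 z.2))
      ((uniformCell d k).prod (cubeLaw d)) :=
    (measurePreserving_gridPoint d hk).integrable_comp_of_integrable hg
  refine (ae_iff_of_countable.1 hg'.prod_right_ae) c fun h => ?_
  have h1 := uniformCell_real_singleton hk c
  rw [measureReal_def, h, ENNReal.toReal_zero] at h1
  have : (0 : ℝ) < ((k : ℝ) ^ d)⁻¹ := by positivity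
  linarith

/-- The mean oscillation of a function over the cells. -/
noncomputable def cellOsc (k : ℕ) (g : (Fin d → ℝ) → ℝ) : ℝ :=
  ((k : ℝ) ^ d)⁻¹ * ∑ c : Fin d → Fin k,
    ∫ y, |g (gridPoint c y) - ∫ y', g (gridPoint c y') ∂(cubeLaw d)| ∂(cubeLaw d)

/-- Passing from g to h changes both the function and its cell means, each at the cost of the L¹
distance; hence the factor 2. -/
theorem cellOsc_le_add (hk : 0 < k) {g h : (Fin d → ℝ) → ℝ} (hg : Integrable g (cubeLaw d))
    (hh : Integrable h (cubeLaw d)) :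
    cellOsc k g ≤ cellOsc k h + 2 * ∫ y, |g y - h y| ∂(cubeLaw d) := by
  have hD : Integrable (fun y => |g y - h y|) (cubeLaw d) := (hg.sub hh).abs
  have hsum := integral_cubeLaw_eq_sum hk hD
  rw [smul_eq_mul] at hsum
  rw [hsum, cellOsc, cellOsc, mul_left_comm, ← mul_add, Finset.mul_sum Finset.univ _ 2,
    ← Finset.sum_add_distrib]
  refine mul_le_mul_of_nonneg_left (Finset.sum_le_sum fun c _ => ?_) (by positivity)
  have hg' := integrable_gridPoint hk hg c
  have hh' := integrable_gridPoint hk hh c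
  have hD' := integrable_gridPoint hk hD c
  set a := ∫ y', g (gridPoint c y') ∂(cubeLaw d)
  set b := ∫ y', h (gridPoint c y') ∂(cubeLaw d)
  set D := ∫ y', |g (gridPoint c y') - h (gridPoint c y')| ∂(cubeLaw d)
  have hab : |a - b| ≤ D := by
    rw [← integral_sub hg' hh']
    exact abs_integral_le_integral_abs
  have h1 : Integrable (fun y => |h (gridPoint c y) - b|) (cubeLaw d) :=
    (hh'.sub (integrable_const _)).abs
  have h3 : Integrable (fun y => |h (gridPoint c y) - b| +
      |g (gridPoint c y) - h (gridPoint c y)|) (cubeLaw d) := h1.add hD'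
  have h2 : ∫ y, |g (gridPoint c y) - a| ∂(cubeLaw d) ≤
      ∫ y, ((|h (gridPoint c y) - b| + |g (gridPoint c y) - h (gridPoint c y)|) + D)
        ∂(cubeLaw d) := by
    refine integral_mono (hg'.sub (integrable_const _)).abs
      (h3.add (integrable_const _)) fun y => ?_
    have e : g (gridPoint c y) - a = (h (gridPoint c y) - b) +
        (g (gridPoint c y) - h (gridPoint c y)) + (b - a) := by ring
    simp only
    rw [e]
    refine (abs_add_le _ _).trans (add_le_add (abs_add_le _ _) ?_)
    rwa [abs_sub_comm]
  refine h2.trans_eq ?_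
  rw [integral_add h3 (integrable_const _), integral_add h1 hD', integral_const,
    probReal_univ, one_smul]
  ring

theorem dist_gridPoint_le (hk : 0 < k) (c : Fin d → Fin k) {y y' : Fin d → ℝ} (hy : y ∈ cube d)
    (hy' : y' ∈ cube d) : dist (gridPoint c y) (gridPoint c y') ≤ (k : ℝ)⁻¹ := by
  refine (dist_pi_le_iff (by positivity)).2 fun j => ?_
  have h1 := hy j (Set.mem_univ j)
  have h2 := hy' j (Set.mem_univ j)
  have hk0 : (0 : ℝ) < k := by exact_mod_cast hk
  simp only [Set.mem_Ico] at h1 h2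
  rw [Real.dist_eq, gridPoint, gridPoint, gridPoint₁_sub, abs_div, abs_of_pos hk0, ← one_div]
  refine div_le_div_of_nonneg_right ?_ hk0.le
  rw [abs_le]
  constructor <;> linarith

/-- Approximate g in L¹ by a compactly supported continuous function, which is uniformly continuous
and so nearly constant on cells of diameter at most 1 / k. -/
theorem tendsto_cellOsc {g : (Fin d → ℝ) → ℝ} (hg : Integrable g (cubeLaw d)) :
    ∀ ε > 0, ∀ᶠ k in atTop, cellOsc k g ≤ ε := by
  intro ε hε
  have hreg : (cubeLaw d).Regular := inferInstance
  obtain ⟨h, hsupp, hle, hcont, hint⟩ :=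
    hg.exists_hasCompactSupport_integral_sub_le (show 0 < ε / 4 by positivity)
  have hunif := hsupp.uniformContinuous_of_continuous hcont
  obtain ⟨δ, hδ, hd⟩ := Metric.uniformContinuous_iff.1 hunif (ε / 2) (by positivity)
  filter_upwards [eventually_gt_atTop 0,
    (tendsto_inv_atTop_nhds_zero_nat (𝕜 := ℝ)).eventually_lt_const hδ] with k hk hkδ
  refine (cellOsc_le_add hk hg hint).trans ?_
  have h1 : cellOsc k h ≤ ε / 2 := by
    have hc : ∀ c : Fin d → Fin k,
        ∫ y, |h (gridPoint c y) - ∫ y', h (gridPoint c y') ∂(cubeLaw d)| ∂(cubeLaw d) ≤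
          ε / 2 := by
      intro c
      have hi := integrable_gridPoint hk hint c
      have hae : ∀ᵐ y ∂(cubeLaw d),
          |h (gridPoint c y) - ∫ y', h (gridPoint c y') ∂(cubeLaw d)| ≤ ε / 2 := by
        filter_upwards [ae_mem_cube d] with y hy
        have e : h (gridPoint c y) - ∫ y', h (gridPoint c y') ∂(cubeLaw d) =
            ∫ y', (h (gridPoint c y) - h (gridPoint c y')) ∂(cubeLaw d) := by
          rw [integral_sub (integrable_const _) hi]
          simp
        rw [e, ← Real.norm_eq_abs]
        refine (norm_integral_le_of_norm_le_const (C := ε / 2) ?_).trans_eq (by simp)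
        filter_upwards [ae_mem_cube d] with y' hy'
        rw [← dist_eq_norm]
        exact (hd ((dist_gridPoint_le hk c hy hy').trans_lt hkδ)).le
      refine (integral_mono_ae (hi.sub (integrable_const _)).abs
        (integrable_const (ε / 2)) hae).trans_eq ?_
      simp
    have hk0 : (0 : ℝ) < (k : ℝ) ^ d := by positivity
    rw [cellOsc, inv_mul_le_iff₀ hk0]
    refine (Finset.sum_le_sum fun c _ => hc c).trans_eq ?_
    simp
  have h2 : ∫ y, |g y - h y| ∂(cubeLaw d) ≤ ε / 4 := hle
  linarith

end oscillation

/-! ### The limit for arbitrary densities. -/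

section densityLimit

open Matrix

variable {d k : ℕ}

/-- The factor m^(-1/2) enters once from each side and becomes the weight s / m. -/
theorem dof_vandermondeFold (n m : ℕ) (s : ℝ) (x : Fin m → Fin d → ℝ) :
    dof ((s : ℂ) • (vandermondeFold d n m x * (vandermondeFold d n m x)ᴴ)) =
      phaseDof n (s / m) x Finset.univ := by
  unfold phaseDof
  congr 1
  ext i j
  simp only [Matrix.smul_apply, mul_apply, conjTranspose_apply, Matrix.sum_apply, vecMulVec_apply,
    Pi.star_apply, smul_eq_mul, Finset.mul_sum]
  refine Finset.sum_congr rfl fun q _ => ?_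
  have hV : ∀ l : Fin d → Fin n, vandermondeFold d n m x l q =
      ((Real.sqrt m : ℝ) : ℂ)⁻¹ * phaseVector n (x q) l := by
    intro l
    rw [vandermondeFold, of_apply, phaseVector, unitExp]
    congr 2
    push_cast
    ring
  have hm : ((s / m : ℝ) : ℂ) =
      s * (((Real.sqrt m : ℝ) : ℂ)⁻¹ * ((Real.sqrt m : ℝ) : ℂ)⁻¹) := by
    rw [← mul_inv, ← Complex.ofReal_mul, Real.mul_self_sqrt (Nat.cast_nonneg m), div_eq_mul_inv]
    push_cast
    rfl
  rw [hV, hV, hm, star_mul', star_inv₀, Complex.star_def, Complex.conj_ofReal]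
  ring

/-- The weights of the cells for the density `g`. -/
noncomputable def cellWeights (k : ℕ) (g : (Fin d → ℝ) → ℝ) : Measure (Fin d → Fin k) :=
  ∑ c, ENNReal.ofReal (((k : ℝ) ^ d)⁻¹ * ∫ y, g (gridPoint c y) ∂(cubeLaw d)) • Measure.dirac c

theorem cellWeights_singleton (g : (Fin d → ℝ) → ℝ) (c : Fin d → Fin k) :
    cellWeights k g {c} =
      ENNReal.ofReal (((k : ℝ) ^ d)⁻¹ * ∫ y, g (gridPoint c y) ∂(cubeLaw d)) := by
  rw [cellWeights, Measure.finsetSum_apply, Finset.sum_eq_single c]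
  · simp
  · intro b _ hb
    simp [hb]
  · simp

section

variable {g : (Fin d → ℝ) → ℝ}

theorem cellWeights_real_singleton (h0 : ∀ z, 0 ≤ g z) (c : Fin d → Fin k) :
    (cellWeights k g).real {c} = ((k : ℝ) ^ d)⁻¹ * ∫ y, g (gridPoint c y) ∂(cubeLaw d) := by
  rw [measureReal_def, cellWeights_singleton, ENNReal.toReal_ofReal]
  exact mul_nonneg (by positivity) (integral_nonneg fun y => h0 _)

theorem isProbabilityMeasure_cellWeights (hk : 0 < k) (h0 : ∀ z, 0 ≤ g z)
    (hg : Integrable g (cubeLaw d)) (h1 : ∫ z, g z ∂(cubeLaw d) = 1) :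
    IsProbabilityMeasure (cellWeights k g) := by
  refine ⟨?_⟩
  rw [← Finset.coe_univ, ← sum_measure_singleton]
  simp only [cellWeights_singleton]
  rw [← ENNReal.ofReal_sum_of_nonneg fun c _ =>
    mul_nonneg (by positivity) (integral_nonneg fun y => h0 _), ← Finset.mul_sum, ← smul_eq_mul,
    ← integral_cubeLaw_eq_sum hk hg, h1, ENNReal.ofReal_one]

theorem integral_stepLaw (P : Measure (Fin d → Fin k)) [IsProbabilityMeasure P]
    {φ : (Fin d → ℝ) → ℝ} (hφ : Measurable φ) (hb : ∀ z, |φ z| ≤ 1) :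
    ∫ z, φ z ∂(stepLaw P) = ∑ c, P.real {c} * ∫ y, φ (gridPoint c y) ∂(cubeLaw d) := by
  have hmeas := measurable_gridPoint d k
  have hi : Integrable (fun z : (Fin d → Fin k) × (Fin d → ℝ) => φ (gridPoint z.1 z.2))
      (P.prod (cubeLaw d)) :=
    Integrable.of_bound (hφ.comp hmeas).aestronglyMeasurable 1
      (ae_of_all _ fun z => (Real.norm_eq_abs _).trans_le (hb _))
  rw [stepLaw, integral_map hmeas.aemeasurable hφ.aestronglyMeasurable, integral_prod _ hi,
    integral_fintype .of_finite]
  simp only [smul_eq_mul]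

theorem integral_pointLaw (h0 : ∀ z, 0 ≤ g z) (hg : Integrable g (cubeLaw d))
    (φ : (Fin d → ℝ) → ℝ) : ∫ z, φ z ∂(pointLaw g) = ∫ z, g z * φ z ∂(cubeLaw d) := by
  rw [pointLaw, ← cubeLaw_eq, integral_withDensity_eq_integral_toReal_smul₀
    hg.aemeasurable.ennreal_ofReal (ae_of_all _ fun _ => ENNReal.ofReal_lt_top)]
  refine integral_congr_ae (ae_of_all _ fun z => ?_)
  simp only [ENNReal.toReal_ofReal (h0 z), smul_eq_mul]

/-- Testing the law with density `g` and its cell averages against bounded functions. -/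
theorem abs_integral_pointLaw_sub_stepLaw_le (hk : 0 < k) (h0 : ∀ z, 0 ≤ g z)
    (hg : Integrable g (cubeLaw d)) (h1 : ∫ z, g z ∂(cubeLaw d) = 1)
    {φ : (Fin d → ℝ) → ℝ} (hφ : Measurable φ) (hb : ∀ z, |φ z| ≤ 1) :
    |∫ z, φ z ∂(pointLaw g) - ∫ z, φ z ∂(stepLaw (cellWeights k g))| ≤ cellOsc k g := by
  have := isProbabilityMeasure_cellWeights hk h0 hg h1
  have hgφ : Integrable (fun z => g z * φ z) (cubeLaw d) :=
    hg.mul_bdd (c := 1) hφ.aestronglyMeasurable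
      (ae_of_all _ fun z => (Real.norm_eq_abs _).trans_le (hb z))
  have hK : (0 : ℝ) < ((k : ℝ) ^ d)⁻¹ := by positivity
  rw [integral_stepLaw _ hφ hb, integral_pointLaw h0 hg, integral_cubeLaw_eq_sum hk hgφ, smul_eq_mul,
    cellOsc]
  simp only [cellWeights_real_singleton h0, mul_assoc]
  rw [← Finset.mul_sum, ← mul_sub, ← Finset.sum_sub_distrib, abs_mul, abs_of_pos hK]
  refine mul_le_mul_of_nonneg_left ((Finset.abs_sum_le_sum_abs _ _).trans
    (Finset.sum_le_sum fun c _ => ?_)) hK.le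
  have hi1 := integrable_gridPoint hk hgφ c
  have hi2 := integrable_gridPoint hk hg c
  have hi3 : Integrable (fun y => φ (gridPoint c y)) (cubeLaw d) :=
    Integrable.of_bound (hφ.comp (continuous_gridPoint c).measurable).aestronglyMeasurable 1
      (ae_of_all _ fun z => (Real.norm_eq_abs _).trans_le (hb _))
  rw [← integral_const_mul, ← integral_sub hi1 (hi3.const_mul _)]
  refine abs_integral_le_integral_abs.trans (integral_mono (hi1.sub (hi3.const_mul _)).abs
    (hi2.sub (integrable_const _)).abs fun y => ?_)
  simp only
  rw [← sub_mul, abs_mul]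
  exact mul_le_of_le_one_right (abs_nonneg _) (hb _)

/-- The positive part is needed because the Lipschitz bound is available only for nonnegative point
densities. -/
theorem continuous_limDof_max (hd : 1 ≤ d) {t : ℝ} (ht : 0 ≤ t) :
    Continuous fun ρ : ℝ => limDof d t (max ρ 0) := by
  refine LipschitzWith.continuous (K := 1) (LipschitzWith.of_dist_le_mul fun x y => ?_)
  rw [Real.dist_eq, Real.dist_eq, NNReal.coe_one, one_mul]
  refine (abs_limDof_sub_le hd ht (le_max_right _ _) (le_max_right _ _)).trans ?_
  simpa using abs_max_sub_max_le_abs x y 0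

/-- A 1-Lipschitz function vanishing at 0 is dominated by its argument. -/
theorem integrable_limDof (hd : 1 ≤ d) (h0 : ∀ z, 0 ≤ g z) (hg : Integrable g (cubeLaw d))
    {t β : ℝ} (ht : 0 ≤ t) (hβ : 0 < β) :
    Integrable (fun z => limDof d t (g z / β)) (cubeLaw d) := by
  have e : (fun z => limDof d t (g z / β)) = fun z => limDof d t (max (g z / β) 0) := by
    funext z
    rw [max_eq_left (div_nonneg (h0 z) hβ.le)]
  refine (hg.div_const β).mono ?_ (ae_of_all _ fun z => ?_)
  · rw [e]
    exact (continuous_limDof_max hd ht).comp_aestronglyMeasurable (hg.div_const β).aestronglyMeasurable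
  · have h := abs_limDof_sub_le hd ht (div_nonneg (h0 z) hβ.le) le_rfl
    rwa [limDof_zero hd ht, sub_zero, sub_zero, ← Real.norm_eq_abs, ← Real.norm_eq_abs] at h

/-- k^d times the weight of a cell is the mean of g there, so the Lipschitz bound reduces the
comparison to the oscillation of g. -/
theorem abs_integral_limDof_sub_le (hd : 1 ≤ d) (hk : 0 < k) (h0 : ∀ z, 0 ≤ g z)
    (hg : Integrable g (cubeLaw d)) {t β : ℝ} (ht : 0 ≤ t) (hβ : 0 < β) :
    |((k : ℝ) ^ d)⁻¹ * ∑ c, limDof d t ((k : ℝ) ^ d * (cellWeights k g).real {c} / β) -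
      ∫ z, limDof d t (g z / β) ∂(cubeLaw d)| ≤ cellOsc k g / β := by
  have hK : (0 : ℝ) < (k : ℝ) ^ d := by positivity
  have hi := integrable_limDof hd h0 hg ht hβ
  rw [integral_cubeLaw_eq_sum hk hi, smul_eq_mul, ← mul_sub, ← Finset.sum_sub_distrib, abs_mul,
    abs_of_pos (inv_pos.2 hK), cellOsc, mul_div_assoc, Finset.sum_div]
  refine mul_le_mul_of_nonneg_left ((Finset.abs_sum_le_sum_abs _ _).trans
    (Finset.sum_le_sum fun c _ => ?_)) (inv_pos.2 hK).le
  have hi1 := integrable_gridPoint hk hi c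
  have hi2 := integrable_gridPoint hk hg c
  rw [cellWeights_real_singleton h0, mul_inv_cancel_left₀ hK.ne']
  set a := ∫ y, g (gridPoint c y) ∂(cubeLaw d) with ha
  have ha0 : 0 ≤ a := integral_nonneg fun y => h0 _
  have e : limDof d t (a / β) - ∫ y, limDof d t (g (gridPoint c y) / β) ∂(cubeLaw d) =
      ∫ y, (limDof d t (a / β) - limDof d t (g (gridPoint c y) / β)) ∂(cubeLaw d) := by
    rw [integral_sub (integrable_const _) hi1]
    simp
  rw [e]
  refine abs_integral_le_integral_abs.trans ((integral_mono
    (g := fun y => |g (gridPoint c y) - a| / β) ((integrable_const _).sub hi1).abs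
    ((hi2.sub (integrable_const _)).abs.div_const β) fun y => ?_).trans_eq (integral_div β _))
  refine (abs_limDof_sub_le hd ht (div_nonneg ha0 hβ.le) (div_nonneg (h0 _) hβ.le)).trans_eq ?_
  rw [← sub_div, abs_div, abs_of_pos hβ, abs_sub_comm]

theorem isProbabilityMeasure_pointLaw_of_integral (h0 : ∀ z, 0 ≤ g z)
    (hg : Integrable g (cubeLaw d)) (h1 : ∫ z, g z ∂(cubeLaw d) = 1) :
    IsProbabilityMeasure (pointLaw g) := by
  refine ⟨?_⟩
  rw [pointLaw, ← cubeLaw_eq, withDensity_apply _ MeasurableSet.univ, Measure.restrict_univ,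
    ← ofReal_integral_eq_lintegral_ofReal hg (ae_of_all _ h0), h1, ENNReal.ofReal_one]

/-- The limit of the normalized expected degrees of freedom for points with density `g`. -/
theorem tendsto_phaseDof_pointLaw (hd : 1 ≤ d) (h0 : ∀ z, 0 ≤ g z)
    (hg : Integrable g (cubeLaw d)) (h1 : ∫ z, g z ∂(cubeLaw d) = 1) {s β : ℝ} (hs : 0 < s)
    (hβ : 0 < β) :
    Tendsto (fun p : ℕ × ℕ => ((p.1 : ℝ) ^ d)⁻¹ * ∫ x : Fin p.2 → Fin d → ℝ,
        phaseDof p.1 (s / p.2) x Finset.univ ∂(Measure.pi fun _ => pointLaw g)) (aspectFilter d β)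
      (𝓝 (∫ z, limDof d (s * β) (g z / β) ∂(cubeLaw d))) := by
  have hβi : 0 < β⁻¹ := inv_pos.2 hβ
  have := isProbabilityMeasure_pointLaw_of_integral h0 hg h1
  refine Metric.tendsto_nhds.2 fun ε hε => ?_
  -- The partition is fixed before n and m grow. Changing the law of the points will cost (β⁻¹ + 1)δ
  -- and changing the limit β⁻¹δ, together ε / 2.
  set δ := ε / (2 * (β⁻¹ + 1 + β⁻¹)) with hδ
  have hδ0 : 0 < δ := by positivity
  obtain ⟨k, hkδ, hk⟩ := ((tendsto_cellOsc hg δ hδ0).and (eventually_gt_atTop 0)).exists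
  have := isProbabilityMeasure_cellWeights hk h0 hg h1
  have hstep := tendsto_phaseDof_stepLaw hd hk hs hβ (cellWeights k g)
  have hlim := abs_integral_limDof_sub_le hd hk h0 hg (mul_pos hs hβ).le hβ
  have hratio : ∀ᶠ p : ℕ × ℕ in aspectFilter d β, ((p.1 : ℝ) ^ d)⁻¹ * p.2 < β⁻¹ + 1 := by
    have h := ((tendsto_aspectFilter_ratio d β).inv₀ hβ.ne').eventually_lt_const
      (lt_add_one β⁻¹)
    refine h.mono fun p hp => ?_
    rwa [inv_div, div_eq_inv_mul] at hp
  filter_upwards [Metric.tendsto_nhds.1 hstep (ε / 2) (half_pos hε), hratio] with p hp hp'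
  have hsm : 0 ≤ s / p.2 := by positivity
  -- Each of the m points costs at most δ; after division by n^d this stays bounded because m / n^d
  -- tends to 1 / β.
  have hcmp : |∫ x : Fin p.2 → Fin d → ℝ, phaseDof p.1 (s / p.2) x Finset.univ
        ∂(Measure.pi fun _ => pointLaw g) - ∫ x : Fin p.2 → Fin d → ℝ,
        phaseDof p.1 (s / p.2) x Finset.univ ∂(Measure.pi fun _ => stepLaw (cellWeights k g))| ≤
      p.2 * δ := by
    refine abs_integral_pi_sub_le _ _ (fun φ hφ hb =>
      (abs_integral_pointLaw_sub_stepLaw_le hk h0 hg h1 hφ hb).trans hkδ) p.2 _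
      (measurable_phaseDof (fun q => measurable_pi_apply q) _) (B := (p.1 : ℝ) ^ d)
      (fun x => ?_) fun x i a => ?_
    · rw [abs_of_nonneg (phaseDof_nonneg _ _ hsm _)]
      exact phaseDof_le _ _ hsm _
    · exact abs_phaseDof_sub_le _ _ hsm _ i fun q hq => Function.update_of_ne hq _ _
  rw [Real.dist_eq] at hp ⊢
  set A := ∫ x : Fin p.2 → Fin d → ℝ, phaseDof p.1 (s / p.2) x Finset.univ
        ∂(Measure.pi fun _ => pointLaw g)
  set B := ∫ x : Fin p.2 → Fin d → ℝ,
        phaseDof p.1 (s / p.2) x Finset.univ ∂(Measure.pi fun _ => stepLaw (cellWeights k g))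
  set L := ((k : ℝ) ^ d)⁻¹ * ∑ c, limDof d (s * β) ((k : ℝ) ^ d * (cellWeights k g).real {c} / β)
  set L' := ∫ z, limDof d (s * β) (g z / β) ∂(cubeLaw d)
  have e1 : |((p.1 : ℝ) ^ d)⁻¹ * A - ((p.1 : ℝ) ^ d)⁻¹ * B| ≤ (β⁻¹ + 1) * δ := by
    rw [← mul_sub, abs_mul, abs_of_nonneg (by positivity)]
    refine (mul_le_mul_of_nonneg_left hcmp (by positivity)).trans ?_
    rw [← mul_assoc]
    exact mul_le_mul_of_nonneg_right hp'.le hδ0.le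
  have e2 : |L - L'| ≤ β⁻¹ * δ := by
    refine hlim.trans ?_
    rw [div_eq_inv_mul]
    exact mul_le_mul_of_nonneg_left hkδ hβi.le
  have e3 : (β⁻¹ + 1) * δ + β⁻¹ * δ = ε / 2 := by
    rw [hδ]
    field_simp
  have e4 := abs_sub_le (((p.1 : ℝ) ^ d)⁻¹ * A) (((p.1 : ℝ) ^ d)⁻¹ * B) L'
  have e5 := abs_sub_le (((p.1 : ℝ) ^ d)⁻¹ * B) L L'
  linarith

end

/-- Every density has a limiting spectral distribution, with the ridge integrals given by the
local densities of points. -/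
theorem IsDensityOnCube.exists_isLSD (hd : 1 ≤ d) {f : (Fin d → ℝ) → ℝ} (hf : IsDensityOnCube f)
    {β : ℝ} (hβ : 0 < β) :
    ∃ μ : Measure ℝ, IsLSD f β μ ∧ μ (Set.Iio 0) = 0 ∧ ∀ s : ℝ, 0 < s →
      ∫ x, ridge s x ∂μ = ∫ z in cube d, limDof d (s * β) (f z / β) := by
  refine exists_isLSD_of_tendsto_dof hd hf hβ fun s hs => ?_
  -- Off the cube f may be negative. The positive part is nonnegative everywhere and gives the same
  -- law, since `ENNReal.ofReal` truncates.
  set g : (Fin d → ℝ) → ℝ := fun z => max (f z) 0 with hgdef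
  have hfg : ∀ z ∈ cube d, f z = g z := fun z hz => (max_eq_left (hf.nonneg z hz)).symm
  have hmeas : MeasurableSet (cube d) := MeasurableSet.univ_pi fun _ => measurableSet_Ico
  have h0 : ∀ z, 0 ≤ g z := fun z => le_max_right _ _
  have hpl : pointLaw f = pointLaw g := by
    unfold pointLaw
    congr 1
    funext z
    rw [hgdef]
    simp [ENNReal.ofReal_max]
  have hgm : AEMeasurable g (cubeLaw d) := by
    rw [cubeLaw_eq]
    exact hf.aemeasurable.max aemeasurable_const
  have hlin : ∫⁻ z, ENNReal.ofReal (g z) ∂(cubeLaw d) = 1 := by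
    rw [← hf.lintegral_eq_one, cubeLaw_eq]
    exact setLIntegral_congr_fun hmeas fun z hz => by simp only [hfg z hz]
  have hg : Integrable g (cubeLaw d) := by
    refine ⟨hgm.aestronglyMeasurable, ?_⟩
    rw [hasFiniteIntegral_iff_ofReal (ae_of_all _ h0), hlin]
    exact ENNReal.one_lt_top
  have h1 : ∫ z, g z ∂(cubeLaw d) = 1 := by
    rw [integral_eq_lintegral_of_nonneg_ae (ae_of_all _ h0) hgm.aestronglyMeasurable, hlin,
      ENNReal.toReal_one]
  have hR : ∫ z in cube d, limDof d (s * β) (f z / β) =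
      ∫ z, limDof d (s * β) (g z / β) ∂(cubeLaw d) := by
    rw [cubeLaw_eq]
    exact setIntegral_congr_fun hmeas fun z hz => by simp only [hfg z hz]
  simp only [dof_vandermondeFold]
  rw [hR, hpl]
  exact tendsto_phaseDof_pointLaw hd h0 hg h1 hs hβ

end densityLimit

/-! ### Scaled versions and the transformed law. -/

section scaledVersion

variable {d : ℕ} {f f' : (Fin d → ℝ) → ℝ} {C : Set (Fin d → ℝ)}

theorem measurableSet_cube (d : ℕ) : MeasurableSet (cube d) :=
  MeasurableSet.univ_pi fun _ => measurableSet_Ico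

theorem volume_cube (d : ℕ) : volume (cube d) = 1 := by
  rw [cube, Real.volume_pi_Ico]
  norm_num

/-- Split the cube along C. On C, S pushes Lebesgue measure to |C| times Lebesgue measure on the
cube, which cancels the prefactor of f'. -/
theorem IsDensityOnCube.of_isScaledVersion (hf : IsDensityOnCube f) (hCmeas : MeasurableSet C)
    (hC : C ⊆ cube d) (hcpos : 0 < volume.real C) (hf' : IsScaledVersion f f' C) :
    IsDensityOnCube f' := by
  obtain ⟨S, hmaps, hS, hon, hoff⟩ := hf'
  have hvol : volume C ≠ ⊤ :=
    ((measure_mono hC).trans_lt ((volume_cube d).trans_lt ENNReal.one_lt_top)).ne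
  have hfS : AEMeasurable (fun z => f (S z)) (volume.restrict C) :=
    (hf.aemeasurable.smul_measure (volume C)).comp_quasiMeasurePreserving hS.quasiMeasurePreserving
  refine ⟨?_, fun z hz => ?_, ?_⟩
  · rw [← Set.union_sdiff_cancel hC, aemeasurable_union_iff]
    refine ⟨(hfS.const_mul (volume.real C)⁻¹).congr ?_, (aemeasurable_const (b := (0 : ℝ))).congr ?_⟩
    · filter_upwards [ae_restrict_mem hCmeas] with z hz
      exact (hon z hz).symm
    · filter_upwards [ae_restrict_mem ((measurableSet_cube d).diff hCmeas)] with z hz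
      exact (hoff z hz).symm
  · by_cases h : z ∈ C
    · rw [hon z h]
      exact mul_nonneg (inv_nonneg.2 hcpos.le) (hf.nonneg _ (hmaps h))
    · exact (hoff z ⟨hz, h⟩).ge
  · rw [← lintegral_inter_add_sdiff _ (cube d) hCmeas, Set.inter_eq_right.2 hC,
      setLIntegral_congr_fun (g := fun _ => 0) ((measurableSet_cube d).diff hCmeas)
        (fun z hz => by simp only [hoff z hz, ENNReal.ofReal_zero]),
      setLIntegral_congr_fun (g := fun z => ENNReal.ofReal (volume.real C)⁻¹ *
        ENNReal.ofReal (f (S z))) hCmeas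
        (fun z hz => by simp only [hon z hz, ENNReal.ofReal_mul (inv_nonneg.2 hcpos.le)]),
      lintegral_const_mul'' _ hfS.ennreal_ofReal, lintegral_zero, add_zero]
    have h1 : ∫⁻ z in C, ENNReal.ofReal (f (S z)) = volume C := by
      rw [← lintegral_map' (f := fun z => ENNReal.ofReal (f z)) (g := S) ?_ hS.measurable.aemeasurable,
        hS.map_eq, lintegral_smul_measure, hf.lintegral_eq_one, smul_eq_mul, mul_one]
      rw [hS.map_eq]
      exact (hf.aemeasurable.smul_measure (volume C)).ennreal_ofReal
    rw [h1, ← ENNReal.ofReal_toReal hvol, ← measureReal_def, ← ENNReal.ofReal_mul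
      (inv_nonneg.2 hcpos.le), inv_mul_cancel₀ hcpos.ne', ENNReal.ofReal_one]

/-- Integrals of functions of a scaled version. -/
theorem IsScaledVersion.setIntegral_comp (hCmeas : MeasurableSet C) (hC : C ⊆ cube d)
    (hf' : IsScaledVersion f f' C) {Φ : ℝ → ℝ} (h0 : Φ 0 = 0)
    (hΦ : AEStronglyMeasurable (fun z => Φ ((volume.real C)⁻¹ * f z)) (volume.restrict (cube d))) :
    ∫ z in cube d, Φ (f' z) = volume.real C * ∫ z in cube d, Φ ((volume.real C)⁻¹ * f z) := by
  obtain ⟨S, -, hS, hon, hoff⟩ := hf'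
  rw [setIntegral_eq_of_subset_of_forall_sdiff_eq_zero (measurableSet_cube d) hC
      (fun z hz => by rw [hoff z hz, h0]),
    setIntegral_congr_fun (g := fun z => Φ ((volume.real C)⁻¹ * f (S z))) hCmeas
      (fun z hz => by simp only [hon z hz]),
    ← integral_map (f := fun z => Φ ((volume.real C)⁻¹ * f z)) hS.measurable.aemeasurable ?_,
    hS.map_eq, integral_smul_measure, smul_eq_mul, measureReal_def]
  rw [hS.map_eq]
  exact hΦ.smul_measure _

theorem IsDensityOnCube.aestronglyMeasurable_limDof (hd : 1 ≤ d) (hf : IsDensityOnCube f)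
    {t b : ℝ} (ht : 0 ≤ t) (hb : 0 ≤ b) :
    AEStronglyMeasurable (fun z => limDof d t (b * f z)) (volume.restrict (cube d)) := by
  refine ((continuous_limDof_max hd ht).comp_aestronglyMeasurable
    (hf.aemeasurable.const_mul b).aestronglyMeasurable).congr ?_
  filter_upwards [ae_restrict_mem (measurableSet_cube d)] with z hz
  rw [max_eq_left (mul_nonneg hb (hf.nonneg z hz))]

theorem ridge_div {c : ℝ} (hc : 0 < c) (s x : ℝ) : ridge s (x / c) = ridge (s / c) x := by
  have h : max (x / c) 0 = max x 0 / c := by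
    rw [← zero_div c, max_div_div_right hc.le, zero_div]
  have h' : s * (max x 0 / c) = s / c * max x 0 := by ring
  rw [ridge, ridge, h, h']

/-- Since c² · c⁻¹ = c, the measure is (1 - c)δ₀ + c Law(λ / c). The test functions vanish at 0, so
the atom is invisible, and dilating the spectrum by 1 / c rescales their parameter to s / c. -/
theorem smul_dirac_add_smul_dilatedDensity {c : ℝ} (hc : 0 < c) (hc1 : c ≤ 1) {μ : Measure ℝ}
    [IsProbabilityMeasure μ] (hμ : μ (Set.Iio 0) = 0) :
    IsProbabilityMeasure (ENNReal.ofReal (1 - c) • Measure.dirac (0 : ℝ) +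
        ENNReal.ofReal (c ^ 2) • dilatedDensity c μ) ∧
      (ENNReal.ofReal (1 - c) • Measure.dirac (0 : ℝ) +
        ENNReal.ofReal (c ^ 2) • dilatedDensity c μ) (Set.Iio 0) = 0 ∧
      ∀ s : ℝ, 0 ≤ s → ∫ x, ridge s x ∂(ENNReal.ofReal (1 - c) • Measure.dirac (0 : ℝ) +
        ENNReal.ofReal (c ^ 2) • dilatedDensity c μ) = c * ∫ x, ridge (s / c) x ∂μ := by
  have hdiv : Measurable fun t : ℝ => t / c := measurable_id.div_const c
  have hmap : ENNReal.ofReal (c ^ 2) • dilatedDensity c μ =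
      ENNReal.ofReal c • μ.map fun t => t / c := by
    rw [dilatedDensity, smul_smul, ← ENNReal.ofReal_mul (by positivity)]
    congr 2
    field_simp
  have := Measure.isProbabilityMeasure_map (μ := μ) hdiv.aemeasurable
  rw [hmap]
  refine ⟨⟨?_⟩, ?_, fun s hs => ?_⟩
  · simp only [Measure.add_apply, Measure.smul_apply, measure_univ, smul_eq_mul, mul_one]
    rw [← ENNReal.ofReal_add (by linarith) hc.le, sub_add_cancel, ENNReal.ofReal_one]
  · have hpre : (fun t : ℝ => t / c) ⁻¹' Set.Iio 0 = Set.Iio 0 := by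
      ext t
      simp [div_neg_iff, hc, not_lt.2 hc.le]
    simp [Measure.map_apply hdiv measurableSet_Iio, hpre, hμ]
  · have hr := (continuous_ridge hs).measurable
    rw [integral_add_measure
      ((integrable_ridge hs _).smul_measure ENNReal.ofReal_ne_top)
      ((integrable_ridge hs _).smul_measure ENNReal.ofReal_ne_top), integral_smul_measure,
      integral_smul_measure, integral_dirac, integral_map hdiv.aemeasurable
      hr.aestronglyMeasurable]
    simp only [ridge_div hc, ENNReal.toReal_ofReal hc.le, smul_eq_mul]
    simp [ridge]

end scaledVersion

/-! ### The scaling identity. -/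

theorem corollary1 {d : ℕ} (hd : 1 ≤ d) {f f' : (Fin d → ℝ) → ℝ} {C : Set (Fin d → ℝ)}
    {c β : ℝ}
    (hf : IsDensityOnCube f) (hfpos : ∀ z ∈ cube d, 0 < f z)
    (hCmeas : MeasurableSet C) (hC : C ⊆ cube d)
    (hc : c = volume.real C) (hcpos : 0 < c)
    (hf' : IsScaledVersion f f' C) (hβ : 0 < β) :
    IsDensityOnCube f' ∧
      (∃ μ : Measure ℝ, IsLSD f (c * β) μ) ∧
      ∀ μ : Measure ℝ, IsLSD f (c * β) μ →
        IsLSD f' β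
          (ENNReal.ofReal (1 - c) • Measure.dirac (0 : ℝ) +
            ENNReal.ofReal (c ^ 2) • dilatedDensity c μ) := by
  have hd' := hf.of_isScaledVersion hCmeas hC (hc ▸ hcpos) hf'
  obtain ⟨μ₀, hμ₀, hneg, hridge⟩ := hf.exists_isLSD hd (mul_pos hcpos hβ)
  refine ⟨hd', ⟨μ₀, hμ₀⟩, fun μ hμ => ?_⟩
  obtain rfl := hμ.unique hd (mul_pos hcpos hβ) hμ₀
  obtain ⟨ν, hν, hνneg, hνridge⟩ := hd'.exists_isLSD hd hβ
  have := hμ.isProbabilityMeasure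
  have := hν.isProbabilityMeasure
  have hc1 : c ≤ 1 := by
    rw [hc, measureReal_def]
    refine ENNReal.toReal_le_of_le_ofReal zero_le_one ?_
    rw [ENNReal.ofReal_one, ← volume_cube d]
    exact measure_mono hC
  obtain ⟨hprob, hnull, hint⟩ := smul_dirac_add_smul_dilatedDensity hcpos hc1 hneg
  -- It suffices to identify the claimed law with the limit ν already known to exist for f', by
  -- matching ridge integrals.
  have heq : ENNReal.ofReal (1 - c) • Measure.dirac (0 : ℝ) +
      ENNReal.ofReal (c ^ 2) • dilatedDensity c μ = ν := by
    refine ext_of_integral_ridge hnull hνneg fun s hs => ?_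
    have hsβ : 0 ≤ s * β := by positivity
    have hΦ : ∀ z, limDof d (s * β) ((volume.real C)⁻¹ * f z / β) =
        limDof d (s * β) ((c * β)⁻¹ * f z) := by
      intro z
      rw [← hc]
      congr 1
      field_simp
    have hscale := hf'.setIntegral_comp hCmeas hC (Φ := fun ρ => limDof d (s * β) (ρ / β))
      (by rw [zero_div, limDof_zero hd hsβ]) (by
        simp only [hΦ]
        exact hf.aestronglyMeasurable_limDof hd hsβ (by positivity))
    rw [hint s hs.le, hνridge s hs, hscale, hridge _ (div_pos hs hcpos), ← hc]
    -- The parameter s / c at ratio cβ gives the same weight as the parameter s at ratio β, so both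
    -- sides involve one and the same function of the point density.
    have e : s / c * (c * β) = s * β := by field_simp
    simp only [← hc] at hΦ
    simp only [hΦ, e, div_eq_inv_mul (f _) (c * β)]
  rw [heq]
  exact hν
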